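/- Let $S$ be a closed oriented smooth surface with universal covering $\widetilde S\to S$ and deck group $\pi_1(S)$. A \emph{complex metric} on $S$ is a smooth non-degenerate symmetric $\mathbb C$-bilinear form $g$ on $\mathbb C TS=TS\otimes\mathbb C$; it is \emph{positive} if at each point $p$ no isotropic direction of $g_p$ is real and its two isotropic directions lie in different components of $\mathbb P(\mathbb C T_pS)\setminus\mathbb P(T_pS)$. Its Levi-Civita connection $\nabla^g$, Gauss curvature $\mathrm K_g$, Laplacian $\Delta_g=\mathrm{tr}_g\mathrm{Hess}_g$ and induced pairing of tensors are defined by the formulas of Riemannian geometry. Let $c_1$ and $\overline{c_2}$ be complex structures on $S$ inducing the given and the opposite orientation respectively; $g$ has conformal class $(c_1,\overline{c_2})$ if $g=\lambda\,dz\,d\overline w$, $\lambda\neq0$, for holomorphic coordinates $z$ of $c_1$ and $\overline w$ of $\overline{c_2}$, where $dz\,d\overline w=\frac12(dz\otimes d\overline w+d\overline w\otimes dz)$. The metric volume form of such a $g$ compatible with the orientation is $dV_g=\frac i2\lambda\,dz\wedge d\overline w$. A map $\sigma\colon\widetilde S\to\mathbb C^3$ with transversal field $\xi\colon\widetilde S\to\mathbb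 C^3$ (both smooth, and $\sigma_*(\mathbb CT\widetilde S)\oplus\mathbb C\xi=\mathbb C^3$ at each point, with $\sigma_*$ injective on $\mathbb CT\widetilde S$), equivariant for some $\rho\colon\pi_1(S)\to\mathrm{SL}(3,\mathbb C)$, is decomposed as $$D_XY=\nabla_XY+g(X,Y)\,\xi,\qquad D_X\xi=-\mathsf S(X)+\tau(X)\,\xi .$$ It is a \emph{positive hyperbolic complex affine sphere} with Blaschke metric $g$ if $g$ is a positive complex metric, the form $\theta=\omega(\cdot,\cdot,\xi)$, $\omega=dz_1\wedge dz_2\wedge dz_3$, satisfies $\nabla\theta=0$ and $\theta=dV_g$, and $\mathsf S=-\mathrm{id}$. The affine normals then meet in one point, which is normalized to be the origin, so that $\xi=\sigma$. The Pick tensor is $C(X,Y,Z)=-2g(\nabla_XY-\nabla^g_XY,Z)$. Let $\mathcal Q_1$ and $\overline{\mathcal Q_2}$ be holomorphic cubic differentials for $c_1$ and $\overline{c_2}$ respectively. (1) Let $g$ be a positive complex metric on $S$ with conformal class $(c_1,\overline{c_2})$. There exists an equivariant positive hyperbolic complex affine sphere $\sigma\colon\widetilde S\to\mathbb C^3$ with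 holonomy in $\mathrm{SL}(3,\mathbb C)$, Blaschke metric $g$ and Pick tensor $\mathcal Q_1+\overline{\mathcal Q_2}$ if and only if $$\mathrm K_g=-1+\tfrac14\,g(\mathcal Q_1,\overline{\mathcal Q_2}).$$ Moreover, any two such complex affine spheres differ by composition with an element of $\mathrm{SL}(3,\mathbb C)$. (2) Let $h$ be the Bers metric of $(c_1,\overline{c_2})$, that is, $h=-\frac{4}{(f_1-\overline{f_2})^2}\,df_1\,d\overline{f_2}$, where $f_1\colon(\widetilde S,c_1)\to\Omega^+$ and $\overline{f_2}\colon(\widetilde S,\overline{c_2})\to\Omega^-$ are biholomorphisms, equivariant for a homomorphism $\pi_1(S)\to\mathrm{PSL}(2,\mathbb C)$ that preserves a Jordan curve in $\mathbb{CP}^1$, onto the two domains complementary to the curve. Let $u\colon S\to\mathbb C$ be smooth. Then $g=e^{2u}h$ and $C=\mathcal Q_1+\overline{\mathcal Q_2}$ are the Blaschke metric and the Pick tensor of an equivariant positive hyperbolic complex affine sphere in $\mathbb C^3$ if and only if $$\Delta_hu-e^{2u}+\tfrac14\,h(\mathcal Q_1,\overline{\mathcal Q_2})\,e^{-4u}+1=0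 .$$ -/

import Mathlib

open scoped Manifold ContDiff Topology
open Set

noncomputable section

namespace CAS

/-! ### Calculus in coordinates -/

/-- The model plane `ℝ²`. -/
abbrev Plane : Type := EuclideanSpace ℝ (Fin 2)

/-- The partial derivative `∂ᵢ f` of a vector-valued function on the plane. -/
def pd {V : Type*} [NormedAddCommGroup V] [NormedSpace ℝ V]
    (i : Fin 2) (f : Plane → V) (y : Plane) : V :=
  fderiv ℝ f y (EuclideanSpace.single i 1)

/-- Christoffel symbols `Γᵏᵢⱼ` of the Levi-Civita connection of a complex metric `∑ Gᵢⱼ dxᵢ dxⱼ`. -/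
def christoffel (G : Plane → Matrix (Fin 2) (Fin 2) ℂ) (k i j : Fin 2) (y : Plane) : ℂ :=
  (1 / 2) * ∑ l, (G y)⁻¹ k l *
    (pd i (fun y' => G y' j l) y + pd j (fun y' => G y' i l) y - pd l (fun y' => G y' i j) y)

/-- The `∂ₗ`-component of `R(∂ᵢ, ∂ⱼ)∂ₖ`, where `R(X, Y)Z = ∇_X ∇_Y Z - ∇_Y ∇_X Z - ∇_[X,Y] Z`
for the Levi-Civita connection of `G`. -/
def riemann (G : Plane → Matrix (Fin 2) (Fin 2) ℂ) (l i j k : Fin 2) (y : Plane) : ℂ :=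
  pd i (christoffel G l j k) y - pd j (christoffel G l i k) y
    + ∑ m, (christoffel G l i m y * christoffel G m j k y
      - christoffel G l j m y * christoffel G m i k y)

/-- Gauss curvature `g(R(∂₀, ∂₁)∂₁, ∂₀) / (g₀₀ g₁₁ - g₀₁²)`. -/
def curvature (G : Plane → Matrix (Fin 2) (Fin 2) ℂ) (y : Plane) : ℂ :=
  (∑ l, riemann G l 0 1 1 y * G y l 0) / (G y).det

/-- The Laplacian: the `G`-trace of the Hessian `∂ᵢ∂ⱼf - Γᵏᵢⱼ ∂ₖf`. -/
def laplacian (G : Plane → Matrix (Fin 2) (Fin 2) ℂ) (f : Plane → ℂ) (y : Plane) : ℂ :=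
  ∑ i, ∑ j, (G y)⁻¹ i j * (pd i (pd j f) y - ∑ k, christoffel G k i j y * pd k f y)

/-- A complex vector `v₀∂₀ + v₁∂₁` is isotropic for the symmetric bilinear form `G`. -/
def IsIsotropic (G : Matrix (Fin 2) (Fin 2) ℂ) (v : Fin 2 → ℂ) : Prop :=
  v ⬝ᵥ G.mulVec v = 0

/-- `Im(v̄₀ v₁)`. It vanishes exactly when the complex line spanned by `v ≠ 0` is the
complexification of a real line, and its sign tells the two components of `ℙ(ℂ²) ∖ ℙ(ℝ²)`
apart (it is positive at `∂₀ + i∂₁`, which is proportional to the vector field `∂/∂z̄` of the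
standard complex structure). -/
def side (v : Fin 2 → ℂ) : ℝ := ((starRingEnd ℂ) (v 0) * v 1).im

/-- Positivity of a complex bilinear form on `ℂ ⊗ ℝ²`: no isotropic direction is real, and
the two components of the complement of the real directions each contain one. -/
def IsPositiveForm (G : Matrix (Fin 2) (Fin 2) ℂ) : Prop :=
  (∀ v, v ≠ 0 → IsIsotropic G v → side v ≠ 0) ∧
  (∃ v, IsIsotropic G v ∧ 0 < side v) ∧ (∃ v, IsIsotropic G v ∧ side v < 0)

/-- `s dx₀ ∧ dx₁` is the metric volume form of the positive form `G` compatible with the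
orientation: `s² = det G`, and the square root is the one for which
`dV(v, v') = i G(v, v')` when `v`, `v'` are isotropic on the negative and on the positive side.
It is the branch that depends continuously on the positive form `G` and that has `s > 0` when
`G` is a Riemannian metric; for `G = λ dz dw̄` it is the form `(i/2) λ dz ∧ dw̄`. -/
def IsVolumeCoeff (G : Matrix (Fin 2) (Fin 2) ℂ) (s : ℂ) : Prop :=
  s ^ 2 = G.det ∧
  ∀ v v' : Fin 2 → ℂ, IsIsotropic G v → IsIsotropic G v' → side v < 0 → 0 < side v' →
    s * (v 0 * v' 1 - v 1 * v' 0) = Complex.I * (v ⬝ᵥ G.mulVec v')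

/-! ### Tensors on a surface -/

section Tensors

variable {S : Type*} [TopologicalSpace S] [ChartedSpace Plane S]

variable (S) in
/-- The atlas of the surface is oriented: all its transition maps preserve orientation. -/
def IsOrientedAtlas : Prop :=
  ∀ e ∈ atlas Plane S, ∀ e' ∈ atlas Plane S, ∀ y ∈ (e.symm ≫ₕ e').source,
    0 < (fderiv ℝ (e' ∘ e.symm) y).det

variable (S) in
/-- Covariant `k`-tensor fields on the complexified tangent bundle. A `ℂ`-multilinear form on
`ℂ ⊗ TₓS` is the same as an `ℝ`-multilinear `ℂ`-valued form on `TₓS`. -/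
abbrev CTensor (k : ℕ) : Type _ :=
  ∀ x : S, MultilinearMap ℝ (fun _ : Fin k => TangentSpace (𝓡 2) x) ℂ

/-- The components `T(∂_{i₁}, …, ∂_{iₖ})` of a tensor field in the chart `e`, at the point of
the surface with coordinates `y`. -/
def CTensor.coeff {k : ℕ} (T : CTensor S k) (e : OpenPartialHomeomorph S Plane) (y : Plane)
    (i : Fin k → Fin 2) : ℂ :=
  T (e.symm y) fun a => mfderiv (𝓡 2) (𝓡 2) e.symm y (EuclideanSpace.single (i a) (1 : ℝ))

/-- A tensor field is smooth if its components in all charts are. -/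
def CTensor.IsSmooth {k : ℕ} (T : CTensor S k) : Prop :=
  ∀ e ∈ atlas Plane S, ∀ i, ContDiffOn ℝ ∞ (fun y => T.coeff e y i) e.target

/-- The matrix `g(∂ᵢ, ∂ⱼ)` of a bilinear form in the chart `e`. -/
def gram (g : CTensor S 2) (e : OpenPartialHomeomorph S Plane) (y : Plane) :
    Matrix (Fin 2) (Fin 2) ℂ :=
  Matrix.of fun i j => g.coeff e y ![i, j]

/-- Positive complex metrics: smooth sections of `Sym²(ℂT*S)` that are non-degenerate and
positive at each point. -/
structure IsPositiveComplexMetric (g : CTensor S 2) : Prop where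
  symm : ∀ x v w, g x ![v, w] = g x ![w, v]
  smooth : g.IsSmooth
  nondegenerate : ∀ e ∈ atlas Plane S, ∀ y ∈ e.target, (gram g e y).det ≠ 0
  positive : ∀ e ∈ atlas Plane S, ∀ y ∈ e.target, IsPositiveForm (gram g e y)

/-- The pairing `g(Q, Q')` of two cubic tensors, in the chart `e`, induced by `g`. -/
def cubicPairing (g : CTensor S 2) (Q Q' : CTensor S 3)
    (e : OpenPartialHomeomorph S Plane) (y : Plane) : ℂ :=
  ∑ i : Fin 3 → Fin 2, ∑ j : Fin 3 → Fin 2,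
    (∏ a, (gram g e y)⁻¹ (i a) (j a)) * Q.coeff e y i * Q'.coeff e y j

/-- The equation `K_g = -1 + ¼ g(Q₁, Q₂)` on the surface. -/
def GaussEquation (g : CTensor S 2) (Q₁ Q₂ : CTensor S 3) : Prop :=
  ∀ e ∈ atlas Plane S, ∀ y ∈ e.target,
    curvature (gram g e) y = -1 + (1 / 4) * cubicPairing g Q₁ Q₂ e y

/-- The equation `Δ_h u - e^{2u} + ¼ h(Q₁, Q₂) e^{-4u} + 1 = 0` on the surface. -/
def GaussPDE (h : CTensor S 2) (Q₁ Q₂ : CTensor S 3) (u : S → ℂ) : Prop :=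
  ∀ e ∈ atlas Plane S, ∀ y ∈ e.target,
    laplacian (gram h e) (u ∘ e.symm) y - Complex.exp (2 * u (e.symm y))
      + (1 / 4) * cubicPairing h Q₁ Q₂ e y * Complex.exp (-4 * u (e.symm y)) + 1 = 0

/-- The metric `e^{2u} h`. -/
def conformalMetric (u : S → ℂ) (h : CTensor S 2) : CTensor S 2 :=
  fun x => Complex.exp (2 * u x) • h x

/-! ### Complex structures and holomorphic cubic differentials -/

variable (S) in
/-- A complex structure on the surface, compatible with its smooth structure: an atlas of
complex coordinates that are diffeomorphisms onto open sets of `ℂ`, with holomorphic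
transition maps. -/
structure ComplexStructure where
  charts : Set (OpenPartialHomeomorph S ℂ)
  cover : ∀ x, ∃ z ∈ charts, x ∈ z.source
  smooth : ∀ z ∈ charts, ContMDiffOn (𝓡 2) 𝓘(ℝ, ℂ) ∞ z z.source
  smooth_symm : ∀ z ∈ charts, ContMDiffOn 𝓘(ℝ, ℂ) (𝓡 2) ∞ z.symm z.target
  holomorphic : ∀ z ∈ charts, ∀ z' ∈ charts,
    DifferentiableOn ℂ (z' ∘ z.symm) (z.symm ≫ₕ z').source

/-- The Jacobian determinant, in the chart `e`, of a complex coordinate `z`. -/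
def jacobian (z : OpenPartialHomeomorph S ℂ) (e : OpenPartialHomeomorph S Plane)
    (y : Plane) : ℝ :=
  ((starRingEnd ℂ) (pd 0 (z ∘ e.symm) y) * pd 1 (z ∘ e.symm) y).im

/-- The complex structure induces the orientation of `S`. -/
def ComplexStructure.IsCompatible (c : ComplexStructure S) : Prop :=
  ∀ z ∈ c.charts, ∀ e ∈ atlas Plane S, ∀ y ∈ e.target, e.symm y ∈ z.source →
    0 < jacobian z e y

/-- The complex structure induces the opposite orientation, that of `S̄`. -/
def ComplexStructure.IsAntiCompatible (c : ComplexStructure S) : Prop :=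
  ∀ z ∈ c.charts, ∀ e ∈ atlas Plane S, ∀ y ∈ e.target, e.symm y ∈ z.source →
    jacobian z e y < 0

/-- The value `dz(v)` of the differential of a complex coordinate at a tangent vector. -/
def dcoord (z : OpenPartialHomeomorph S ℂ) (x : S) (v : TangentSpace (𝓡 2) x) : ℂ :=
  mfderiv (𝓡 2) 𝓘(ℝ, ℂ) z x v

/-- `g` has conformal class `(c₁, c₂)`: for holomorphic coordinates `z` of `c₁` and `w` of `c₂`
one has `g = λ dz dw` with `λ ≠ 0` (here `dz dw` is the symmetric product
`½ (dz ⊗ dw + dw ⊗ dz)`). For `c₂` of the opposite orientation, `w` is what is usually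
written `w̄`. -/
def HasConformalClass (g : CTensor S 2) (c₁ c₂ : ComplexStructure S) : Prop :=
  ∀ z ∈ c₁.charts, ∀ w ∈ c₂.charts, ∀ x ∈ z.source ∩ w.source, ∃ l : ℂ, l ≠ 0 ∧
    ∀ v v' : TangentSpace (𝓡 2) x, g x ![v, v'] =
      l * ((1 / 2) * (dcoord z x v * dcoord w x v' + dcoord w x v * dcoord z x v'))

/-- Holomorphic cubic differentials: in each coordinate `z` of the complex structure,
`Q = φ dz³` with `φ` holomorphic. -/
def IsHolomorphicCubic (c : ComplexStructure S) (Q : CTensor S 3) : Prop :=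
  ∀ z ∈ c.charts, ∃ φ : ℂ → ℂ, DifferentiableOn ℂ φ z.target ∧
    ∀ x ∈ z.source, ∀ v : Fin 3 → TangentSpace (𝓡 2) x,
      Q x v = φ (z x) * ∏ a, dcoord z x (v a)

end Tensors

/-! ### Universal cover, equivariance -/

section Cover

variable {S M : Type*} [TopologicalSpace S] [ChartedSpace Plane S] [TopologicalSpace M]

/-- The group of deck transformations of `p`, i.e. the fundamental group of `S` when `p` is the
universal covering. -/
def deckGroup (p : M → S) : Subgroup (M ≃ₜ M) where
  carrier := {d | ∀ x, p (d x) = p x}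
  mul_mem' := by
    intro a b ha hb x
    exact (ha (b x)).trans (hb x)
  one_mem' := fun _ => rfl
  inv_mem' := by
    intro a ha x
    have h := ha (a⁻¹ x)
    have h' : a (a⁻¹ x) = x := a.apply_symm_apply x
    rw [h'] at h
    exact h.symm

/-- `κ` is the lift `e ∘ p`, restricted to an open set on which it is injective, of a chart `e`
of the base. The lifts of the charts of an atlas of `S` form the atlas of the covering space
for which `p` is a local diffeomorphism; in such a chart of `M` the components of the pull-back
of a tensor field of `S` are its components in the chart `e`. -/
def IsLift {H : Type*} [TopologicalSpace H] (p : M → S) (e : OpenPartialHomeomorph S H)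
    (κ : OpenPartialHomeomorph M H) : Prop :=
  ∀ x ∈ κ.source, p x ∈ e.source ∧ κ x = e (p x)

/-- Smoothness of a map on the covering space. -/
def SmoothOnCover {V : Type*} [NormedAddCommGroup V] [NormedSpace ℝ V]
    (p : M → S) (f : M → V) : Prop :=
  ∀ e ∈ atlas Plane S, ∀ κ : OpenPartialHomeomorph M Plane, IsLift p e κ →
    ContDiffOn ℝ ∞ (f ∘ κ.symm) κ.target

/-- Holomorphy of a function on the covering space, for the lift of `c`. -/
def HolomorphicOnCover (p : M → S) (c : ComplexStructure S) (f : M → ℂ) : Prop :=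
  ∀ z ∈ c.charts, ∀ ζ : OpenPartialHomeomorph M ℂ, IsLift p z ζ →
    DifferentiableOn ℂ (f ∘ ζ.symm) ζ.target

/-! ### Bers metrics -/

/-- `h` is the Bers metric of the pair `(c₁, c₂)`: there are a quasi-Fuchsian representation `ρ`
(by Möbius transformations preserving a Jordan curve `γ` of the Riemann sphere) and
`ρ`-equivariant biholomorphisms `f₁`, `f₂` from the universal cover, with the lifts of `c₁` and
`c₂`, onto the two domains complementary to `γ`, such that `h` lifts to
`-4 / (f₁ - f₂)² df₁ df₂`. This expression is the same in all affine coordinates of the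
sphere, so a coordinate whose point at infinity lies on `γ` is used. -/
def IsBersMetric (p : M → S) (c₁ c₂ : ComplexStructure S) (h : CTensor S 2) : Prop :=
  ∃ (γ : Circle → OnePoint ℂ) (ρ : deckGroup p →* Equiv.Perm (OnePoint ℂ)) (f₁ f₂ : M → ℂ),
    (Continuous γ ∧ Function.Injective γ ∧ OnePoint.infty ∈ range γ) ∧
    (∀ d, ∃ A : GL (Fin 2) ℂ, ∀ ζ : OnePoint ℂ, ρ d ζ = A • ζ) ∧
    (∀ d, ρ d '' range γ = range γ) ∧
    (HolomorphicOnCover p c₁ f₁ ∧ HolomorphicOnCover p c₂ f₂) ∧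
    (Function.Injective f₁ ∧ Function.Injective f₂) ∧
    Disjoint (range f₁) (range f₂) ∧
    (OnePoint.some '' range f₁ ∪ OnePoint.some '' range f₂ = (range γ)ᶜ) ∧
    (∀ (d : deckGroup p) (x : M), (f₁ (d.1 x) : OnePoint ℂ) = ρ d (f₁ x : OnePoint ℂ) ∧
      (f₂ (d.1 x) : OnePoint ℂ) = ρ d (f₂ x : OnePoint ℂ)) ∧
    ∀ e ∈ atlas Plane S, ∀ κ : OpenPartialHomeomorph M Plane, IsLift p e κ →
      ∀ y ∈ κ.target, ∀ i j : Fin 2, gram h e y i j =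
        -4 / (f₁ (κ.symm y) - f₂ (κ.symm y)) ^ 2 *
          ((1 / 2) * (pd i (f₁ ∘ κ.symm) y * pd j (f₂ ∘ κ.symm) y
            + pd i (f₂ ∘ κ.symm) y * pd j (f₁ ∘ κ.symm) y))

/-! ### Complex affine immersions and complex affine spheres in `ℂ³` -/

/-- `ℂ³`. -/
abbrev C3 : Type := Fin 3 → ℂ

/-- The matrix with columns `∂₀σ`, `∂₁σ`, `ξ`. -/
def frame (σ ξ : Plane → C3) (y : Plane) : Matrix (Fin 3) (Fin 3) ℂ :=
  Matrix.of fun a b => ![pd 0 σ y, pd 1 σ y, ξ y] b a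

/-- The components of a vector of `ℂ³` in the basis `∂₀σ`, `∂₁σ`, `ξ`. -/
def component (σ ξ : Plane → C3) (y : Plane) (v : C3) : Fin 3 → ℂ :=
  (frame σ ξ y)⁻¹.mulVec v

/-- Coefficients `Γᵏᵢⱼ` of the induced connection:
`∂ᵢ∂ⱼσ = ∑ₖ Γᵏᵢⱼ ∂ₖσ + gᵢⱼ ξ`. -/
def inducedConnection (σ ξ : Plane → C3) (k i j : Fin 2) (y : Plane) : ℂ :=
  component σ ξ y (pd i (pd j σ) y) k.castSucc

/-- Coefficients `gᵢⱼ` of the affine fundamental form. -/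
def fundamentalForm (σ ξ : Plane → C3) (i j : Fin 2) (y : Plane) : ℂ :=
  component σ ξ y (pd i (pd j σ) y) 2

/-- Coefficients `Sᵏᵢ` of the shape operator: `∂ᵢξ = -∑ₖ Sᵏᵢ ∂ₖσ + τᵢ ξ`. -/
def shapeOperator (σ ξ : Plane → C3) (k i : Fin 2) (y : Plane) : ℂ :=
  -component σ ξ y (pd i ξ y) k.castSucc

/-- The coefficient `θ(∂₀, ∂₁) = ω(∂₀σ, ∂₁σ, ξ)` of the induced complex volume form, where
`ω = dz₁ ∧ dz₂ ∧ dz₃`. -/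
def inducedVolume (σ ξ : Plane → C3) (y : Plane) : ℂ := (frame σ ξ y).det

/-- `(σ, ξ)` is a complex affine immersion: `σ` is a smooth admissible immersion and `ξ` a smooth
transversal vector field, i.e. `∂₀σ`, `∂₁σ`, `ξ` form a basis of `ℂ³` over `ℂ`. -/
structure IsComplexAffineImmersion (p : M → S) (σ ξ : M → C3) : Prop where
  smooth : SmoothOnCover p σ
  smooth_normal : SmoothOnCover p ξ
  transversal : ∀ e ∈ atlas Plane S, ∀ κ : OpenPartialHomeomorph M Plane, IsLift p e κ →
    ∀ y ∈ κ.target, LinearIndependent ℂ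
      ![pd 0 (σ ∘ κ.symm) y, pd 1 (σ ∘ κ.symm) y, ξ (κ.symm y)]

/-- `(σ, ξ)` is a Blaschke affine immersion with (positive) Blaschke metric `g`: the affine
fundamental form is `g`, the induced volume form `θ` is parallel for the induced connection, and
`θ` is the metric volume form of `g` compatible with the orientation. -/
structure IsBlaschkeImmersion (p : M → S) (g : CTensor S 2) (σ ξ : M → C3) : Prop
    extends IsComplexAffineImmersion p σ ξ where
  positive : IsPositiveComplexMetric g
  metric : ∀ e ∈ atlas Plane S, ∀ κ : OpenPartialHomeomorph M Plane, IsLift p e κ →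
    ∀ y ∈ κ.target, ∀ i j,
      fundamentalForm (σ ∘ κ.symm) (ξ ∘ κ.symm) i j y = gram g e y i j
  parallel : ∀ e ∈ atlas Plane S, ∀ κ : OpenPartialHomeomorph M Plane, IsLift p e κ →
    ∀ y ∈ κ.target, ∀ i,
      pd i (inducedVolume (σ ∘ κ.symm) (ξ ∘ κ.symm)) y
        - (∑ k, inducedConnection (σ ∘ κ.symm) (ξ ∘ κ.symm) k i k y)
          * inducedVolume (σ ∘ κ.symm) (ξ ∘ κ.symm) y = 0
  volume : ∀ e ∈ atlas Plane S, ∀ κ : OpenPartialHomeomorph M Plane, IsLift p e κ →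
    ∀ y ∈ κ.target,
      IsVolumeCoeff (gram g e y) (inducedVolume (σ ∘ κ.symm) (ξ ∘ κ.symm) y)

/-- `(σ, ξ)` is a positive hyperbolic complex affine sphere with Blaschke metric `g`: the shape
operator is `-id`. -/
structure IsPositiveHyperbolicSphere (p : M → S) (g : CTensor S 2) (σ ξ : M → C3) : Prop
    extends IsBlaschkeImmersion p g σ ξ where
  shape : ∀ e ∈ atlas Plane S, ∀ κ : OpenPartialHomeomorph M Plane, IsLift p e κ →
    ∀ y ∈ κ.target, ∀ k i,
      shapeOperator (σ ∘ κ.symm) (ξ ∘ κ.symm) k i y = if k = i then -1 else 0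

/-- The Pick tensor `C(X, Y, Z) = -2 g(∇_X Y - ∇ᵍ_X Y, Z)` of `(σ, ξ)`, where `∇` is the induced
connection and `∇ᵍ` the Levi-Civita connection of `g`, is the cubic tensor `C`. -/
def HasPickTensor (p : M → S) (g : CTensor S 2) (C : CTensor S 3) (σ ξ : M → C3) : Prop :=
  ∀ e ∈ atlas Plane S, ∀ κ : OpenPartialHomeomorph M Plane, IsLift p e κ →
    ∀ y ∈ κ.target, ∀ i j k, C.coeff e y ![i, j, k] =
      -2 * ∑ l, (inducedConnection (σ ∘ κ.symm) (ξ ∘ κ.symm) l i j y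
        - christoffel (gram g e) l i j y) * gram g e y l k

/-- `(σ, ξ)` is equivariant for a representation of the deck group in `SL(3, ℂ)`. -/
def IsEquivariant (p : M → S) (σ ξ : M → C3) : Prop :=
  ∃ ρ : deckGroup p →* Matrix.SpecialLinearGroup (Fin 3) ℂ, ∀ (d : deckGroup p) (x : M),
    σ (d.1 x) = (ρ d).1.mulVec (σ x) ∧ ξ (d.1 x) = (ρ d).1.mulVec (ξ x)

/-- `σ` is an equivariant positive hyperbolic complex affine sphere, with holonomy in
`SL(3, ℂ)`, Blaschke metric `g` and Pick tensor `C`, whose affine normals meet at the origin: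
`σ - ξ`, which is constant for a sphere with shape operator `-id`, vanishes. -/
def IsEquivariantCAS (p : M → S) (g : CTensor S 2) (C : CTensor S 3) (σ : M → C3) : Prop :=
  ∃ ξ : M → C3, IsPositiveHyperbolicSphere p g σ ξ ∧ HasPickTensor p g C σ ξ ∧
    IsEquivariant p σ ξ ∧ ∀ x, σ x - ξ x = 0

end Cover

end CAS

end

open CAS

/-! Locally choose z holomorphic for c₁ and w holomorphic for c₂. Then g = l dz dw, Q₁ = p dz³, Q₂ =
q dw³ with p_w = 0 and q_z = 0, and the isotropic lines of g are ker dz and ker dw. In these null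
coordinates all conditions on an affine sphere with ξ = σ collapse to σ_zz = (l_z/l) σ_z − (p/l)
σ_w, σ_zw = (l/2) σ, σ_ww = (l_w/l) σ_w − (q/l) σ_z, det(σ_z, σ_w, σ) = i l/2
(`PickData.structureEqs_of_sphereAt` and `PickData.sphereAt_of_structureEqs`).

This is a linear total differential equation for the frame (σ_z, σ_w, σ). Holomorphy of p and q
settles the Codazzi part of its integrability. What remains is (log l)_zw + pq/l² = l/2. Since K_g =
−(2/l)(log l)_zw and g(Q₁, Q₂) = 8pq/l³, this is exactly the Gauss equation. It is necessary because
mixed third derivatives of σ commute (`PickData.integrability_of_structureEqs`), and sufficient by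
the Frobenius theorem (`PickData.exists_structureEqs`).

A solution is determined by its frame at one point, and the determinant condition fixes the
determinant of that frame, so two local spheres with the same data differ by a unique element of
SL(3, ℂ). Comparing local spheres therefore gives a locally defined SL(3, ℂ)-valued cocycle. On a
simply connected space it is a coboundary, which patches the local spheres to a global one
(`exists_global_of_local`). On a connected space the local uniqueness globalizes too; applied to σ
and σ ∘ d, for d a deck transformation, it produces the holonomy representation.

For the second statement, f₁ and f₂ are themselves null coordinates of h, with l = −4/(f₁ − f₂)², so
K_h = −1. The metric e^{2u}h has curvature e^{−2u}(−1 − Δ_h u), and the cubic pairing scales by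
e^{−6u}, so the Gauss equation of e^{2u}h multiplied by e^{2u} is the stated equation for u. -/

noncomputable section

namespace CAS

/-! ### Frobenius theorem for linear total differential equations -/

section Frobenius

set_option maxSynthPendingDepth 3

variable {E V : Type*} [NormedAddCommGroup E] [NormedSpace ℝ E]
  [NormedAddCommGroup V] [NormedSpace ℝ V]

/-- Two solutions of the linear total differential equation `dF = A F` on a ball that agree at the
centre are equal. -/
theorem eqOn_ball_of_linear_system {A : E → E →L[ℝ] V →L[ℝ] V} {y₀ : E} {r : ℝ}
    (hA : ContinuousOn A (Metric.ball y₀ r)) {F F' : E → V}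
    (hF : ∀ y ∈ Metric.ball y₀ r, HasFDerivAt F ((A y).flip (F y)) y)
    (hF' : ∀ y ∈ Metric.ball y₀ r, HasFDerivAt F' ((A y).flip (F' y)) y)
    (h0 : F y₀ = F' y₀) : EqOn F F' (Metric.ball y₀ r) := by
  intro y hy
  have hmem : ∀ t ∈ Icc (0 : ℝ) 1, y₀ + t • (y - y₀) ∈ Metric.ball y₀ r := by
    intro t ht
    have := mem_ball_iff_norm.1 hy
    rw [mem_ball_iff_norm, add_sub_cancel_left, norm_smul, Real.norm_of_nonneg ht.1]
    nlinarith [norm_nonneg (y - y₀), ht.2]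
  have hline : ∀ t : ℝ, HasDerivAt (fun t : ℝ => y₀ + t • (y - y₀)) (y - y₀) t := by
    intro t
    simpa using ((hasDerivAt_id t).smul_const (y - y₀)).const_add y₀
  have hcont : ContinuousOn (fun t : ℝ => A (y₀ + t • (y - y₀))) (Icc 0 1) :=
    hA.comp (by fun_prop) hmem
  obtain ⟨N, hN⟩ := (isCompact_Icc (a := (0 : ℝ)) (b := 1)).exists_bound_of_continuousOn (E := E →L[ℝ] V →L[ℝ] V)
    hcont
  have hder : ∀ t ∈ Icc (0 : ℝ) 1, HasDerivAt
      (fun t : ℝ => F (y₀ + t • (y - y₀)) - F' (y₀ + t • (y - y₀)))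
      (A (y₀ + t • (y - y₀)) (y - y₀) (F (y₀ + t • (y - y₀)) - F' (y₀ + t • (y - y₀)))) t := by
    intro t ht
    have h1 := (hF _ (hmem t ht)).comp_hasDerivAt t (hline t)
    have h2 := (hF' _ (hmem t ht)).comp_hasDerivAt t (hline t)
    refine (h1.sub h2).congr_deriv ?_
    simp only [ContinuousLinearMap.flip_apply]
    exact (map_sub _ _ _).symm
  -- Along the segment from y₀ to y the difference is 0 at time 0 and its derivative is at most N‖y
  -- − y₀‖ times itself, so it vanishes by Grönwall.
  have := eq_zero_of_abs_deriv_le_mul_abs_self_of_eq_zero_right (K := N * ‖y - y₀‖)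
    (fun t ht => (hder t ht).continuousAt.continuousWithinAt)
    (fun t ht => (hder t (Ico_subset_Icc_self ht)).hasDerivWithinAt) (by simp [h0])
    (fun t ht => (ContinuousLinearMap.le_opNorm _ _).trans (by
      gcongr
      exact (ContinuousLinearMap.le_opNorm _ _).trans (by
        gcongr
        exact hN t (Ico_subset_Icc_self ht)))) 1 (right_mem_Icc.2 zero_le_one)
  simpa [sub_eq_zero] using this

/-- A linear differential equation on the unit interval with small coefficients is solvable. -/
theorem exists_linear_ode_solution [CompleteSpace V] {B : ℝ → V →L[ℝ] V}
    (hB : ContinuousOn B (Icc 0 1)) (hB' : ∀ t ∈ Icc (0 : ℝ) 1, ‖B t‖ ≤ 1 / 2) (v₀ : V) :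
    ∃ f : ℝ → V, f 0 = v₀ ∧ ∀ t ∈ Icc (0 : ℝ) 1, HasDerivWithinAt f (B t (f t)) (Icc 0 1) t := by
  -- On the ball of radius ‖v₀‖ about v₀ one has ‖v‖ ≤ 2‖v₀‖. The bound 1/2 on B then keeps the
  -- speed below ‖v₀‖, so the solution cannot leave the ball in unit time.
  have hPL : IsPicardLindelof (fun t v => B t v) (⟨0, by simp⟩ : Icc (0 : ℝ) 1) v₀ ‖v₀‖₊ 0
      ‖v₀‖₊ 1 := by
    refine ⟨fun t ht => ?_, fun v _ => hB.clm_apply continuousOn_const, fun t ht v hv => ?_, ?_⟩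
    · refine (((B t).lipschitz).weaken ?_).lipschitzOnWith
      have := hB' t ht
      rw [← NNReal.coe_le_coe]
      push_cast
      linarith
    · have h1 : ‖v‖ ≤ 2 * ‖v₀‖ := by
        have := mem_closedBall_iff_norm.1 hv
        have h2 := norm_le_norm_add_norm_sub' v v₀
        simp only [coe_nnnorm] at this
        linarith
      have h2 := (B t).le_opNorm v
      have h3 := hB' t ht
      simp only [coe_nnnorm]
      nlinarith [norm_nonneg v, norm_nonneg (B t)]
    · simp
  exact hPL.exists_eq_forall_mem_Icc_hasDerivWithinAt₀

/-- **Frobenius theorem** for linear systems: the total differential equation `dF = A F` is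
locally solvable if the connection `d - A` is flat. -/
theorem exists_linear_system_solution [CompleteSpace V] {A : E → E →L[ℝ] V →L[ℝ] V}
    {U : Set E} (hU : IsOpen U) (hA : ContDiffOn ℝ 2 A U)
    (hflat : ∀ y ∈ U, ∀ u v : E, fderiv ℝ A y u v + (A y v).comp (A y u) =
      fderiv ℝ A y v u + (A y u).comp (A y v)) {y₀ : E} (hy₀ : y₀ ∈ U) (F₀ : V) :
    ∃ r > 0, Metric.ball y₀ r ⊆ U ∧ ∃ F : E → V, F y₀ = F₀ ∧
      ∀ y ∈ Metric.ball y₀ r, HasFDerivAt F ((A y).flip (F y)) y := by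
  have hAt : ContDiffAt ℝ 2 A y₀ := hA.contDiffAt (hU.mem_nhds hy₀)
  obtain ⟨K₁, s₁, hs₁, hL₁⟩ := (hAt.of_le one_le_two).exists_lipschitzOnWith
  obtain ⟨K₂, s₂, hs₂, hL₂⟩ :=
    (hAt.fderiv_right (m := 1) (by norm_num)).exists_lipschitzOnWith
  set M : ℝ := ‖A y₀‖ + 1 with hM
  have hMpos : 0 < M := by positivity
  have hcA : ContinuousAt (fun y => ‖A y‖) y₀ :=
    ContinuousAt.norm (E := E →L[ℝ] V →L[ℝ] V) hAt.continuousAt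
  have hs₃ : {y | ‖A y‖ < M} ∈ 𝓝 y₀ := hcA.eventually_lt continuousAt_const (by simp [hM])
  obtain ⟨ρ, hρ, hball⟩ := Metric.mem_nhds_iff.1
    (Filter.inter_mem (Filter.inter_mem hs₁ hs₂) (Filter.inter_mem hs₃ (hU.mem_nhds hy₀)))
  -- With this radius the equation along each ray has coefficients of norm at most 1/2, as
  -- `exists_linear_ode_solution` needs.
  set r : ℝ := min ρ (1 / (2 * M)) with hr
  have hr0 : 0 < r := by positivity
  have hMr : M * r ≤ 1 / 2 := by
    calc M * r ≤ M * (1 / (2 * M)) := by gcongr; exact min_le_right _ _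
      _ = 1 / 2 := by field_simp
  have hsub : Metric.ball y₀ r ⊆ Metric.ball y₀ ρ := Metric.ball_subset_ball (min_le_left _ _)
  have hB₁ : LipschitzOnWith K₁ A (Metric.ball y₀ r) :=
    hL₁.mono fun y hy => (hball (hsub hy)).1.1
  have hB₂ : LipschitzOnWith K₂ (fderiv ℝ A) (Metric.ball y₀ r) :=
    hL₂.mono fun y hy => (hball (hsub hy)).1.2
  have hB₃ : ∀ y ∈ Metric.ball y₀ r, ‖A y‖ ≤ M := fun y hy => (hball (hsub hy)).2.1.le
  have hBU : Metric.ball y₀ r ⊆ U := fun y hy => (hball (hsub hy)).2.2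
  have hAd : ∀ y ∈ Metric.ball y₀ r, HasFDerivAt A (fderiv ℝ A y) y := fun y hy =>
    ((hA.contDiffAt (hU.mem_nhds (hBU hy))).differentiableAt (by norm_num)).hasFDerivAt
  have hmem : ∀ h : E, ‖h‖ < r → ∀ t ∈ Icc (0 : ℝ) 1, y₀ + t • h ∈ Metric.ball y₀ r := by
    intro h hh t ht
    rw [mem_ball_iff_norm, add_sub_cancel_left, norm_smul, Real.norm_of_nonneg ht.1]
    nlinarith [norm_nonneg h, ht.2]
  have hline : ∀ (h : E) (t : ℝ), HasDerivAt (fun t : ℝ => y₀ + t • h) h t := by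
    intro h t
    simpa using ((hasDerivAt_id t).smul_const h).const_add y₀
  have hex : ∀ h : E, ∃ f : ℝ → V, ‖h‖ < r → f 0 = F₀ ∧ ∀ t ∈ Icc (0 : ℝ) 1,
      HasDerivWithinAt f (A (y₀ + t • h) h (f t)) (Icc 0 1) t := by
    intro h
    by_cases hh : ‖h‖ < r
    · have hc : ContinuousOn (fun t : ℝ => A (y₀ + t • h) h) (Icc 0 1) :=
        (hB₁.continuousOn.comp (by fun_prop) (hmem h hh)).clm_apply continuousOn_const
      obtain ⟨f, hf⟩ := exists_linear_ode_solution hc (fun t ht => by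
        calc ‖A (y₀ + t • h) h‖ ≤ ‖A (y₀ + t • h)‖ * ‖h‖ := ContinuousLinearMap.le_opNorm _ _
          _ ≤ M * r := by gcongr; exact hB₃ _ (hmem h hh t ht)
          _ ≤ 1 / 2 := hMr) F₀
      exact ⟨f, fun _ => hf⟩
    · exact ⟨0, fun h' => absurd h' hh⟩
  choose Φ hΦ using hex
  -- The solution is obtained by integrating along the ray from y₀ to y and evaluating at time 1.
  refine ⟨r, hr0, hBU, fun y => Φ (y - y₀) 1, ?_, fun y hy => ?_⟩
  · have h0 : ‖(0 : E)‖ < r := by simpa using hr0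
    have hd := (hΦ 0 h0).2
    have : Φ 0 1 = Φ 0 0 := by
      refine (convex_Icc (0 : ℝ) 1).is_const_of_fderivWithin_eq_zero (𝕜 := ℝ)
        (fun t ht => ((hd t ht).differentiableWithinAt)) (fun t ht => ?_) (by simp) (by simp)
      have h1 := (hd t ht).hasFDerivWithinAt.fderivWithin (uniqueDiffOn_Icc zero_lt_one t ht)
      rw [h1]
      ext
      simp
    simpa [(hΦ 0 h0).1] using this
  · set h : E := y - y₀ with hh
    have hhr : ‖h‖ < r := mem_ball_iff_norm.1 hy
    obtain ⟨hΦ0, hΦd⟩ := hΦ h hhr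
    obtain ⟨N, hN⟩ := isCompact_Icc.exists_bound_of_continuousOn
      (HasDerivWithinAt.continuousOn hΦd)
    have hN0 : 0 ≤ N := (norm_nonneg _).trans (hN 0 (by simp))
    set C : ℝ := (K₂ * r + K₁ + (K₁ * r + M) * M) * N with hC
    have key : ∀ v : E, ‖h + v‖ < r →
        ‖Φ (h + v) 1 - Φ h 1 - A y v (Φ h 1)‖ ≤ gronwallBound 0 (1 / 2) (C * ‖v‖ ^ 2) 1 := by
      intro v hv
      obtain ⟨hΨ0, hΨd⟩ := hΦ (h + v) hv
      -- D is the error of the expected first-order expansion at time t along the ray. At t = 1 it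
      -- is F(y + v) − F(y) − A(y) v F(y), to be bounded by a multiple of ‖v‖².
      set D : ℝ → V := fun t => Φ (h + v) t - Φ h t - A (y₀ + t • h) (t • v) (Φ h t) with hD
      set D' : ℝ → V := fun t => A (y₀ + t • (h + v)) (h + v) (Φ (h + v) t) -
        A (y₀ + t • h) h (Φ h t) - ((fderiv ℝ A (y₀ + t • h) h (t • v) + A (y₀ + t • h) v) (Φ h t) +
          A (y₀ + t • h) (t • v) (A (y₀ + t • h) h (Φ h t))) with hD'
      have hDd : ∀ t ∈ Icc (0 : ℝ) 1, HasDerivWithinAt D (D' t) (Icc 0 1) t := by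
        intro t ht
        have h1 := ((hAd _ (hmem h hhr t ht)).comp_hasDerivAt t (hline h t)).hasDerivWithinAt
          (s := Icc 0 1)
        have h2 : HasDerivWithinAt (fun t : ℝ => t • v) v (Icc 0 1) t := by
          simpa using ((hasDerivAt_id t).smul_const v).hasDerivWithinAt
        exact ((hΨd t ht).sub (hΦd t ht)).sub ((h1.clm_apply h2).clm_apply (hΦd t ht))
      have hest : ∀ t ∈ Icc (0 : ℝ) 1, ‖D' t‖ ≤ 1 / 2 * ‖D t‖ + C * ‖v‖ ^ 2 := by
        intro t ht
        have hm := hmem h hhr t ht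
        have hm' := hmem (h + v) hv t ht
        set a := y₀ + t • h with ha
        set a' := y₀ + t • (h + v) with ha'
        have hdiff : a' - a = t • v := by simp [ha, ha', smul_add]
        have htv : ‖t • v‖ ≤ ‖v‖ := by
          rw [norm_smul, Real.norm_of_nonneg ht.1]
          nlinarith [norm_nonneg v, ht.2]
        have hfl := congrArg (fun L : V →L[ℝ] V => L (Φ h t)) (hflat a (hBU hm) h (t • v))
        simp only [add_apply, ContinuousLinearMap.comp_apply] at hfl
        -- Flatness trades dA(h)(tv) for dA(tv)(h). What is left besides a linear term in D consists
        -- of four terms quadratic in v, so Grönwall makes D quadratic in v.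
        have hid : D' t = A a' (h + v) (D t) +
            ((A a' - A a - fderiv ℝ A a (t • v)) h (Φ h t) + (A a' - A a) v (Φ h t)) +
            (((A a' - A a) (h + v)) (A a (t • v) (Φ h t)) + A a v (A a (t • v) (Φ h t))) := by
          simp only [hD, hD', ← ha, ← ha', add_apply,
            sub_apply, map_add, map_sub]
          rw [← sub_eq_zero] at hfl ⊢
          rw [← neg_eq_zero, ← hfl]
          abel
        have e1 : ‖A a' - A a‖ ≤ K₁ * ‖v‖ := by
          have := hB₁.dist_le_mul a' hm' a hm
          rw [dist_eq_norm, dist_eq_norm, hdiff] at this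
          exact this.trans (by gcongr)
        have e2 : ‖A a' - A a - fderiv ℝ A a (t • v)‖ ≤ K₂ * ‖v‖ * ‖v‖ := by
          have hseg : segment ℝ a a' ⊆ Metric.ball y₀ r := (convex_ball y₀ r).segment_subset hm hm'
          have := (convex_segment a a').norm_image_sub_le_of_norm_hasFDerivWithin_le'
            (f := A) (f' := fderiv ℝ A) (φ := fderiv ℝ A a) (C := K₂ * ‖v‖)
            (fun x hx => (hAd x (hseg hx)).hasFDerivWithinAt) (fun x hx => by
              have h3 := hB₂.dist_le_mul x (hseg hx) a hm
              rw [dist_eq_norm, dist_eq_norm] at h3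
              refine h3.trans ?_
              gcongr
              exact (norm_sub_le_of_mem_segment hx).trans (by rw [hdiff]; exact htv))
            (left_mem_segment ℝ a a') (right_mem_segment ℝ a a')
          rw [hdiff] at this
          exact this.trans (by gcongr)
        have e3 : ‖A a (t • v) (Φ h t)‖ ≤ M * ‖v‖ * N := by
          refine ((A a).le_opNorm₂ _ _).trans ?_
          gcongr
          exacts [hB₃ a hm, hN t ht]
        have e4 : ‖A a' (h + v) (D t)‖ ≤ 1 / 2 * ‖D t‖ := by
          refine ((A a').le_opNorm₂ _ _).trans ?_
          gcongr
          exact (mul_le_mul (hB₃ a' hm') hv.le (norm_nonneg _) hMpos.le).trans hMr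
        have e5 : ‖(A a' - A a - fderiv ℝ A a (t • v)) h (Φ h t)‖ ≤ K₂ * ‖v‖ * ‖v‖ * r * N := by
          refine (ContinuousLinearMap.le_opNorm₂ _ _ _).trans ?_
          gcongr
          exact hN t ht
        have e6 : ‖(A a' - A a) v (Φ h t)‖ ≤ K₁ * ‖v‖ * ‖v‖ * N := by
          refine (ContinuousLinearMap.le_opNorm₂ _ _ _).trans ?_
          gcongr
          exact hN t ht
        have e7 : ‖((A a' - A a) (h + v)) (A a (t • v) (Φ h t))‖ ≤
            K₁ * ‖v‖ * r * (M * ‖v‖ * N) := by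
          refine (ContinuousLinearMap.le_opNorm₂ _ _ _).trans ?_
          gcongr
        have e8 : ‖A a v (A a (t • v) (Φ h t))‖ ≤ M * ‖v‖ * (M * ‖v‖ * N) := by
          refine (ContinuousLinearMap.le_opNorm₂ _ _ _).trans ?_
          gcongr
          exact hB₃ a hm
        rw [hid]
        refine (norm_add₃_le).trans ?_
        have f1 := norm_add_le ((A a' - A a - fderiv ℝ A a (t • v)) h (Φ h t))
          ((A a' - A a) v (Φ h t))
        have f2 := norm_add_le (((A a' - A a) (h + v)) (A a (t • v) (Φ h t)))
          (A a v (A a (t • v) (Φ h t)))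
        have : C * ‖v‖ ^ 2 = K₂ * ‖v‖ * ‖v‖ * r * N + K₁ * ‖v‖ * ‖v‖ * N +
            (K₁ * ‖v‖ * r * (M * ‖v‖ * N) + M * ‖v‖ * (M * ‖v‖ * N)) := by
          rw [hC]; ring
        linarith
      have := norm_le_gronwallBound_of_norm_deriv_right_le (f := D) (f' := D') (δ := 0)
        (K := 1 / 2) (ε := C * ‖v‖ ^ 2) (HasDerivWithinAt.continuousOn hDd)
        (fun t ht => (hDd t (Ico_subset_Icc_self ht)).mono_of_mem_nhdsWithin
          (Icc_mem_nhdsGE_of_mem ht)) (by simp [hD, hΦ0, hΨ0])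
        (fun t ht => hest t (Ico_subset_Icc_self ht)) 1 (by simp)
      simpa [hD, hh] using this
    have hlin : ∀ v : E, gronwallBound 0 (1 / 2) (C * ‖v‖ ^ 2) 1 =
        (2 * (Real.exp (1 / 2) - 1) * C) * ‖v‖ ^ 2 := by
      intro v
      rw [gronwallBound_of_K_ne_0 (by norm_num)]
      simp
      ring
    rw [hasFDerivAt_iff_isLittleO_nhds_zero]
    have hbig : (fun v : E => Φ (y + v - y₀) 1 - Φ (y - y₀) 1 - (A y).flip (Φ (y - y₀) 1) v)
        =O[𝓝 0] fun v : E => ‖v‖ ^ 2 := by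
      refine Asymptotics.IsBigO.of_bound (2 * (Real.exp (1 / 2) - 1) * C) ?_
      have hev : ∀ᶠ v : E in 𝓝 0, ‖h + v‖ < r := by
        have : ContinuousAt (fun v : E => ‖h + v‖) 0 := by fun_prop
        exact this.eventually_lt continuousAt_const (by simpa using hhr)
      filter_upwards [hev] with v hv
      have := key v hv
      rw [hlin] at this
      have e : y + v - y₀ = h + v := by rw [hh]; abel
      rw [e, Real.norm_of_nonneg (by positivity)]
      simpa using this
    refine hbig.trans_isLittleO ?_
    exact Asymptotics.IsLittleO.of_norm_right (by
      simpa using (Asymptotics.isLittleO_norm_pow_norm_pow (E' := E) one_lt_two))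

end Frobenius

end CAS
end

noncomputable section

namespace CAS

/-! ### Patching local solutions on a simply connected space -/

section Cocycle

variable {M G : Type*}

/-- The total space of the `G`-covering of `M` with transition function `a`. -/
@[ext] structure CocycleSpace (a : M → M → G) where
  base : M
  val : G

variable [TopologicalSpace M] [Group G]

/-- The sheet through (x, g) is y ↦ (y, g · a x y) for y near x. The product topology is not meant:
the group coordinate varies along a sheet. -/
instance CocycleSpace.topologicalSpace (a : M → M → G) : TopologicalSpace (CocycleSpace a) where
  IsOpen W := ∀ e ∈ W, ∀ᶠ y in 𝓝 e.base, (⟨y, e.val * a e.base y⟩ : CocycleSpace a) ∈ W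
  isOpen_univ _ _ := by simp
  isOpen_inter _ _ hs ht e he := (hs e he.1).and (ht e he.2)
  isOpen_sUnion _ hs e he := by
    obtain ⟨t, ht, het⟩ := he
    exact (hs t ht e het).mono fun y hy => ⟨t, ht, hy⟩

theorem CocycleSpace.isOpen_iff {a : M → M → G} {W : Set (CocycleSpace a)} :
    IsOpen W ↔ ∀ e ∈ W, ∀ᶠ y in 𝓝 e.base, (⟨y, e.val * a e.base y⟩ : CocycleSpace a) ∈ W :=
  Iff.rfl

theorem CocycleSpace.continuous_base (a : M → M → G) :
    Continuous (CocycleSpace.base : CocycleSpace a → M) := by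
  refine ⟨fun U hU => CocycleSpace.isOpen_iff.2 fun e he => ?_⟩
  exact hU.mem_nhds he

/-- By the cocycle identity, val · (a x base)⁻¹ is locally constant over a neighbourhood of x. It is
the fibre coordinate of a trivialization there, with G discrete. -/
theorem CocycleSpace.isCoveringMap {a : M → M → G}
    (ha : ∀ x, ∀ᶠ y in 𝓝 x, ∀ᶠ z in 𝓝 y, a x z = a x y * a y z) :
    IsCoveringMap (CocycleSpace.base : CocycleSpace a → M) := by
  intro x
  let _ : TopologicalSpace G := ⊥
  have : DiscreteTopology G := ⟨rfl⟩
  refine IsEvenlyCovered.to_isEvenlyCovered_preimage (I := G) ⟨inferInstance,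
    interior {y | ∀ᶠ z in 𝓝 y, a x z = a x y * a y z}, mem_interior_iff_mem_nhds.2 (ha x),
    isOpen_interior, isOpen_interior.preimage (CocycleSpace.continuous_base a), ?_⟩
  set U := interior {y | ∀ᶠ z in 𝓝 y, a x z = a x y * a y z} with hU
  have hUmem : ∀ y ∈ U, ∀ᶠ z in 𝓝 y, a x z = a x y * a y z := fun y hy => (interior_subset hy : y ∈ {y | ∀ᶠ z in 𝓝 y, a x z = a x y * a y z})
  refine ⟨{ toFun := fun e => (⟨e.1.base, e.2⟩, e.1.val * (a x e.1.base)⁻¹)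
            invFun := fun q => ⟨⟨q.1, q.2 * a x q.1⟩, q.1.2⟩
            left_inv := fun e => by ext <;> simp
            right_inv := fun q => by ext <;> simp
            continuous_toFun := ?_
            continuous_invFun := ?_ }, fun _ => rfl⟩
  · refine Continuous.prodMk ?_ ?_
    · exact ((CocycleSpace.continuous_base a).comp continuous_subtype_val).subtype_mk _
    · rw [continuous_discrete_rng]
      intro g
      have : IsOpen {e : CocycleSpace a | e.base ∈ U ∧ e.val * (a x e.base)⁻¹ = g} := by
        refine CocycleSpace.isOpen_iff.2 fun e he => ?_
        filter_upwards [isOpen_interior.mem_nhds he.1, hUmem _ he.1] with z hz hz'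
        refine ⟨hz, ?_⟩
        rw [← he.2]
        simp only [hz']
        group
      convert this.preimage continuous_subtype_val using 1
      ext e
      exact ⟨fun h => ⟨e.2, h⟩, fun h => h.2⟩
  · refine Continuous.subtype_mk ?_ _
    refine ⟨fun W hW => ?_⟩
    rw [isOpen_iff_mem_nhds]
    rintro ⟨y, g⟩ hy
    rw [nhds_prod_eq, nhds_discrete G, Filter.prod_pure, Filter.mem_map]
    have h1 := CocycleSpace.isOpen_iff.1 hW _ hy
    rw [nhds_subtype]
    refine Filter.mem_comap.2 ⟨_, h1.and (hUmem _ y.2), ?_⟩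
    rintro z ⟨hz, hz'⟩
    simpa [hz', mul_assoc] using hz

/-- A locally defined group-valued cocycle on a simply connected space is a coboundary. -/
theorem exists_eventually_eq_mul_of_cocycle [SimplyConnectedSpace M] [LocallyPathConnectedSpace M]
    {a : M → M → G} (ha : ∀ x, ∀ᶠ y in 𝓝 x, ∀ᶠ z in 𝓝 y, a x z = a x y * a y z) :
    ∃ b : M → G, ∀ x, ∀ᶠ y in 𝓝 x, b y = b x * a x y := by
  obtain ⟨x₀⟩ : Nonempty M := inferInstance
  -- The identity of M lifts to a continuous section, whose group coordinate is the required b.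
  obtain ⟨F, ⟨-, hF⟩, -⟩ := (CocycleSpace.isCoveringMap ha).existsUnique_continuousMap_lifts
    (ContinuousMap.id M) x₀ ⟨x₀, 1⟩ rfl
  have hF' : ∀ x, (F x).base = x := fun x => congrFun hF x
  refine ⟨fun x => (F x).val, fun x => ?_⟩
  have hone : a x x = 1 := by
    have := (ha x).self_of_nhds.self_of_nhds
    simpa using this
  set U := interior {y | ∀ᶠ z in 𝓝 y, a x z = a x y * a y z} with hU
  have hUmem : ∀ y ∈ U, ∀ᶠ z in 𝓝 y, a x z = a x y * a y z := fun y hy => (interior_subset hy : y ∈ {y | ∀ᶠ z in 𝓝 y, a x z = a x y * a y z})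
  -- This set is the sheet through F x. Because it is open, the section stays in it near x.
  have hW : IsOpen {e : CocycleSpace a | e.base ∈ U ∧ e.val = (F x).val * a x e.base} := by
    refine CocycleSpace.isOpen_iff.2 fun e he => ?_
    filter_upwards [isOpen_interior.mem_nhds he.1, hUmem _ he.1] with z hz hz'
    refine ⟨hz, ?_⟩
    simp only [hz', he.2, mul_assoc]
  have hmem : F x ∈ {e : CocycleSpace a | e.base ∈ U ∧ e.val = (F x).val * a x e.base} := by
    refine ⟨?_, ?_⟩ <;> rw [hF' x]
    · exact mem_interior_iff_mem_nhds.2 (ha x)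
    · simp [hone]
  filter_upwards [F.continuous.continuousAt (hW.mem_nhds hmem)] with y hy
  have := hy.2
  rwa [hF' y] at this

/-- Local solutions of a problem that are unique up to the action of a group can be patched
together on a simply connected space. -/
theorem exists_global_of_local [SimplyConnectedSpace M] [LocallyPathConnectedSpace M]
    {X : Type*} [MulAction G X] (Sol : (M → X) → M → Prop)
    (hcongr : ∀ s s' x, s =ᶠ[𝓝 x] s' → Sol s x → Sol s' x)
    (hsmul : ∀ (A : G) s x, Sol s x → Sol (fun y => A • s y) x)
    (hex : ∀ x, ∃ s, ∀ᶠ y in 𝓝 x, Sol s y)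
    (huniq : ∀ s s' x, (∀ᶠ y in 𝓝 x, Sol s y) → (∀ᶠ y in 𝓝 x, Sol s' y) →
      ∃! A : G, ∀ᶠ y in 𝓝 x, s' y = A • s y) :
    ∃ s, ∀ x, Sol s x := by
  choose s hs using hex
  have hs' : ∀ x, ∀ᶠ y in 𝓝 x, ∀ᶠ z in 𝓝 y, Sol (s x) z :=
    fun x => eventually_eventually_nhds.2 (hs x)
  have h1 : ∀ x y, ∃ A : G, (∀ᶠ z in 𝓝 y, Sol (s x) z) → ∀ᶠ z in 𝓝 y, s x z = A • s y z := by
    intro x y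
    by_cases h : ∀ᶠ z in 𝓝 y, Sol (s x) z
    · obtain ⟨A, hA, -⟩ := huniq (s y) (s x) y (hs y) h
      exact ⟨A, fun _ => hA⟩
    · exact ⟨1, fun h' => absurd h' h⟩
  choose a ha using h1
  -- Both sides carry the solution s z to s x near z, so they agree by uniqueness.
  have hcoc : ∀ x, ∀ᶠ y in 𝓝 x, ∀ᶠ z in 𝓝 y, a x z = a x y * a y z := by
    intro x
    filter_upwards [hs' x] with y hy
    filter_upwards [eventually_eventually_nhds.2 (ha x y hy), eventually_eventually_nhds.2 hy,
      hs' y] with z hz hxz hyz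
    refine (huniq (s z) (s x) z (hs z) hxz).unique (ha x z hxz) ?_
    filter_upwards [hz, ha y z hyz] with t ht ht'
    rw [ht, ht', mul_smul]
  obtain ⟨b, hb⟩ := exists_eventually_eq_mul_of_cocycle hcoc
  -- Near x the coboundary relation turns this diagonal expression into b x • s x, which is a
  -- solution.
  refine ⟨fun y => b y • s y y, fun x => ?_⟩
  refine hcongr (fun y => b x • s x y) _ x ?_ (hsmul _ _ _ (hs x).self_of_nhds)
  filter_upwards [hb x, hs' x] with y hy hy'
  rw [hy, mul_smul, (ha x y hy').self_of_nhds]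

end Cocycle

/-- An injective holomorphic function on an open set has nonvanishing derivative. -/
theorem deriv_ne_zero_of_injOn {f : ℂ → ℂ} {U : Set ℂ} (hU : IsOpen U)
    (hf : DifferentiableOn ℂ f U) (hinj : InjOn f U) {z₀ : ℂ} (hz₀ : z₀ ∈ U) : deriv f z₀ ≠ 0 := by
  intro h0
  have han : AnalyticOnNhd ℂ f U := hf.analyticOnNhd hU
  have hnc : ∀ z ∈ U, ¬ ∀ᶠ y in 𝓝 z, f y = f z := by
    intro z hz h
    have h2 : ∀ᶠ y in 𝓝[≠] z, False := by
      filter_upwards [h.filter_mono nhdsWithin_le_nhds, self_mem_nhdsWithin,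
        mem_nhdsWithin_of_mem_nhds (hU.mem_nhds hz)] with y hy hyz hyU
      exact hyz (hinj hyU hz hy)
    exact (Filter.eventually_false_iff_eq_bot.1 h2 ▸ NormedField.nhdsNE_neBot z).ne rfl
  have hopen : ∀ z ∈ U, 𝓝 (f z) ≤ Filter.map f (𝓝 z) := fun z hz =>
    ((han z hz).eventually_constant_or_nhds_le_map_nhds).resolve_left (hnc z hz)
  set g : ℂ → ℂ := Function.invFunOn f U with hg
  have hgf : ∀ z ∈ U, g (f z) = z := fun z hz => hinj.leftInvOn_invFunOn hz
  have hgc : ∀ z ∈ U, ContinuousAt g (f z) := by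
    intro z hz
    rw [ContinuousAt, hgf z hz]
    refine Filter.Tendsto.mono_left ?_ (hopen z hz)
    rw [Filter.tendsto_map'_iff]
    refine Filter.tendsto_id.congr' ?_
    filter_upwards [hU.mem_nhds hz] with y hy
    exact (hgf y hy).symm
  have hfimg : ∀ z ∈ U, f '' U ∈ 𝓝 (f z) := fun z hz =>
    hopen z hz (Filter.image_mem_map (hU.mem_nhds hz))
  have hgd : ∀ z ∈ U, deriv f z ≠ 0 → DifferentiableAt ℂ g (f z) := by
    intro z hz hd
    have hfd : HasDerivAt f (deriv f z) (g (f z)) := by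
      rw [hgf z hz]
      exact (hf.differentiableAt (hU.mem_nhds hz)).hasDerivAt
    refine (HasDerivAt.of_local_left_inverse (hgc z hz) hfd hd ?_).differentiableAt
    filter_upwards [hfimg z hz] with w hw
    obtain ⟨y, hy, rfl⟩ := hw
    rw [hgf y hy]
  have hiso : ∀ᶠ z in 𝓝[≠] z₀, deriv f z ≠ 0 := by
    rcases (han.deriv z₀ hz₀).eventually_eq_zero_or_eventually_ne_zero with h | h
    · exfalso
      refine hnc z₀ hz₀ ?_
      obtain ⟨ε, hε, hb⟩ := Metric.eventually_nhds_iff_ball.1 (h.and (hU.mem_nhds hz₀))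
      filter_upwards [Metric.ball_mem_nhds z₀ hε] with y hy
      refine (convex_ball z₀ ε).is_const_of_fderivWithin_eq_zero (𝕜 := ℂ)
        (fun z hz => (hf z (hb z hz).2).differentiableAt (hU.mem_nhds (hb z hz).2)
          |>.differentiableWithinAt) (fun z hz => ?_) hy (Metric.mem_ball_self hε)
      rw [fderivWithin_of_isOpen Metric.isOpen_ball hz]
      ext
      simpa using (hb z hz).1
    · exact h
  -- The inverse g is continuous at f z₀ by the open mapping property and holomorphic around it
  -- except there, so the singularity is removable. The chain rule for g ∘ f = id then contradicts
  -- f'(z₀) = 0.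
  have hgd₀ : DifferentiableAt ℂ g (f z₀) := by
    have hs : {w | w ≠ f z₀ → DifferentiableAt ℂ g w} ∈ 𝓝 (f z₀) := by
      refine hopen z₀ hz₀ (Filter.mem_map.2 ?_)
      have h3 := eventually_nhdsWithin_iff.1 hiso
      filter_upwards [h3, hU.mem_nhds hz₀] with z hz hzU hne
      refine hgd z hzU (hz ?_)
      rintro rfl
      exact hne rfl
    refine ((Complex.differentiableOn_compl_singleton_and_continuousAt_iff hs).1
      ⟨fun w hw => ?_, hgc z₀ hz₀⟩).differentiableAt hs
    exact (hw.1 hw.2).differentiableWithinAt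
  have hcomp : HasDerivAt (g ∘ f) (deriv g (f z₀) * deriv f z₀) z₀ :=
    hgd₀.hasDerivAt.comp z₀ (hf.differentiableAt (hU.mem_nhds hz₀)).hasDerivAt
  have hid : HasDerivAt (g ∘ f) 1 z₀ := by
    refine (hasDerivAt_id z₀).congr_of_eventuallyEq ?_
    filter_upwards [hU.mem_nhds hz₀] with y hy
    exact hgf y hy
  have := hcomp.unique hid
  simp [h0] at this

/-! ### Matrix-valued one-forms acting on frames of ℂ³ -/

section Frames

set_option maxSynthPendingDepth 3
set_option synthInstance.maxHeartbeats 100000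

/-- The action of coefficient matrices on frames. -/
def frameAction : (Fin 3 → Fin 3 → ℂ) →L[ℝ] (Fin 3 → C3) →L[ℝ] (Fin 3 → C3) :=
  LinearMap.toContinuousLinearMap
    ((LinearMap.toContinuousLinearMap :
      ((Fin 3 → C3) →ₗ[ℝ] (Fin 3 → C3)) ≃ₗ[ℝ] ((Fin 3 → C3) →L[ℝ] (Fin 3 → C3))).toLinearMap ∘ₗ
    LinearMap.mk₂ ℝ (fun (m : Fin 3 → Fin 3 → ℂ) (Φ : Fin 3 → C3) b => ∑ c, m b c • Φ c)
      (fun m m' Φ => by ext; simp [add_smul, Finset.sum_add_distrib])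
      (fun c m Φ => by ext; simp [Finset.mul_sum, mul_assoc])
      (fun m Φ Φ' => by ext; simp [Finset.sum_add_distrib])
      (fun c m Φ => by ext; simp [Finset.mul_sum, mul_left_comm]))

theorem frameAction_apply (m : Fin 3 → Fin 3 → ℂ) (Φ : Fin 3 → C3) (b : Fin 3) :
    frameAction m Φ b = ∑ c, m b c • Φ c := rfl

/-- The `𝔤𝔩(3, ℂ)`-valued one-form with components `A₀`, `A₁`, acting on frames. -/
def connectionForm : (Fin 2 → Fin 3 → Fin 3 → ℂ) →L[ℝ] Plane →L[ℝ] (Fin 3 → C3) →L[ℝ] (Fin 3 → C3) :=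
  LinearMap.toContinuousLinearMap
    { toFun := fun A => ∑ i, (EuclideanSpace.proj i : Plane →L[ℝ] ℝ).smulRight (frameAction (A i))
      map_add' := fun A B => by
        ext
        simp
        ring
      map_smul' := fun c A => by
        ext
        simp [mul_left_comm] }

theorem connectionForm_apply (A : Fin 2 → Fin 3 → Fin 3 → ℂ) (v : Plane) :
    connectionForm A v = ∑ i, v i • frameAction (A i) := by
  change (∑ i, (EuclideanSpace.proj i : Plane →L[ℝ] ℝ).smulRight (frameAction (A i))) v = _
  rw [sum_apply]
  rfl

theorem connectionForm_single (A : Fin 2 → Fin 3 → Fin 3 → ℂ) (i : Fin 2) :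
    connectionForm A (EuclideanSpace.single i 1) = frameAction (A i) := by
  rw [connectionForm_apply]
  fin_cases i <;> simp [zero_smul ℝ (_ : (Fin 3 → C3) →L[ℝ] (Fin 3 → C3))]

end Frames

end CAS
end

noncomputable section

namespace CAS

/-! ### Rules for partial derivatives on the plane -/

section PartialDerivatives

variable {V : Type*} [NormedAddCommGroup V] [NormedSpace ℝ V] {f g : Plane → V} {y : Plane}
  {U : Set Plane} (i j : Fin 2)

theorem pd_congr (h : f =ᶠ[𝓝 y] g) : pd i f y = pd i g y := by
  rw [pd, pd, h.fderiv_eq]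

theorem pd_congr_on (hU : IsOpen U) (h : EqOn f g U) (hy : y ∈ U) : pd i f y = pd i g y :=
  pd_congr i (h.eventuallyEq_of_mem (hU.mem_nhds hy))

theorem fderiv_eq_sum_pd (v : Plane) : fderiv ℝ f y v = ∑ i, v i • pd i f y := by
  conv_lhs => rw [← (EuclideanSpace.basisFun (Fin 2) ℝ).sum_repr v]
  simp [pd]

theorem pd_const (c : V) : pd i (fun _ => c) y = 0 := by
  simp [pd]

theorem pd_add (hf : DifferentiableAt ℝ f y) (hg : DifferentiableAt ℝ g y) :
    pd i (fun x => f x + g x) y = pd i f y + pd i g y := by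
  simp only [pd, fderiv_fun_add hf hg, add_apply]

theorem pd_sub (hf : DifferentiableAt ℝ f y) (hg : DifferentiableAt ℝ g y) :
    pd i (fun x => f x - g x) y = pd i f y - pd i g y := by
  simp only [pd, fderiv_fun_sub hf hg, sub_apply]

theorem pd_mul {a b : Plane → ℂ} (ha : DifferentiableAt ℝ a y) (hb : DifferentiableAt ℝ b y) :
    pd i (fun x => a x * b x) y = pd i a y * b y + a y * pd i b y := by
  simp only [pd, fderiv_fun_mul ha hb, add_apply, smul_apply, smul_eq_mul]
  ring

theorem pd_const_mul (c : ℂ) {a : Plane → ℂ} (ha : DifferentiableAt ℝ a y) :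
    pd i (fun x => c * a x) y = c * pd i a y := by
  rw [pd_mul i (differentiableAt_const c) ha, pd_const]
  ring

theorem pd_smul [NormedSpace ℂ V] [IsScalarTower ℝ ℂ V] {a : Plane → ℂ}
    (ha : DifferentiableAt ℝ a y) (hf : DifferentiableAt ℝ f y) :
    pd i (fun x => a x • f x) y = pd i a y • f y + a y • pd i f y := by
  simp only [pd, fderiv_fun_smul ha hf, add_apply, smul_apply,
    ContinuousLinearMap.smulRight_apply]
  rw [add_comm]

theorem pd_inv {a : Plane → ℂ} (ha : DifferentiableAt ℝ a y) (h0 : a y ≠ 0) :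
    pd i (fun x => (a x)⁻¹) y = -pd i a y / a y ^ 2 := by
  have h := pd_mul i ha (ha.fun_inv h0)
  have h1 : pd i (fun x => a x * (a x)⁻¹) y = 0 := by
    rw [pd_congr (g := fun _ => 1) i, pd_const]
    filter_upwards [ha.continuousAt.eventually_ne h0] with x hx
    exact mul_inv_cancel₀ hx
  rw [h1] at h
  field_simp at h ⊢
  linear_combination -h

theorem pd_apply {W : Type*} [NormedAddCommGroup W] [NormedSpace ℝ W] (L : V →L[ℝ] W)
    (hf : DifferentiableAt ℝ f y) : pd i (fun x => L (f x)) y = L (pd i f y) := by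
  have h : HasFDerivAt (fun x => L (f x)) (L.comp (fderiv ℝ f y)) y :=
    L.hasFDerivAt.comp y hf.hasFDerivAt
  rw [pd, h.fderiv]
  rfl

theorem pd_pi_apply {F : Plane → C3} (hF : DifferentiableAt ℝ F y) (n : Fin 3) :
    pd i (fun x => F x n) y = pd i F y n :=
  pd_apply i (ContinuousLinearMap.proj (R := ℝ) (φ := fun _ : Fin 3 => ℂ) n) hF

theorem pd_comm (hf : ContDiffAt ℝ ∞ f y) : pd i (pd j f) y = pd j (pd i f) y := by
  have hd : DifferentiableAt ℝ (fderiv ℝ f) y :=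
    (hf.fderiv_right (m := 1) (WithTop.coe_le_coe.2 le_top)).differentiableAt (by norm_num)
  have h : ∀ i j, pd i (pd j f) y =
      fderiv ℝ (fderiv ℝ f) y (EuclideanSpace.single i 1) (EuclideanSpace.single j 1) := by
    intro i j
    have := pd_apply i (ContinuousLinearMap.apply ℝ V (EuclideanSpace.single j (1 : ℝ))) hd
    exact this
  rw [h, h]
  exact (hf.isSymmSndFDerivAt (by
    simpa using (WithTop.coe_le_coe.2 le_top : ((2 : ℕ∞) : WithTop ℕ∞) ≤ ∞))) _ _

theorem contDiffOn_pd (hU : IsOpen U) (hf : ContDiffOn ℝ ∞ f U) : ContDiffOn ℝ ∞ (pd i f) U :=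
  (hf.fderiv_of_isOpen hU (by simp)).clm_apply contDiffOn_const

theorem differentiableAt_of_contDiffOn (hU : IsOpen U) (hf : ContDiffOn ℝ ∞ f U) (hy : y ∈ U) :
    DifferentiableAt ℝ f y :=
  (hf.contDiffAt (hU.mem_nhds hy)).differentiableAt (by simp)

theorem pd_comp {τ : Plane → Plane} (hf : DifferentiableAt ℝ f (τ y))
    (hτ : DifferentiableAt ℝ τ y) :
    pd i (fun x => f (τ x)) y = ∑ k, pd i τ y k • pd k f (τ y) := by
  have h : HasFDerivAt (fun x => f (τ x)) ((fderiv ℝ f (τ y)).comp (fderiv ℝ τ y)) y :=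
    hf.hasFDerivAt.comp y hτ.hasFDerivAt
  rw [pd, h.fderiv]
  exact fderiv_eq_sum_pd _

end PartialDerivatives

/-! ### Linear systems for frames in coordinates -/

section FrameSystem

set_option maxSynthPendingDepth 3
set_option synthInstance.maxHeartbeats 100000

variable {U : Set Plane} {A : Fin 2 → Fin 3 → Fin 3 → Plane → ℂ} {y₀ : Plane}

/-- This translates between the invariant form dF = A F used in the Frobenius theorem and the
equations for the two partial derivatives. -/
theorem hasFDerivAt_connectionForm_iff {F : Plane → Fin 3 → C3} {y : Plane}
    (a : Fin 2 → Fin 3 → Fin 3 → ℂ) :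
    HasFDerivAt F ((connectionForm a).flip (F y)) y ↔
      DifferentiableAt ℝ F y ∧ ∀ i b, pd i F y b = ∑ c, a i b c • F y c := by
  constructor
  · intro h
    refine ⟨h.differentiableAt, fun i b => ?_⟩
    rw [pd, h.fderiv, ContinuousLinearMap.flip_apply, connectionForm_single, frameAction_apply]
  · rintro ⟨h, h'⟩
    refine h.hasFDerivAt.congr_fderiv ?_
    ext1 v
    rw [fderiv_eq_sum_pd, ContinuousLinearMap.flip_apply, connectionForm_apply, sum_apply]
    refine Finset.sum_congr rfl fun i _ => ?_
    rw [smul_apply]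
    congr 1
    funext b
    rw [h', frameAction_apply]

theorem contDiffOn_connectionForm (hA : ∀ i b c, ContDiffOn ℝ ∞ (A i b c) U) :
    ContDiffOn ℝ ∞ (fun y => connectionForm fun i b c => A i b c y) U :=
  connectionForm.contDiff.comp_contDiffOn
    (contDiffOn_pi.2 fun i => contDiffOn_pi.2 fun b => contDiffOn_pi.2 fun c => hA i b c)

/-- Local existence for the linear system `∂ᵢ F_b = ∑ A_{ibc} F_c` under the flatness condition. -/
theorem exists_frame (hU : IsOpen U) (hA : ∀ i b c, ContDiffOn ℝ ∞ (A i b c) U)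
    (hflat : ∀ y ∈ U, ∀ b c, pd 0 (A 1 b c) y + ∑ d, A 1 b d y * A 0 d c y =
      pd 1 (A 0 b c) y + ∑ d, A 0 b d y * A 1 d c y) (hy₀ : y₀ ∈ U) (F₀ : Fin 3 → C3) :
    ∃ r > 0, Metric.ball y₀ r ⊆ U ∧ ∃ F : Plane → Fin 3 → C3, F y₀ = F₀ ∧
      ∀ y ∈ Metric.ball y₀ r, DifferentiableAt ℝ F y ∧
        ∀ i b, pd i F y b = ∑ c, A i b c y • F y c := by
  set B : Plane → Fin 2 → Fin 3 → Fin 3 → ℂ := fun y i b c => A i b c y with hB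
  have hBs : ContDiffOn ℝ ∞ B U :=
    contDiffOn_pi.2 fun i => contDiffOn_pi.2 fun b => contDiffOn_pi.2 fun c => hA i b c
  have hBd : ∀ y ∈ U, DifferentiableAt ℝ B y := fun y hy =>
    differentiableAt_of_contDiffOn hU hBs hy
  have hder : ∀ y ∈ U, ∀ u v : Plane, fderiv ℝ (fun y => connectionForm (B y)) y u v =
      connectionForm (fderiv ℝ B y u) v := by
    intro y hy u v
    have h : HasFDerivAt (fun y => connectionForm (B y)) (connectionForm.comp (fderiv ℝ B y)) y :=
      connectionForm.hasFDerivAt.comp y (hBd y hy).hasFDerivAt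
    rw [h.fderiv]
    rfl
  have hpd : ∀ y ∈ U, ∀ i k b c, pd i B y k b c = pd i (A k b c) y := by
    intro y hy i k b c
    have := pd_apply i (((ContinuousLinearMap.proj (R := ℝ) (φ := fun _ : Fin 3 => ℂ) c).comp
      (ContinuousLinearMap.proj (R := ℝ) (φ := fun _ : Fin 3 => Fin 3 → ℂ) b)).comp
      (ContinuousLinearMap.proj (R := ℝ) (φ := fun _ : Fin 2 => Fin 3 → Fin 3 → ℂ) k)) (hBd y hy)
    exact this.symm
  obtain ⟨r, hr, hrU, F, hF0, hF⟩ := exists_linear_system_solution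
    (A := fun y => connectionForm (B y)) hU
    ((contDiffOn_connectionForm hA).of_le (WithTop.coe_le_coe.2 le_top)) (fun y hy u v => by
      rw [hder y hy, hder y hy]
      ext Φ b n
      have key : ∀ b n, (∑ c, (pd 0 (A 1 b c) y + ∑ d, A 1 b d y * A 0 d c y) * Φ c n) =
          ∑ c, (pd 1 (A 0 b c) y + ∑ d, A 0 b d y * A 1 d c y) * Φ c n := fun b n =>
        Finset.sum_congr rfl fun c _ => by rw [hflat y hy b c]
      have k1 := key b n
      have hBA : ∀ i b c, B y i b c = A i b c y := fun _ _ _ => rfl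
      simp only [fderiv_eq_sum_pd, connectionForm_apply, add_apply, smul_apply,
        ContinuousLinearMap.comp_apply, Pi.add_apply, Pi.smul_apply,
        frameAction_apply, Fin.sum_univ_two, Fin.sum_univ_three, hpd y hy, smul_eq_mul,
        Complex.real_smul, hBA] at k1 ⊢
      -- The flatness defect is alternating in u and v, so on the plane it is a multiple of its
      -- value on the two coordinate vectors.
      linear_combination ((u 0 : ℂ) * (v 1 : ℂ) - u 1 * v 0) * k1) hy₀ F₀
  exact ⟨r, hr, hrU, F, hF0, fun y hy => (hasFDerivAt_connectionForm_iff _).1 (hF y hy)⟩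

/-- Bootstrapping: if F is Cⁿ then so is dF = A F, hence F is Cⁿ⁺¹. -/
theorem contDiffOn_frame (hU : IsOpen U) (hA : ∀ i b c, ContDiffOn ℝ ∞ (A i b c) U)
    {F : Plane → Fin 3 → C3} (hF : ∀ y ∈ U, DifferentiableAt ℝ F y ∧
      ∀ i b, pd i F y b = ∑ c, A i b c y • F y c) : ContDiffOn ℝ ∞ F U := by
  have hF' : ∀ y ∈ U, HasFDerivAt F ((connectionForm fun i b c => A i b c y).flip (F y)) y :=
    fun y hy => (hasFDerivAt_connectionForm_iff _).2 (hF y hy)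
  have hn : ∀ n : ℕ, ContDiffOn ℝ n F U := by
    intro n
    induction n with
    | zero =>
      simp only [Nat.cast_zero, contDiffOn_zero]
      exact fun y hy => (hF y hy).1.continuousAt.continuousWithinAt
    | succ n ih =>
      push_cast
      rw [contDiffOn_succ_iff_fderiv_of_isOpen hU]
      refine ⟨fun y hy => (hF y hy).1.differentiableWithinAt, by simp, ?_⟩
      have hc := (contDiffOn_connectionForm hA).of_le (show (n : WithTop ℕ∞) ≤ ∞ from
        WithTop.coe_le_coe.2 le_top)
      have h2 : ContDiffOn ℝ n (fun y => (connectionForm fun i b c => A i b c y).flip (F y)) U := by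
        refine ContDiffOn.clm_apply ?_ ih
        exact (ContinuousLinearMap.flipₗᵢ ℝ Plane (Fin 3 → C3) (Fin 3 → C3)).contDiff.comp_contDiffOn hc
      exact h2.congr fun y hy => (hF' y hy).fderiv
  exact contDiffOn_infty.2 hn

theorem eqOn_frame {r : ℝ} (hA : ∀ i b c, ContDiffOn ℝ ∞ (A i b c) (Metric.ball y₀ r))
    {F F' : Plane → Fin 3 → C3}
    (hF : ∀ y ∈ Metric.ball y₀ r, DifferentiableAt ℝ F y ∧
      ∀ i b, pd i F y b = ∑ c, A i b c y • F y c)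
    (hF' : ∀ y ∈ Metric.ball y₀ r, DifferentiableAt ℝ F' y ∧
      ∀ i b, pd i F' y b = ∑ c, A i b c y • F' y c)
    (h0 : F y₀ = F' y₀) : EqOn F F' (Metric.ball y₀ r) :=
  eqOn_ball_of_linear_system (contDiffOn_connectionForm hA).continuousOn
    (fun y hy => (hasFDerivAt_connectionForm_iff _).2 (hF y hy))
    (fun y hy => (hasFDerivAt_connectionForm_iff _).2 (hF' y hy)) h0

end FrameSystem

end CAS
end

noncomputable section

namespace CAS

/-! ### Derivatives with respect to a pair of complex coordinates -/

section NullCoordinates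

/-- The Jacobian determinant `∂₀z ∂₁w - ∂₁z ∂₀w` of a pair of complex functions. -/
def jac (z w : Plane → ℂ) (y : Plane) : ℂ := pd 0 z y * pd 1 w y - pd 1 z y * pd 0 w y

variable {V : Type*} [NormedAddCommGroup V] [NormedSpace ℝ V] [NormedSpace ℂ V]
  {z w : Plane → ℂ} {f g : Plane → V} {y : Plane} {U : Set Plane} (i j : Fin 2)

/-- The coefficient of `dz` in `df = (∂f/∂z) dz + (∂f/∂w) dw`. -/
def delZ (z w : Plane → ℂ) (f : Plane → V) (y : Plane) : V :=
  (jac z w y)⁻¹ • (pd 1 w y • pd 0 f y - pd 0 w y • pd 1 f y)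

/-- The coefficient of `dw` in `df = (∂f/∂z) dz + (∂f/∂w) dw`. -/
def delW (z w : Plane → ℂ) (f : Plane → V) (y : Plane) : V :=
  (jac z w y)⁻¹ • (pd 0 z y • pd 1 f y - pd 1 z y • pd 0 f y)

/-- A pair of smooth complex functions with independent differentials. -/
structure NullCoords (U : Set Plane) (z w : Plane → ℂ) : Prop where
  isOpen : IsOpen U
  smooth_z : ContDiffOn ℝ ∞ z U
  smooth_w : ContDiffOn ℝ ∞ w U
  jac_ne : ∀ y ∈ U, jac z w y ≠ 0

theorem pd_eq_delZ_add_delW (hJ : jac z w y ≠ 0) :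
    pd i f y = pd i z y • delZ z w f y + pd i w y • delW z w f y := by
  have h0 : pd 0 f y = (jac z w y)⁻¹ • (jac z w y • pd 0 f y) := (inv_smul_smul₀ hJ _).symm
  have h1 : pd 1 f y = (jac z w y)⁻¹ • (jac z w y • pd 1 f y) := (inv_smul_smul₀ hJ _).symm
  have key : ∀ i : Fin 2, jac z w y • pd i f y = pd i z y • (pd 1 w y • pd 0 f y - pd 0 w y • pd 1 f y)
      + pd i w y • (pd 0 z y • pd 1 f y - pd 1 z y • pd 0 f y) := by
    intro i
    fin_cases i <;> simp only [jac, Fin.zero_eta, Fin.mk_one] <;> module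
  rw [delZ, delW, smul_comm (pd i z y), smul_comm (pd i w y), ← smul_add, ← key,
    inv_smul_smul₀ hJ]

/-- Since dz and dw are independent, coefficients can be read off. Derivatives in the null
directions are computed below by exhibiting df as a combination of dz and dw. -/
theorem delZ_eq (hJ : jac z w y ≠ 0) {a b : V} (h : ∀ i, pd i f y = pd i z y • a + pd i w y • b) :
    delZ z w f y = a := by
  have : pd 1 w y • pd 0 f y - pd 0 w y • pd 1 f y = jac z w y • a := by
    rw [h, h, jac]
    module
  rw [delZ, this, inv_smul_smul₀ hJ]

theorem delW_eq (hJ : jac z w y ≠ 0) {a b : V} (h : ∀ i, pd i f y = pd i z y • a + pd i w y • b) :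
    delW z w f y = b := by
  have : pd 0 z y • pd 1 f y - pd 1 z y • pd 0 f y = jac z w y • b := by
    rw [h, h, jac]
    module
  rw [delW, this, inv_smul_smul₀ hJ]

namespace NullCoords

variable (H : NullCoords U z w)
include H

theorem differentiableAt {E : Type*} [NormedAddCommGroup E] [NormedSpace ℝ E] {f : Plane → E}
    (hf : ContDiffOn ℝ ∞ f U) (hy : y ∈ U) : DifferentiableAt ℝ f y :=
  differentiableAt_of_contDiffOn H.isOpen hf hy

theorem smooth_pd {E : Type*} [NormedAddCommGroup E] [NormedSpace ℝ E] {f : Plane → E}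
    (hf : ContDiffOn ℝ ∞ f U) : ContDiffOn ℝ ∞ (pd i f) U :=
  contDiffOn_pd i H.isOpen hf

theorem smooth_jac : ContDiffOn ℝ ∞ (jac z w) U :=
  ((H.smooth_pd 0 H.smooth_z).mul (H.smooth_pd 1 H.smooth_w)).sub
    ((H.smooth_pd 1 H.smooth_z).mul (H.smooth_pd 0 H.smooth_w))

theorem smooth_jac_inv : ContDiffOn ℝ ∞ (fun y => (jac z w y)⁻¹) U :=
  H.smooth_jac.inv H.jac_ne

variable [IsScalarTower ℝ ℂ V]

theorem smooth_delZ (hf : ContDiffOn ℝ ∞ f U) : ContDiffOn ℝ ∞ (delZ z w f) U :=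
  H.smooth_jac_inv.smul (((H.smooth_pd 1 H.smooth_w).smul (H.smooth_pd 0 hf)).sub
    ((H.smooth_pd 0 H.smooth_w).smul (H.smooth_pd 1 hf)))

theorem smooth_delW (hf : ContDiffOn ℝ ∞ f U) : ContDiffOn ℝ ∞ (delW z w f) U :=
  H.smooth_jac_inv.smul (((H.smooth_pd 0 H.smooth_z).smul (H.smooth_pd 1 hf)).sub
    ((H.smooth_pd 1 H.smooth_z).smul (H.smooth_pd 0 hf)))

/-- Second derivatives in null coordinates, for a function with `df = a dz + b dw`. -/
theorem pd_pd {a b : Plane → V} (ha : ContDiffOn ℝ ∞ a U) (hb : ContDiffOn ℝ ∞ b U)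
    (hab : ∀ y ∈ U, ∀ i, pd i f y = pd i z y • a y + pd i w y • b y) (hy : y ∈ U) :
    pd i (pd j f) y = pd i (pd j z) y • a y + pd j z y • pd i a y
      + (pd i (pd j w) y • b y + pd j w y • pd i b y) := by
  have hz := H.differentiableAt (H.smooth_pd j H.smooth_z) hy
  have hw := H.differentiableAt (H.smooth_pd j H.smooth_w) hy
  have hda := H.differentiableAt ha hy
  have hdb := H.differentiableAt hb hy
  rw [pd_congr_on (f := pd j f) i H.isOpen (fun y hy => hab y hy j) hy,
    pd_add i (hz.fun_smul hda) (hw.fun_smul hdb), pd_smul i hz hda, pd_smul i hw hdb]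

/-- Commutation follows from d(df) = 0 with df = f_z dz + f_w dw, because dz and dw are closed. -/
theorem delW_delZ (hf : ContDiffOn ℝ ∞ f U) (hy : y ∈ U) :
    delW z w (delZ z w f) y = delZ z w (delW z w f) y := by
  have hJ := H.jac_ne y hy
  have key := H.pd_pd 0 1 (H.smooth_delZ hf) (H.smooth_delW hf)
    (fun y hy i => pd_eq_delZ_add_delW i (H.jac_ne y hy)) hy
  have key' := H.pd_pd 1 0 (H.smooth_delZ hf) (H.smooth_delW hf)
    (fun y hy i => pd_eq_delZ_add_delW i (H.jac_ne y hy)) hy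
  have hU := H.isOpen.mem_nhds hy
  rw [pd_comm 0 1 (hf.contDiffAt hU), key', pd_comm 0 1 (H.smooth_z.contDiffAt hU),
    pd_comm 0 1 (H.smooth_w.contDiffAt hU)] at key
  have h3 : pd 0 z y • pd 1 (delZ z w f) y - pd 1 z y • pd 0 (delZ z w f) y =
      pd 1 w y • pd 0 (delW z w f) y - pd 0 w y • pd 1 (delW z w f) y := by
    rw [← sub_eq_zero] at key ⊢
    rw [← key]
    abel
  rw [delW, h3, delZ]

end NullCoords

end NullCoordinates

theorem contDiffOn_div {f g : Plane → ℂ} {U : Set Plane} (hf : ContDiffOn ℝ ∞ f U)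
    (hg : ContDiffOn ℝ ∞ g U) (h0 : ∀ y ∈ U, g y ≠ 0) :
    ContDiffOn ℝ ∞ (fun y => f y / g y) U := by
  simp only [div_eq_mul_inv]
  exact hf.mul (hg.inv h0)

/-- The matrix of `λ dz dw` in the coordinates of the plane. -/
def IsNullForm (G : Matrix (Fin 2) (Fin 2) ℂ) (l : ℂ) (Z W : Fin 2 → ℂ) : Prop :=
  ∀ i j, G i j = l * ((1 / 2) * (Z i * W j + W i * Z j))

/-! ### Levi-Civita connection, curvature and Laplacian of l dz dw -/

section NullMetric

variable {z w l : Plane → ℂ} {G : Plane → Matrix (Fin 2) (Fin 2) ℂ} {y : Plane} {U : Set Plane}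

/-- `G = l dz dw` on `U`, with `l ≠ 0`. -/
structure NullMetric (U : Set Plane) (z w l : Plane → ℂ) (G : Plane → Matrix (Fin 2) (Fin 2) ℂ) :
    Prop extends NullCoords U z w where
  smooth_l : ContDiffOn ℝ ∞ l U
  l_ne : ∀ y ∈ U, l y ≠ 0
  form : ∀ y ∈ U, IsNullForm (G y) (l y) (fun i => pd i z y) (fun i => pd i w y)

theorem IsNullForm.det {G : Matrix (Fin 2) (Fin 2) ℂ} {l : ℂ} {Z W : Fin 2 → ℂ}
    (h : IsNullForm G l Z W) : G.det = -(l ^ 2 / 4 * (Z 0 * W 1 - Z 1 * W 0) ^ 2) := by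
  rw [Matrix.det_fin_two, h, h, h, h]
  ring

/-- The inverse of the matrix of `l dz dw`. -/
theorem IsNullForm.inv {G : Matrix (Fin 2) (Fin 2) ℂ} {l : ℂ} {Z W : Fin 2 → ℂ}
    (h : IsNullForm G l Z W) (hl : l ≠ 0) (hJ : Z 0 * W 1 - Z 1 * W 0 ≠ 0) (i j : Fin 2) :
    G⁻¹ i j = 2 / (l * (Z 0 * W 1 - Z 1 * W 0) ^ 2) *
      (![W 1, -W 0] i * ![-Z 1, Z 0] j + ![-Z 1, Z 0] i * ![W 1, -W 0] j) := by
  obtain ⟨J, hJ'⟩ : ∃ J, J = Z 0 * W 1 - Z 1 * W 0 := ⟨_, rfl⟩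
  rw [← hJ'] at hJ ⊢
  have : G⁻¹ = Matrix.of fun i j => 2 / (l * J ^ 2) *
      (![W 1, -W 0] i * ![-Z 1, Z 0] j + ![-Z 1, Z 0] i * ![W 1, -W 0] j) := by
    refine Matrix.inv_eq_right_inv ?_
    ext i j
    fin_cases i <;> fin_cases j <;>
      simp [Matrix.mul_apply, h _ _] <;> field_simp <;> (try rw [hJ']) <;> ring
  rw [this]
  rfl

namespace NullMetric

variable (H : NullMetric U z w l G)
include H

/-- The logarithmic derivatives of `l`. -/
theorem smooth_a : ContDiffOn ℝ ∞ (fun y => delZ z w l y / l y) U :=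
  contDiffOn_div (H.smooth_delZ H.smooth_l) H.smooth_l H.l_ne

theorem smooth_b : ContDiffOn ℝ ∞ (fun y => delW z w l y / l y) U :=
  contDiffOn_div (H.smooth_delW H.smooth_l) H.smooth_l H.l_ne

theorem pd_l (hy : y ∈ U) (i : Fin 2) : pd i l y =
    l y * (delZ z w l y / l y * pd i z y + delW z w l y / l y * pd i w y) := by
  have := pd_eq_delZ_add_delW (f := l) i (H.jac_ne y hy)
  have hl := H.l_ne y hy
  simp only [smul_eq_mul] at this
  rw [this]
  field_simp

theorem pd_form (hy : y ∈ U) (i j k : Fin 2) : pd i (fun y => G y j k) y =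
    pd i l y * ((1 / 2) * (pd j z y * pd k w y + pd j w y * pd k z y)) +
      l y * ((1 / 2) * (pd i (pd j z) y * pd k w y + pd j z y * pd i (pd k w) y +
        (pd i (pd j w) y * pd k z y + pd j w y * pd i (pd k z) y))) := by
  have dz := fun j => H.differentiableAt (H.smooth_pd j H.smooth_z) hy
  have dw := fun j => H.differentiableAt (H.smooth_pd j H.smooth_w) hy
  have dl := H.differentiableAt H.smooth_l hy
  have hG : ∀ y ∈ U, G y j k =
      l y * ((1 / 2) * (pd j z y * pd k w y + pd j w y * pd k z y)) := fun y hy => H.form y hy j k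
  have d1 := ((dz j).fun_mul (dw k)).fun_add ((dw j).fun_mul (dz k))
  rw [pd_congr_on i H.isOpen hG hy, pd_mul i dl (d1.const_mul _), pd_const_mul i _ d1,
    pd_add i ((dz j).fun_mul (dw k)) ((dw j).fun_mul (dz k)), pd_mul i (dz j) (dw k),
    pd_mul i (dw j) (dz k)]

/-- In null coordinates the only Christoffel symbols are (log l)_z and (log l)_w. The second
derivatives of z and w account for the passage to the coordinates of the plane. -/
theorem christoffel_eq (hy : y ∈ U) (k i j : Fin 2) : christoffel G k i j y =
    (jac z w y)⁻¹ * (![pd 1 w y, -pd 0 w y] k *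
        (pd i (pd j z) y + delZ z w l y / l y * pd i z y * pd j z y)
      + ![-pd 1 z y, pd 0 z y] k *
        (pd i (pd j w) y + delW z w l y / l y * pd i w y * pd j w y)) := by
  have hl := H.l_ne y hy
  have hJ := H.jac_ne y hy
  have hU := H.isOpen.mem_nhds hy
  have cz : ∀ i j, pd i (pd j z) y = pd j (pd i z) y := fun i j =>
    pd_comm i j (H.smooth_z.contDiffAt hU)
  have cw : ∀ i j, pd i (pd j w) y = pd j (pd i w) y := fun i j =>
    pd_comm i j (H.smooth_w.contDiffAt hU)
  set X := pd i (pd j z) y + delZ z w l y / l y * pd i z y * pd j z y with hX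
  set Y := pd i (pd j w) y + delW z w l y / l y * pd i w y * pd j w y with hY
  have hE : ∀ m, pd i (fun y' => G y' j m) y + pd j (fun y' => G y' i m) y -
      pd m (fun y' => G y' i j) y = l y * (X * pd m w y + Y * pd m z y) := by
    intro m
    rw [H.pd_form hy, H.pd_form hy, H.pd_form hy, H.pd_l hy, H.pd_l hy, H.pd_l hy, cz j i, cw j i,
      cz m i, cw m i, cz m j, cw m j, hX, hY]
    ring
  rw [christoffel]
  simp only [hE, (H.form y hy).inv hl hJ, Fin.sum_univ_two]
  have hJ' : pd 0 z y * pd 1 w y - pd 1 z y * pd 0 w y = jac z w y := rfl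
  rw [hJ']
  have e0 : pd 0 z y * pd 1 w y = jac z w y + pd 1 z y * pd 0 w y := by rw [← hJ']; ring
  clear_value X Y
  generalize jac z w y = J at *
  fin_cases k <;> simp <;> field_simp
  · linear_combination (X * pd 1 w y - Y * pd 1 z y) * e0
  · linear_combination (-X * pd 0 w y + Y * pd 0 z y) * e0

/-- In invariant form this is ∇dz = −(log l)_z dz², the only fact about the connection, with its
counterpart for w, that the curvature and the Laplacian need. -/
theorem sum_pd_z_mul_christoffel (hy : y ∈ U) (i j : Fin 2) :
    ∑ k, pd k z y * christoffel G k i j y =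
      pd i (pd j z) y + delZ z w l y / l y * pd i z y * pd j z y := by
  have hJ := H.jac_ne y hy
  simp only [Fin.sum_univ_two, H.christoffel_eq hy]
  have hJ' : jac z w y = pd 0 z y * pd 1 w y - pd 1 z y * pd 0 w y := rfl
  generalize jac z w y = J at *
  simp
  field_simp
  rw [hJ']
  ring

theorem sum_pd_w_mul_christoffel (hy : y ∈ U) (i j : Fin 2) :
    ∑ k, pd k w y * christoffel G k i j y =
      pd i (pd j w) y + delW z w l y / l y * pd i w y * pd j w y := by
  have hJ := H.jac_ne y hy
  simp only [Fin.sum_univ_two, H.christoffel_eq hy]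
  have hJ' : jac z w y = pd 0 z y * pd 1 w y - pd 1 z y * pd 0 w y := rfl
  generalize jac z w y = J at *
  simp
  field_simp
  rw [hJ']
  ring

theorem smooth_christoffel (k i j : Fin 2) : ContDiffOn ℝ ∞ (christoffel G k i j) U := by
  refine ContDiffOn.congr ?_ fun y hy => H.christoffel_eq hy k i j
  have h1 := H.smooth_pd i (H.smooth_pd j H.smooth_z)
  have h2 := H.smooth_pd i (H.smooth_pd j H.smooth_w)
  have hz := fun i => H.smooth_pd i H.smooth_z
  have hw := fun i => H.smooth_pd i H.smooth_w
  have hX := h1.add ((H.smooth_a.mul (hz i)).mul (hz j))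
  have hY := h2.add ((H.smooth_b.mul (hw i)).mul (hw j))
  refine H.smooth_jac_inv.mul (ContDiffOn.add (ContDiffOn.mul ?_ hX) (ContDiffOn.mul ?_ hY))
  · fin_cases k
    exacts [hw 1, (hw 0).neg]
  · fin_cases k
    exacts [(hz 1).neg, hz 0]

/-- The form `a dz + b dw = dl / l` is closed. -/
theorem delW_a (hy : y ∈ U) : delW z w (fun y => delZ z w l y / l y) y =
    delZ z w (fun y => delW z w l y / l y) y := by
  have hU := H.isOpen.mem_nhds hy
  have hl := H.l_ne y hy
  have da := H.differentiableAt H.smooth_a hy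
  have db := H.differentiableAt H.smooth_b hy
  have dl := H.differentiableAt H.smooth_l hy
  have dz := fun i => H.differentiableAt (H.smooth_pd i H.smooth_z) hy
  have dw := fun i => H.differentiableAt (H.smooth_pd i H.smooth_w) hy
  have h2 : ∀ i j, pd i (pd j l) y = _ := fun i j => by
    rw [pd_congr_on i H.isOpen (fun y hy => H.pd_l hy j) hy,
      pd_mul i dl ((da.fun_mul (dz j)).fun_add (db.fun_mul (dw j))),
      pd_add i (da.fun_mul (dz j)) (db.fun_mul (dw j)), pd_mul i da (dz j), pd_mul i db (dw j),
      H.pd_l hy i]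
  have key := pd_comm 0 1 (H.smooth_l.contDiffAt hU)
  rw [h2, h2, pd_comm 0 1 (H.smooth_z.contDiffAt hU), pd_comm 0 1 (H.smooth_w.contDiffAt hU)] at key
  rw [delW, delZ]
  congr 1
  simp only [smul_eq_mul]
  refine mul_left_cancel₀ hl ?_
  linear_combination -key

end NullMetric

/-- The contraction of the curvature tensor with `dz`, if `∇dz = -a dz²`. -/
theorem sum_pd_mul_riemann (hU : IsOpen U) {a : Plane → ℂ} (hz : ContDiffOn ℝ ∞ z U)
    (ha : ContDiffOn ℝ ∞ a U) (hΓ : ∀ k i j, ContDiffOn ℝ ∞ (christoffel G k i j) U)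
    (hE : ∀ y ∈ U, ∀ j k, ∑ m, pd m z y * christoffel G m j k y =
      pd j (pd k z) y + a y * pd j z y * pd k z y) (hy : y ∈ U) (i j k : Fin 2) :
    ∑ m, pd m z y * riemann G m i j k y =
      (pd i a y * pd j z y - pd j a y * pd i z y) * pd k z y := by
  have dz := fun i => differentiableAt_of_contDiffOn hU (contDiffOn_pd i hU hz) hy
  have dz2 := fun i j =>
    differentiableAt_of_contDiffOn hU (contDiffOn_pd i hU (contDiffOn_pd j hU hz)) hy
  have da := differentiableAt_of_contDiffOn hU ha hy
  have dΓ := fun m j k => differentiableAt_of_contDiffOn hU (hΓ m j k) hy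
  have hn := hU.mem_nhds hy
  have D : ∀ i j k, pd i (pd 0 z) y * christoffel G 0 j k y + pd 0 z y * pd i (christoffel G 0 j k) y
      + (pd i (pd 1 z) y * christoffel G 1 j k y + pd 1 z y * pd i (christoffel G 1 j k) y) =
      pd i (pd j (pd k z)) y + ((pd i a y * pd j z y + a y * pd i (pd j z) y) * pd k z y +
        a y * pd j z y * pd i (pd k z) y) := by
    intro i j k
    have h := pd_congr_on i hU (fun y hy => hE y hy j k) hy
    simp only [Fin.sum_univ_two] at h
    rw [pd_add i ((dz 0).fun_mul (dΓ 0 j k)) ((dz 1).fun_mul (dΓ 1 j k)), pd_mul i (dz 0) (dΓ 0 j k),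
      pd_mul i (dz 1) (dΓ 1 j k), pd_add i (dz2 j k) ((da.fun_mul (dz j)).fun_mul (dz k)),
      pd_mul i (da.fun_mul (dz j)) (dz k), pd_mul i da (dz j)] at h
    exact h
  have E := fun j k => hE y hy j k
  simp only [Fin.sum_univ_two] at E
  have c2 : ∀ i j, pd i (pd j z) y = pd j (pd i z) y := fun i j => pd_comm i j (hz.contDiffAt hn)
  have c3 : pd i (pd j (pd k z)) y = pd j (pd i (pd k z)) y :=
    pd_comm i j ((contDiffOn_pd k hU hz).contDiffAt hn)
  simp only [riemann, Fin.sum_univ_two]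
  -- Differentiate the formula for Γ contracted with dz and antisymmetrize in i and j. Third
  -- derivatives of z cancel, and the quadratic terms in Γ are removed by the same formula.
  linear_combination D i j k - D j i k + c3 + christoffel G 0 j k y * E i 0 +
    christoffel G 1 j k y * E i 1 - christoffel G 0 i k y * E j 0 - christoffel G 1 i k y * E j 1 +
    a y * pd i z y * E j k - a y * pd j z y * E i k + a y * pd k z y * c2 i j

namespace NullMetric

variable (H : NullMetric U z w l G)
include H

/-- The Gauss curvature of `l dz dw` is `-(2 / l) ∂²(log l) / ∂z ∂w`. -/
theorem curvature_eq (hy : y ∈ U) :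
    curvature G y = -(2 / l y) * delW z w (fun y => delZ z w l y / l y) y := by
  have hJ := H.jac_ne y hy
  have hl := H.l_ne y hy
  have hz := sum_pd_mul_riemann H.isOpen H.smooth_z H.smooth_a H.smooth_christoffel
    (fun y hy => H.sum_pd_z_mul_christoffel hy) hy 0 1 1
  have hw := sum_pd_mul_riemann H.isOpen H.smooth_w H.smooth_b H.smooth_christoffel
    (fun y hy => H.sum_pd_w_mul_christoffel hy) hy 0 1 1
  have ha : ∀ i, pd i (fun y => delZ z w l y / l y) y = _ := fun i =>
    pd_eq_delZ_add_delW i hJ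
  have hb : ∀ i, pd i (fun y => delW z w l y / l y) y = _ := fun i =>
    pd_eq_delZ_add_delW i hJ
  rw [ha, ha] at hz
  rw [hb, hb, ← H.delW_a hy] at hw
  rw [curvature, (H.form y hy).det]
  have hG : ∀ i j, G y i j = l y * ((1 / 2) * (pd i z y * pd j w y + pd i w y * pd j z y)) :=
    H.form y hy
  simp only [hG, smul_eq_mul, Fin.sum_univ_two] at hz hw ⊢
  have hJ' : jac z w y = pd 0 z y * pd 1 w y - pd 1 z y * pd 0 w y := rfl
  rw [← hJ', div_eq_iff (by simp [hJ, hl])]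
  set m := delW z w (fun y => delZ z w l y / l y) y
  clear_value m
  have e : -(2 / l y) * m * -(l y ^ 2 / 4 * jac z w y ^ 2) = l y / 2 * m * jac z w y ^ 2 := by
    field_simp
    ring
  rw [e, hJ']
  -- The numerator g(R(∂₀, ∂₁)∂₁, ∂₀) is assembled from the dz- and dw-components of the curvature
  -- vector, each given by `sum_pd_mul_riemann`.
  linear_combination (l y / 2 * pd 0 w y) * hz + (l y / 2 * pd 0 z y) * hw

/-- The Laplacian of `l dz dw` is `(4 / l) ∂² / ∂z ∂w`. -/
theorem laplacian_eq {f : Plane → ℂ} (hf : ContDiffOn ℝ ∞ f U) (hy : y ∈ U) :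
    laplacian G f y = 4 / l y * delW z w (delZ z w f) y := by
  have hJ := H.jac_ne y hy
  have hl := H.l_ne y hy
  have h1 : ∀ i, pd i f y = _ := fun i => pd_eq_delZ_add_delW i hJ
  have h2 := fun i j => H.pd_pd i j (H.smooth_delZ hf) (H.smooth_delW hf)
    (fun y hy i => pd_eq_delZ_add_delW i (H.jac_ne y hy)) hy
  have h3 : ∀ i, pd i (delZ z w f) y = _ := fun i => pd_eq_delZ_add_delW i hJ
  have h4 : ∀ i, pd i (delW z w f) y = _ := fun i => pd_eq_delZ_add_delW i hJ
  have hess : ∀ i j, pd i (pd j f) y - ∑ k, christoffel G k i j y * pd k f y =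
      pd j z y * pd i (delZ z w f) y + pd j w y * pd i (delW z w f) y
      - delZ z w l y / l y * pd i z y * pd j z y * delZ z w f y
      - delW z w l y / l y * pd i w y * pd j w y * delW z w f y := by
    intro i j
    have ez := H.sum_pd_z_mul_christoffel hy i j
    have ew := H.sum_pd_w_mul_christoffel hy i j
    simp only [Fin.sum_univ_two] at ez ew ⊢
    rw [h2, h1 0, h1 1]
    simp only [smul_eq_mul]
    linear_combination -delZ z w f y * ez - delW z w f y * ew
  rw [laplacian]
  simp only [hess, (H.form y hy).inv hl hJ, h3, h4, ← H.delW_delZ hf hy]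
  have hJ' : jac z w y = pd 0 z y * pd 1 w y - pd 1 z y * pd 0 w y := rfl
  simp only [← hJ', smul_eq_mul, Fin.sum_univ_two]
  generalize jac z w y = J at *
  simp
  field_simp
  rw [hJ']
  ring

end NullMetric

end NullMetric

end CAS
end

noncomputable section

namespace CAS

/-! ### Pointwise algebra of the form l dz dw -/

section Algebra

variable {G : Matrix (Fin 2) (Fin 2) ℂ} {l s : ℂ} {Z W v v' : Fin 2 → ℂ}

theorem exists_eq_smul_of_mul_add_mul_eq_zero (hZ : side Z ≠ 0) (h : Z 0 * v 0 + Z 1 * v 1 = 0) :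
    ∃ c : ℂ, v 0 = -(c * Z 1) ∧ v 1 = c * Z 0 := by
  have hZ0 : Z 0 ≠ 0 := fun h0 => hZ (by simp [side, h0])
  refine ⟨v 1 / Z 0, ?_, by field_simp⟩
  field_simp
  linear_combination h

/-- The kernel of a covector lies on the same side as the covector. Hence the orientations of z and
w decide on which sides the isotropic lines ker dz and ker dw lie. -/
theorem side_eq_normSq_mul {c : ℂ} (h0 : v 0 = -(c * Z 1)) (h1 : v 1 = c * Z 0) :
    side v = Complex.normSq c * side Z := by
  simp only [side, h0, h1, map_neg, map_mul, Complex.mul_im, Complex.mul_re, Complex.conj_re,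
    Complex.conj_im, Complex.neg_im, Complex.neg_re, Complex.normSq_apply]
  ring

/-- Proportional covectors cannot have sides of opposite sign. This is why coordinates of opposite
orientations are automatically independent. -/
theorem jac_ne_zero_of_side (hZ : 0 < side Z) (hW : side W < 0) : Z 0 * W 1 - Z 1 * W 0 ≠ 0 := by
  intro h
  obtain ⟨c, h0, h1⟩ := exists_eq_smul_of_mul_add_mul_eq_zero (Z := Z) (v := ![W 1, -W 0])
    hZ.ne' (by simp; linear_combination h)
  have h2 : W 0 = -(c * Z 0) := by simpa [neg_eq_iff_eq_neg] using h1
  have h3 : W 1 = -(c * Z 1) := h0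
  have : side W = Complex.normSq c * side Z := by
    simp only [side, h2, h3, map_neg, map_mul, Complex.mul_im, Complex.mul_re, Complex.conj_re,
      Complex.conj_im, Complex.neg_im, Complex.neg_re, Complex.normSq_apply]
    ring
  have := mul_nonneg (Complex.normSq_nonneg c) hZ.le
  linarith

namespace IsNullForm

variable (h : IsNullForm G l Z W)
include h

theorem dotProduct_mulVec (v v' : Fin 2 → ℂ) : v ⬝ᵥ G.mulVec v' =
    l / 2 * ((Z 0 * v 0 + Z 1 * v 1) * (W 0 * v' 0 + W 1 * v' 1) +
      (W 0 * v 0 + W 1 * v 1) * (Z 0 * v' 0 + Z 1 * v' 1)) := by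
  simp only [dotProduct, Matrix.mulVec, Fin.sum_univ_two, h _ _]
  ring

theorem isIsotropic_iff (hl : l ≠ 0) : IsIsotropic G v ↔
    Z 0 * v 0 + Z 1 * v 1 = 0 ∨ W 0 * v 0 + W 1 * v 1 = 0 := by
  rw [IsIsotropic, h.dotProduct_mulVec, ← mul_eq_zero]
  have : l / 2 * ((Z 0 * v 0 + Z 1 * v 1) * (W 0 * v 0 + W 1 * v 1) +
      (W 0 * v 0 + W 1 * v 1) * (Z 0 * v 0 + Z 1 * v 1)) =
      l * ((Z 0 * v 0 + Z 1 * v 1) * (W 0 * v 0 + W 1 * v 1)) := by ring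
  rw [this, mul_eq_zero, or_iff_right hl]

theorem isPositiveForm (hl : l ≠ 0) (hZ : 0 < side Z) (hW : side W < 0) : IsPositiveForm G := by
  have hz : side ![-Z 1, Z 0] = side Z := by
    rw [side_eq_normSq_mul (Z := Z) (c := 1) (by simp) (by simp)]; simp
  have hw : side ![-W 1, W 0] = side W := by
    rw [side_eq_normSq_mul (Z := W) (c := 1) (by simp) (by simp)]; simp
  refine ⟨fun v hv hiso => ?_, ⟨![-Z 1, Z 0], ?_, by rwa [hz]⟩, ⟨![-W 1, W 0], ?_, by rwa [hw]⟩⟩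
  · have aux : ∀ {Z : Fin 2 → ℂ}, side Z ≠ 0 → Z 0 * v 0 + Z 1 * v 1 = 0 → side v ≠ 0 := by
      intro Z hZ h0
      obtain ⟨c, h0, h1⟩ := exists_eq_smul_of_mul_add_mul_eq_zero hZ h0
      rw [side_eq_normSq_mul h0 h1]
      refine mul_ne_zero ?_ hZ
      rw [Ne, Complex.normSq_eq_zero]
      rintro rfl
      refine hv (funext fun i => ?_)
      fin_cases i <;> simp [h0, h1]
    rcases (h.isIsotropic_iff hl).1 hiso with h0 | h0
    exacts [aux hZ.ne' h0, aux hW.ne h0]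
  · exact (h.isIsotropic_iff hl).2 (Or.inl (by simp; ring))
  · exact (h.isIsotropic_iff hl).2 (Or.inr (by simp; ring))

/-- The volume form of `l dz dw` is `(i / 2) l dz ∧ dw`. -/
theorem isVolumeCoeff_iff (hl : l ≠ 0) (hZ : 0 < side Z) (hW : side W < 0) :
    IsVolumeCoeff G s ↔ s = Complex.I * l / 2 * (Z 0 * W 1 - Z 1 * W 0) := by
  have hJ := jac_ne_zero_of_side hZ hW
  have hz : side ![-Z 1, Z 0] = side Z := by
    rw [side_eq_normSq_mul (Z := Z) (c := 1) (by simp) (by simp)]; simp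
  have hw : side ![-W 1, W 0] = side W := by
    rw [side_eq_normSq_mul (Z := W) (c := 1) (by simp) (by simp)]; simp
  constructor
  · rintro ⟨-, hs⟩
    have := hs ![-W 1, W 0] ![-Z 1, Z 0] ((h.isIsotropic_iff hl).2 (Or.inr (by simp; ring)))
      ((h.isIsotropic_iff hl).2 (Or.inl (by simp; ring))) (by rwa [hw]) (by rwa [hz])
    rw [h.dotProduct_mulVec] at this
    simp at this
    refine mul_right_cancel₀ hJ ?_
    linear_combination -this
  · rintro rfl
    refine ⟨?_, fun v v' hv hv' hn hp => ?_⟩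
    · rw [h.det]
      linear_combination (l ^ 2 / 4 * (Z 0 * W 1 - Z 1 * W 0) ^ 2) * Complex.I_sq
    · have h1 : W 0 * v 0 + W 1 * v 1 = 0 := by
        rcases (h.isIsotropic_iff hl).1 hv with h0 | h0
        · obtain ⟨c, h0, h1⟩ := exists_eq_smul_of_mul_add_mul_eq_zero hZ.ne' h0
          rw [side_eq_normSq_mul h0 h1] at hn
          exact absurd hn (not_lt.2 (mul_nonneg (Complex.normSq_nonneg c) hZ.le))
        · exact h0
      have h2 : Z 0 * v' 0 + Z 1 * v' 1 = 0 := by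
        rcases (h.isIsotropic_iff hl).1 hv' with h0 | h0
        · exact h0
        · obtain ⟨c, h0, h1⟩ := exists_eq_smul_of_mul_add_mul_eq_zero hW.ne h0
          rw [side_eq_normSq_mul h0 h1] at hp
          exact absurd hp (not_lt.2 (mul_nonpos_of_nonneg_of_nonpos (Complex.normSq_nonneg c) hW.le))
      rw [h.dotProduct_mulVec, h1, h2]
      obtain ⟨c, h0, h1⟩ := exists_eq_smul_of_mul_add_mul_eq_zero hW.ne h1
      obtain ⟨c', h0', h1'⟩ := exists_eq_smul_of_mul_add_mul_eq_zero hZ.ne' h2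
      rw [h0, h1, h0', h1']
      ring

/-- The dual metric pairs dz with dw to 2/l. The cubic pairing is the third power of this, whence
the factor 8/l³. -/
theorem sum_inv_mul (hl : l ≠ 0) (hJ : Z 0 * W 1 - Z 1 * W 0 ≠ 0) :
    ∑ i, ∑ j, G⁻¹ i j * (Z i * W j) = 2 / l := by
  simp only [h.inv hl hJ, Fin.sum_univ_two]
  simp
  field_simp
  ring

/-- The pairing of `p dz³` and `q dw³` for the metric `l dz dw`. -/
theorem sum_pairing (hl : l ≠ 0) (hJ : Z 0 * W 1 - Z 1 * W 0 ≠ 0) (p q : ℂ) :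
    ∑ i : Fin 3 → Fin 2, ∑ j : Fin 3 → Fin 2,
      (∏ a, G⁻¹ (i a) (j a)) * (p * ∏ a, Z (i a)) * (q * ∏ a, W (j a)) =
      8 * p * q / l ^ 3 := by
  have key : (∏ _a : Fin 3, ∑ i, ∑ j, G⁻¹ i j * (Z i * W j)) =
      ∑ i : Fin 3 → Fin 2, ∑ j : Fin 3 → Fin 2, ∏ a, (G⁻¹ (i a) (j a) * (Z (i a) * W (j a))) := by
    rw [Finset.prod_univ_sum, Fintype.piFinset_univ]
    refine Finset.sum_congr rfl fun i _ => ?_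
    rw [Finset.prod_univ_sum, Fintype.piFinset_univ]
  have : ∀ i j : Fin 3 → Fin 2, (∏ a, G⁻¹ (i a) (j a)) * (p * ∏ a, Z (i a)) * (q * ∏ a, W (j a)) =
      p * q * ∏ a, (G⁻¹ (i a) (j a) * (Z (i a) * W (j a))) := by
    intro i j
    rw [Finset.prod_mul_distrib, Finset.prod_mul_distrib]
    ring
  simp only [this, ← Finset.mul_sum, ← key, h.sum_inv_mul hl hJ]
  simp
  field_simp
  norm_num

end IsNullForm

end Algebra

/-! ### Conformal change of metric and the model metric of curvature −1 -/

section Conformal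

variable {z w l : Plane → ℂ} {G : Plane → Matrix (Fin 2) (Fin 2) ℂ} {y : Plane} {U : Set Plane}

theorem pd_exp (i : Fin 2) {f : Plane → ℂ} (hf : DifferentiableAt ℝ f y) :
    pd i (fun x => Complex.exp (f x)) y = Complex.exp (f y) * pd i f y := by
  rw [pd, hf.hasFDerivAt.cexp.fderiv]
  rfl

namespace NullMetric

variable (H : NullMetric U z w l G)
include H

theorem exp_smul {u : Plane → ℂ} (hu : ContDiffOn ℝ ∞ u U) :
    NullMetric U z w (fun y => Complex.exp (2 * u y) * l y)
      (fun y => Complex.exp (2 * u y) • G y) where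
  toNullCoords := H.toNullCoords
  smooth_l := ((contDiffOn_const.mul hu).cexp).mul H.smooth_l
  l_ne y hy := mul_ne_zero (Complex.exp_ne_zero _) (H.l_ne y hy)
  form y hy i j := by
    rw [Matrix.smul_apply, H.form y hy i j, smul_eq_mul]
    ring

/-- The curvature of a conformal metric. -/
theorem curvature_exp_smul {u : Plane → ℂ} (hu : ContDiffOn ℝ ∞ u U) (hy : y ∈ U) :
    curvature (fun y => Complex.exp (2 * u y) • G y) y =
      Complex.exp (-(2 * u y)) * (curvature G y - laplacian G u y) := by
  have hJ := H.jac_ne y hy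
  have hl := H.l_ne y hy
  have hlog : ∀ y ∈ U, delZ z w (fun y => Complex.exp (2 * u y) * l y) y /
      (Complex.exp (2 * u y) * l y) = 2 * delZ z w u y + delZ z w l y / l y := by
    intro y hy
    have hJ := H.jac_ne y hy
    have hl := H.l_ne y hy
    have du := H.differentiableAt hu hy
    have dl := H.differentiableAt H.smooth_l hy
    have h2u : DifferentiableAt ℝ (fun y => 2 * u y) y := du.const_mul _
    have : delZ z w (fun y => Complex.exp (2 * u y) * l y) y =
        Complex.exp (2 * u y) * (2 * delZ z w u y * l y + delZ z w l y) := by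
      refine delZ_eq hJ (b := Complex.exp (2 * u y) * (2 * delW z w u y * l y + delW z w l y))
        fun i => ?_
      rw [pd_mul i h2u.cexp dl, pd_exp i h2u, pd_const_mul i 2 du,
        pd_eq_delZ_add_delW (f := u) i hJ, pd_eq_delZ_add_delW (f := l) i hJ]
      simp only [smul_eq_mul]
      ring
    rw [this]
    field_simp
  have hW : delW z w (fun y => delZ z w (fun y => Complex.exp (2 * u y) * l y) y /
      (Complex.exp (2 * u y) * l y)) y = 2 * delW z w (delZ z w u) y +
        delW z w (fun y => delZ z w l y / l y) y := by
    refine delW_eq hJ (a := 2 * delZ z w (delZ z w u) y +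
        delZ z w (fun y => delZ z w l y / l y) y) fun i => ?_
    have d1 := H.differentiableAt (H.smooth_delZ hu) hy
    have d2 := H.differentiableAt H.smooth_a hy
    rw [pd_congr_on i H.isOpen hlog hy, pd_add i (d1.const_mul 2) d2, pd_const_mul i 2 d1,
      pd_eq_delZ_add_delW (f := delZ z w u) i hJ,
      pd_eq_delZ_add_delW (f := fun y => delZ z w l y / l y) i hJ]
    simp only [smul_eq_mul]
    ring
  rw [(H.exp_smul hu).curvature_eq hy, hW, H.curvature_eq hy, H.laplacian_eq hu hy, Complex.exp_neg]
  field_simp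
  ring

end NullMetric

/-- The metric `-4 / (z - w)² dz dw` has curvature `-1`. -/
theorem NullMetric.curvature_eq_neg_one
    (H : NullMetric U z w (fun y => -4 / (z y - w y) ^ 2) G) (hne : ∀ y ∈ U, z y ≠ w y)
    (hy : y ∈ U) : curvature G y = -1 := by
  have hd : ∀ y ∈ U, z y - w y ≠ 0 := fun y hy => sub_ne_zero.2 (hne y hy)
  have hinv : ∀ y ∈ U, ∀ i, pd i (fun y => (z y - w y)⁻¹) y =
      -(pd i z y - pd i w y) / (z y - w y) ^ 2 := by
    intro y hy i
    have dz := H.differentiableAt H.smooth_z hy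
    have dw := H.differentiableAt H.smooth_w hy
    rw [pd_inv i (dz.fun_sub dw) (hd y hy), pd_sub i dz dw]
  have dinv : ∀ y ∈ U, DifferentiableAt ℝ (fun y => (z y - w y)⁻¹) y := fun y hy =>
    ((H.differentiableAt H.smooth_z hy).fun_sub (H.differentiableAt H.smooth_w hy)).fun_inv (hd y hy)
  have ha : ∀ y ∈ U, delZ z w (fun y => -4 / (z y - w y) ^ 2) y / (-4 / (z y - w y) ^ 2) =
      -2 * (z y - w y)⁻¹ := by
    intro y hy
    have h0 := hd y hy
    have : delZ z w (fun y => -4 / (z y - w y) ^ 2) y = 8 / (z y - w y) ^ 3 := by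
      refine delZ_eq (H.jac_ne y hy) (b := -8 / (z y - w y) ^ 3) fun i => ?_
      have e : (fun y => -4 / (z y - w y) ^ 2) = fun y => -4 * ((z y - w y)⁻¹ * (z y - w y)⁻¹) := by
        funext y
        rw [← mul_inv, div_eq_mul_inv, pow_two]
      rw [e, pd_const_mul i _ ((dinv y hy).fun_mul (dinv y hy)), pd_mul i (dinv y hy) (dinv y hy),
        hinv y hy]
      simp only [smul_eq_mul]
      field_simp
      ring
    rw [this]
    field_simp
    norm_num
  have h0 := hd y hy
  have hW : delW z w (fun y => delZ z w (fun y => -4 / (z y - w y) ^ 2) y /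
      (-4 / (z y - w y) ^ 2)) y = -2 / (z y - w y) ^ 2 := by
    refine delW_eq (H.jac_ne y hy) (a := 2 / (z y - w y) ^ 2) fun i => ?_
    rw [pd_congr_on i H.isOpen ha hy, pd_const_mul i _ (dinv y hy), hinv y hy]
    simp only [smul_eq_mul]
    field_simp
    ring
  rw [H.curvature_eq hy, hW]
  field_simp
  norm_num

end Conformal

end CAS
end

noncomputable section

namespace CAS

/-! ### Determinants and components in ℂ³ -/

section Det

/-- The determinant of three vectors of `ℂ³`. -/
def det3 (a b c : C3) : ℂ := (Matrix.of ![a, b, c]).det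

theorem det3_eq (a b c : C3) : det3 a b c = a 0 * b 1 * c 2 - a 0 * b 2 * c 1 - a 1 * b 0 * c 2 +
    a 1 * b 2 * c 0 + a 2 * b 0 * c 1 - a 2 * b 1 * c 0 := by
  simp [det3, Matrix.det_fin_three]

theorem frame_eq (σ ξ : Plane → C3) (y : Plane) :
    frame σ ξ y = (Matrix.of ![pd 0 σ y, pd 1 σ y, ξ y]).transpose := rfl

theorem inducedVolume_eq (σ ξ : Plane → C3) (y : Plane) :
    inducedVolume σ ξ y = det3 (pd 0 σ y) (pd 1 σ y) (ξ y) := by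
  rw [inducedVolume, frame_eq, Matrix.det_transpose, det3]

theorem linearIndependent_iff_det3_ne_zero {a b c : C3} :
    LinearIndependent ℂ ![a, b, c] ↔ det3 a b c ≠ 0 := by
  have := Matrix.linearIndependent_rows_iff_isUnit (A := Matrix.of ![a, b, c])
  rw [Matrix.isUnit_iff_isUnit_det, isUnit_iff_ne_zero] at this
  exact this

theorem det3_linear (a b c : C3) (z₀ z₁ w₀ w₁ : ℂ) :
    det3 (z₀ • a + w₀ • b) (z₁ • a + w₁ • b) c = (z₀ * w₁ - z₁ * w₀) * det3 a b c := by
  simp only [det3_eq, Pi.add_apply, Pi.smul_apply, smul_eq_mul]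
  ring

theorem frame_mulVec (σ ξ : Plane → C3) (y : Plane) (c : Fin 3 → ℂ) :
    (frame σ ξ y).mulVec c = c 0 • pd 0 σ y + c 1 • pd 1 σ y + c 2 • ξ y := by
  ext n
  simp [Matrix.mulVec, dotProduct, frame, Fin.sum_univ_three]
  ring

theorem component_eq_iff {σ ξ : Plane → C3} {y : Plane}
    (h : inducedVolume σ ξ y ≠ 0) {v : C3} {c : Fin 3 → ℂ} :
    component σ ξ y v = c ↔ v = c 0 • pd 0 σ y + c 1 • pd 1 σ y + c 2 • ξ y := by
  have hu : IsUnit (frame σ ξ y).det := isUnit_iff_ne_zero.2 h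
  rw [← frame_mulVec, component]
  constructor
  · rintro rfl
    rw [Matrix.mulVec_mulVec, Matrix.mul_nonsing_inv _ hu, Matrix.one_mulVec]
  · rintro rfl
    rw [Matrix.mulVec_mulVec, Matrix.nonsing_inv_mul _ hu, Matrix.one_mulVec]

theorem pd_mul_mul (i : Fin 2) {a b c : Plane → ℂ} {y : Plane} (ha : DifferentiableAt ℝ a y)
    (hb : DifferentiableAt ℝ b y) (hc : DifferentiableAt ℝ c y) :
    pd i (fun x => a x * b x * c x) y =
      pd i a y * b y * c y + a y * pd i b y * c y + a y * b y * pd i c y := by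
  rw [pd_mul i (ha.fun_mul hb) hc, pd_mul i ha hb]
  ring

theorem pd_det3 (i : Fin 2) {f g h : Plane → C3} {y : Plane} (hf : DifferentiableAt ℝ f y)
    (hg : DifferentiableAt ℝ g y) (hh : DifferentiableAt ℝ h y) :
    pd i (fun x => det3 (f x) (g x) (h x)) y =
      det3 (pd i f y) (g y) (h y) + det3 (f y) (pd i g y) (h y) + det3 (f y) (g y) (pd i h y) := by
  have df := fun n => (differentiableAt_pi.1 hf n)
  have dg := fun n => (differentiableAt_pi.1 hg n)
  have dh := fun n => (differentiableAt_pi.1 hh n)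
  have dt := fun m n k => ((df m).fun_mul (dg n)).fun_mul (dh k)
  simp only [det3_eq]
  rw [pd_sub i ((((((dt 0 1 2).fun_sub (dt 0 2 1)).fun_sub (dt 1 0 2)).fun_add
      (dt 1 2 0))).fun_add (dt 2 0 1)) (dt 2 1 0),
    pd_add i (((((dt 0 1 2).fun_sub (dt 0 2 1)).fun_sub (dt 1 0 2)).fun_add (dt 1 2 0))) (dt 2 0 1),
    pd_add i (((dt 0 1 2).fun_sub (dt 0 2 1)).fun_sub (dt 1 0 2)) (dt 1 2 0),
    pd_sub i ((dt 0 1 2).fun_sub (dt 0 2 1)) (dt 1 0 2), pd_sub i (dt 0 1 2) (dt 0 2 1)]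
  simp only [pd_mul_mul i (df _) (dg _) (dh _), pd_pi_apply i hf, pd_pi_apply i hg,
    pd_pi_apply i hh]
  ring

end Det

/-! ### Affine spheres as solutions of the structure equations -/

section Sphere

/-- The conditions on a map into `ℂ³` to be an affine sphere with metric `G` and Pick tensor `C`,
with the position vector as affine normal, at a point of the plane. -/
structure SphereAt (G : Plane → Matrix (Fin 2) (Fin 2) ℂ) (C : Plane → (Fin 3 → Fin 2) → ℂ)
    (σ : Plane → C3) (y : Plane) : Prop where
  transversal : LinearIndependent ℂ ![pd 0 σ y, pd 1 σ y, σ y]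
  metric : ∀ i j, fundamentalForm σ σ i j y = G y i j
  parallel : ∀ i, pd i (inducedVolume σ σ) y
    - (∑ k, inducedConnection σ σ k i k y) * inducedVolume σ σ y = 0
  volume : IsVolumeCoeff (G y) (inducedVolume σ σ y)
  shape : ∀ k i, shapeOperator σ σ k i y = if k = i then -1 else 0
  pick : ∀ i j k, C y ![i, j, k] =
    -2 * ∑ l, (inducedConnection σ σ l i j y - christoffel G l i j y) * G y l k

/-- A metric `G = l dz dw` and a cubic tensor `C = p dz³ + q dw³` with `p`, `q` holomorphic. -/
structure PickData (U : Set Plane) (z w l p q : Plane → ℂ) (G : Plane → Matrix (Fin 2) (Fin 2) ℂ)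
    (C : Plane → (Fin 3 → Fin 2) → ℂ) : Prop extends NullMetric U z w l G where
  side_z : ∀ y ∈ U, 0 < side fun i => pd i z y
  side_w : ∀ y ∈ U, side (fun i => pd i w y) < 0
  smooth_p : ContDiffOn ℝ ∞ p U
  smooth_q : ContDiffOn ℝ ∞ q U
  delW_p : ∀ y ∈ U, delW z w p y = 0
  delZ_q : ∀ y ∈ U, delZ z w q y = 0
  cubic : ∀ y ∈ U, ∀ i, C y i = p y * ∏ a, pd (i a) z y + q y * ∏ a, pd (i a) w y

/-- The structure equations of an affine sphere in null coordinates. -/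
structure StructureEqs (z w l p q : Plane → ℂ) (σ : Plane → C3) (y : Plane) : Prop where
  pd_delZ : ∀ i, pd i (delZ z w σ) y = pd i z y • ((delZ z w l y / l y) • delZ z w σ y -
    (p y / l y) • delW z w σ y) + pd i w y • ((l y / 2) • σ y)
  pd_delW : ∀ i, pd i (delW z w σ) y = pd i z y • ((l y / 2) • σ y) +
    pd i w y • ((delW z w l y / l y) • delW z w σ y - (q y / l y) • delZ z w σ y)
  det : det3 (delZ z w σ y) (delW z w σ y) (σ y) = Complex.I * l y / 2

variable {U : Set Plane} {z w l p q : Plane → ℂ} {G : Plane → Matrix (Fin 2) (Fin 2) ℂ}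
  {C : Plane → (Fin 3 → Fin 2) → ℂ} {σ : Plane → C3} {y : Plane}

theorem inducedVolume_eq_jac_mul (hJ : jac z w y ≠ 0) :
    inducedVolume σ σ y = jac z w y * det3 (delZ z w σ y) (delW z w σ y) (σ y) := by
  rw [inducedVolume_eq, pd_eq_delZ_add_delW (f := σ) 0 hJ, pd_eq_delZ_add_delW (f := σ) 1 hJ,
    det3_linear, jac]

theorem StructureEqs.delZ_ne_zero (h : StructureEqs z w l p q σ y) (hl : l y ≠ 0) :
    delZ z w σ y ≠ 0 := by
  intro h0
  have := h.det
  rw [h0, det3_eq] at this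
  simp only [Pi.zero_apply, zero_mul, sub_self, add_zero] at this
  exact div_ne_zero (mul_ne_zero Complex.I_ne_zero hl) two_ne_zero this.symm

namespace PickData

variable (H : PickData U z w l p q G C)
include H

theorem pd_pd_sphere (hσ : ContDiffOn ℝ ∞ σ U) (hy : y ∈ U) (i j : Fin 2) :
    pd i (pd j σ) y = pd i (pd j z) y • delZ z w σ y + pd j z y • pd i (delZ z w σ) y
      + (pd i (pd j w) y • delW z w σ y + pd j w y • pd i (delW z w σ) y) :=
  H.pd_pd i j (H.smooth_delZ hσ) (H.smooth_delW hσ)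
    (fun y hy i => pd_eq_delZ_add_delW i (H.jac_ne y hy)) hy

theorem form_apply (hy : y ∈ U) (i j : Fin 2) :
    G y i j = l y * ((1 / 2) * (pd i z y * pd j w y + pd i w y * pd j z y)) := H.form y hy i j

/-- Contracting the Pick tensor with null directions determines ∇ − ∇ᵍ: its dz-component is −(q/l)
dw² and its dw-component is −(p/l) dz². Together with `NullMetric.sum_pd_z_mul_christoffel` and its
counterpart for w, this gives all second derivatives of σ. -/
theorem structureEqs_of_sphereAt (hσ : ContDiffOn ℝ ∞ σ U) (hy : y ∈ U) (h : SphereAt G C σ y) :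
    StructureEqs z w l p q σ y := by
  have hJ := H.jac_ne y hy
  have hl := H.l_ne y hy
  have hJ' : jac z w y = pd 0 z y * pd 1 w y - pd 1 z y * pd 0 w y := rfl
  have hvol : inducedVolume σ σ y ≠ 0 := by
    rw [inducedVolume_eq]
    exact linearIndependent_iff_det3_ne_zero.1 h.transversal
  -- the contractions of the difference tensor
  have hdiff : ∀ i j, ∀ k : Fin 2,
      (∑ m, pd m z y * (inducedConnection σ σ m i j y - christoffel G m i j y) +
        q y / l y * pd i w y * pd j w y) * pd k w y +
      (∑ m, pd m w y * (inducedConnection σ σ m i j y - christoffel G m i j y) +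
        p y / l y * pd i z y * pd j z y) * pd k z y = 0 := by
    intro i j k
    have h1 := h.pick i j k
    rw [H.cubic y hy] at h1
    simp only [H.form_apply hy, Fin.sum_univ_two, Fin.prod_univ_three, Matrix.cons_val_zero,
      Matrix.cons_val_one, Matrix.cons_val_two, Matrix.head_cons, Matrix.tail_cons] at h1 ⊢
    field_simp
    linear_combination h1
  have hcz : ∀ i j, ∑ m, pd m z y * inducedConnection σ σ m i j y = pd i (pd j z) y +
      delZ z w l y / l y * pd i z y * pd j z y - q y / l y * pd i w y * pd j w y := by
    intro i j
    rw [← H.sum_pd_z_mul_christoffel hy]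
    have h0 := hdiff i j 0
    have h1 := hdiff i j 1
    simp only [Fin.sum_univ_two] at h0 h1 ⊢
    refine mul_left_cancel₀ hJ ?_
    rw [hJ']
    linear_combination pd 0 z y * h1 - pd 1 z y * h0
  have hcw : ∀ i j, ∑ m, pd m w y * inducedConnection σ σ m i j y = pd i (pd j w) y +
      delW z w l y / l y * pd i w y * pd j w y - p y / l y * pd i z y * pd j z y := by
    intro i j
    rw [← H.sum_pd_w_mul_christoffel hy]
    have h0 := hdiff i j 0
    have h1 := hdiff i j 1
    simp only [Fin.sum_univ_two] at h0 h1 ⊢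
    refine mul_left_cancel₀ hJ ?_
    rw [hJ']
    linear_combination pd 1 w y * h0 - pd 0 w y * h1
  have hhess : ∀ i j, pd i (pd j σ) y =
      (∑ m, pd m z y * inducedConnection σ σ m i j y) • delZ z w σ y +
      (∑ m, pd m w y * inducedConnection σ σ m i j y) • delW z w σ y + G y i j • σ y := by
    intro i j
    have h1 := (component_eq_iff hvol (v := pd i (pd j σ) y)).1 rfl
    have e0 : component σ σ y (pd i (pd j σ) y) 0 = inducedConnection σ σ 0 i j y := rfl
    have e1 : component σ σ y (pd i (pd j σ) y) 1 = inducedConnection σ σ 1 i j y := rfl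
    have e2 : component σ σ y (pd i (pd j σ) y) 2 = G y i j := h.metric i j
    rw [e0, e1, e2, pd_eq_delZ_add_delW (f := σ) 0 hJ, pd_eq_delZ_add_delW (f := σ) 1 hJ] at h1
    rw [h1]
    simp only [Fin.sum_univ_two]
    module
  have key : ∀ i j, pd j z y • pd i (delZ z w σ) y + pd j w y • pd i (delW z w σ) y =
      (delZ z w l y / l y * pd i z y * pd j z y - q y / l y * pd i w y * pd j w y) • delZ z w σ y +
      (delW z w l y / l y * pd i w y * pd j w y - p y / l y * pd i z y * pd j z y) • delW z w σ y +
      G y i j • σ y := by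
    intro i j
    have h1 := hhess i j
    rw [H.pd_pd_sphere hσ hy, hcz, hcw, ← sub_eq_zero] at h1
    rw [← sub_eq_zero, ← h1]
    module
  refine ⟨fun i => ?_, fun i => ?_, ?_⟩
  -- The identities `key` for j = 0, 1 are two linear equations for ∂ᵢσ_z and ∂ᵢσ_w, solved here by
  -- Cramer's rule.
  · have : jac z w y • pd i (delZ z w σ) y = pd 1 w y • (pd 0 z y • pd i (delZ z w σ) y +
        pd 0 w y • pd i (delW z w σ) y) - pd 0 w y • (pd 1 z y • pd i (delZ z w σ) y +
        pd 1 w y • pd i (delW z w σ) y) := by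
      rw [hJ']
      module
    rw [key, key, H.form_apply hy, H.form_apply hy] at this
    rw [← sub_eq_zero] at this
    refine smul_right_injective _ hJ ?_
    rw [← sub_eq_zero]
    rw [← this]
    simp only [hJ']
    module
  · have : jac z w y • pd i (delW z w σ) y = pd 0 z y • (pd 1 z y • pd i (delZ z w σ) y +
        pd 1 w y • pd i (delW z w σ) y) - pd 1 z y • (pd 0 z y • pd i (delZ z w σ) y +
        pd 0 w y • pd i (delW z w σ) y) := by
      rw [hJ']
      module
    rw [key, key, H.form_apply hy, H.form_apply hy] at this
    rw [← sub_eq_zero] at this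
    refine smul_right_injective _ hJ ?_
    rw [← sub_eq_zero]
    rw [← this]
    simp only [hJ']
    module
  · have h1 := ((H.form y hy).isVolumeCoeff_iff hl (H.side_z y hy) (H.side_w y hy)).1 h.volume
    rw [inducedVolume_eq_jac_mul hJ] at h1
    refine mul_left_cancel₀ hJ ?_
    rw [h1, hJ']
    ring

/-- The equations are assumed on an open set because parallelism differentiates the volume (i/2) l
(z₀w₁ − z₁w₀), which comes from the determinant equation. The shape operator is −id because the
affine normal is σ itself. -/
theorem sphereAt_of_structureEqs (hσ : ContDiffOn ℝ ∞ σ U)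
    (h : ∀ y ∈ U, StructureEqs z w l p q σ y) (hy : y ∈ U) : SphereAt G C σ y := by
  have hJ := H.jac_ne y hy
  have hl := H.l_ne y hy
  have hJ' : jac z w y = pd 0 z y * pd 1 w y - pd 1 z y * pd 0 w y := rfl
  have hvolU : ∀ y ∈ U, inducedVolume σ σ y = Complex.I / 2 * (jac z w y * l y) := by
    intro y hy
    rw [inducedVolume_eq_jac_mul (H.jac_ne y hy), (h y hy).det]
    ring
  have hvol : inducedVolume σ σ y ≠ 0 := by
    rw [hvolU y hy]
    simp [hJ, hl]
  -- These are the Christoffel symbols of `christoffel_eq` corrected by −q/l and −p/l in the two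
  -- null directions.
  set Γ : Fin 2 → Fin 2 → Fin 2 → ℂ := fun k i j => (jac z w y)⁻¹ * (![pd 1 w y, -pd 0 w y] k *
      (pd i (pd j z) y + delZ z w l y / l y * pd i z y * pd j z y - q y / l y * pd i w y * pd j w y)
      + ![-pd 1 z y, pd 0 z y] k * (pd i (pd j w) y + delW z w l y / l y * pd i w y * pd j w y -
      p y / l y * pd i z y * pd j z y)) with hΓ
  have hcomp : ∀ i j, component σ σ y (pd i (pd j σ) y) = ![Γ 0 i j, Γ 1 i j, G y i j] := by
    intro i j
    rw [component_eq_iff hvol, H.pd_pd_sphere hσ hy, (h y hy).pd_delZ, (h y hy).pd_delW,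
      H.form_apply hy]
    have eZ : delZ z w σ y = (jac z w y)⁻¹ • (pd 1 w y • pd 0 σ y - pd 0 w y • pd 1 σ y) := rfl
    have eW : delW z w σ y = (jac z w y)⁻¹ • (pd 0 z y • pd 1 σ y - pd 1 z y • pd 0 σ y) := rfl
    rw [eZ, eW]
    simp only [hΓ, Matrix.cons_val_zero, Matrix.cons_val_one, Matrix.cons_val]
    module
  have hind : ∀ k i j, inducedConnection σ σ k i j y = Γ k i j := by
    intro k i j
    rw [inducedConnection, hcomp]
    fin_cases k <;> rfl
  refine ⟨?_, fun i j => ?_, fun i => ?_, ?_, fun k i => ?_, fun i j k => ?_⟩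
  · rw [linearIndependent_iff_det3_ne_zero, ← inducedVolume_eq]
    exact hvol
  · rw [fundamentalForm, hcomp]
    rfl
  · have dz := fun j => H.differentiableAt (H.smooth_pd j H.smooth_z) hy
    have dw := fun j => H.differentiableAt (H.smooth_pd j H.smooth_w) hy
    have dl := H.differentiableAt H.smooth_l hy
    have dJ := H.differentiableAt H.smooth_jac hy
    have hn := H.isOpen.mem_nhds hy
    have hpJ : pd i (jac z w) y = pd i (pd 0 z) y * pd 1 w y + pd 0 z y * pd i (pd 1 w) y -
        (pd i (pd 1 z) y * pd 0 w y + pd 1 z y * pd i (pd 0 w) y) := by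
      have : pd i (jac z w) y = pd i (fun y => pd 0 z y * pd 1 w y - pd 1 z y * pd 0 w y) y := rfl
      rw [this, pd_sub i ((dz 0).fun_mul (dw 1)) ((dz 1).fun_mul (dw 0)), pd_mul i (dz 0) (dw 1),
        pd_mul i (dz 1) (dw 0)]
    rw [pd_congr_on i H.isOpen hvolU hy, pd_const_mul i _ (dJ.fun_mul dl), pd_mul i dJ dl,
      hvolU y hy, hpJ, H.pd_l hy]
    simp only [hind, hΓ, Fin.sum_univ_two, Matrix.cons_val_zero, Matrix.cons_val_one]
    generalize jac z w y = J at *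
    field_simp
    rw [hJ']
    ring
  · rw [(H.form y hy).isVolumeCoeff_iff hl (H.side_z y hy) (H.side_w y hy), hvolU y hy, hJ']
    ring
  · have hc : component σ σ y (pd i σ y) = ![if 0 = i then 1 else 0, if 1 = i then 1 else 0, 0] := by
      rw [component_eq_iff hvol]
      fin_cases i <;> simp
    rw [shapeOperator, hc]
    fin_cases k <;> fin_cases i <;> simp
  · rw [H.cubic y hy]
    simp only [hind, H.christoffel_eq hy, hΓ, H.form_apply hy, Fin.sum_univ_two,
      Fin.prod_univ_three, Matrix.cons_val_zero, Matrix.cons_val_one, Matrix.cons_val]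
    generalize jac z w y = J at *
    field_simp
    rw [hJ']
    ring

end PickData

end Sphere

end CAS
end

noncomputable section

namespace CAS

/-! ### The Gauss equation as integrability condition; local existence -/

section Integrability

variable {U : Set Plane} {z w l p q : Plane → ℂ} {G : Plane → Matrix (Fin 2) (Fin 2) ℂ}
  {C : Plane → (Fin 3 → Fin 2) → ℂ} {σ : Plane → C3} {y y₀ : Plane}

namespace PickData

variable (H : PickData U z w l p q G C)
include H

theorem smooth_p_div : ContDiffOn ℝ ∞ (fun y => p y / l y) U :=
  contDiffOn_div H.smooth_p H.smooth_l H.l_ne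

theorem smooth_q_div : ContDiffOn ℝ ∞ (fun y => q y / l y) U :=
  contDiffOn_div H.smooth_q H.smooth_l H.l_ne

theorem pd_div (hy : y ∈ U) (i : Fin 2) {f : Plane → ℂ} (hf : DifferentiableAt ℝ f y) :
    pd i (fun y => f y / l y) y = (pd i f y - f y * (delZ z w l y / l y * pd i z y +
      delW z w l y / l y * pd i w y)) / l y := by
  have hl := H.l_ne y hy
  have dl := H.differentiableAt H.smooth_l hy
  simp only [div_eq_mul_inv (f _)]
  rw [pd_mul i hf (dl.fun_inv hl), pd_inv i dl hl, H.pd_l hy]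
  field_simp
  ring

/-- Since p_w = 0, the w-derivative of p/l is −(p/l)(log l)_w. This is the Codazzi equation, and it
cancels the σ_w terms in the integrability condition. -/
theorem pd_p_div (hy : y ∈ U) (i : Fin 2) : pd i (fun y => p y / l y) y =
    pd i z y * delZ z w (fun y => p y / l y) y -
      pd i w y * (p y / l y * (delW z w l y / l y)) := by
  have hJ := H.jac_ne y hy
  have hp : ∀ i, pd i p y = pd i z y * delZ z w p y := fun i => by
    have := pd_eq_delZ_add_delW (f := p) i hJ
    simpa [H.delW_p y hy] using this
  have h1 : ∀ i, pd i (fun y => p y / l y) y = pd i z y •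
      ((delZ z w p y - p y * (delZ z w l y / l y)) / l y) +
      pd i w y • (-(p y / l y * (delW z w l y / l y))) := fun i => by
    rw [H.pd_div hy i (H.differentiableAt H.smooth_p hy), hp]
    simp only [smul_eq_mul]
    ring
  rw [delZ_eq hJ h1, h1]
  simp only [smul_eq_mul]
  ring

theorem pd_q_div (hy : y ∈ U) (i : Fin 2) : pd i (fun y => q y / l y) y =
    pd i w y * delW z w (fun y => q y / l y) y -
      pd i z y * (q y / l y * (delZ z w l y / l y)) := by
  have hJ := H.jac_ne y hy
  have hq : ∀ i, pd i q y = pd i w y * delW z w q y := fun i => by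
    have := pd_eq_delZ_add_delW (f := q) i hJ
    simpa [H.delZ_q y hy] using this
  have h1 : ∀ i, pd i (fun y => q y / l y) y = pd i z y • (-(q y / l y * (delZ z w l y / l y))) +
      pd i w y • ((delW z w q y - q y * (delW z w l y / l y)) / l y) := fun i => by
    rw [H.pd_div hy i (H.differentiableAt H.smooth_q hy), hq]
    simp only [smul_eq_mul]
    ring
  rw [delW_eq hJ h1, h1]
  simp only [smul_eq_mul]
  ring

/-- The Gauss equation is the integrability condition of the structure equations. -/
theorem integrability_of_structureEqs (hσ : ContDiffOn ℝ ∞ σ U)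
    (h : ∀ y ∈ U, StructureEqs z w l p q σ y) (hy : y ∈ U) :
    delW z w (fun y => delZ z w l y / l y) y + p y / l y * (q y / l y) = l y / 2 := by
  have hJ := H.jac_ne y hy
  have hl := H.l_ne y hy
  have sα := H.smooth_delZ hσ
  have sβ := H.smooth_delW hσ
  have dα := H.differentiableAt sα hy
  have dβ := H.differentiableAt sβ hy
  have dσ := H.differentiableAt hσ hy
  have dl : DifferentiableAt ℝ (fun y => l y / 2) y := by
    simp only [div_eq_mul_inv]
    exact (H.differentiableAt H.smooth_l hy).mul_const _
  have da := H.differentiableAt H.smooth_a hy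
  have dp := H.differentiableAt H.smooth_p_div hy
  have hZ : ∀ y ∈ U, delZ z w (delZ z w σ) y =
      (delZ z w l y / l y) • delZ z w σ y - (p y / l y) • delW z w σ y := fun y hy =>
    delZ_eq (H.jac_ne y hy) (h y hy).pd_delZ
  have hW : ∀ y ∈ U, delW z w (delZ z w σ) y = (l y / 2) • σ y := fun y hy =>
    delW_eq (H.jac_ne y hy) (h y hy).pd_delZ
  have e1 : delW z w (delZ z w (delZ z w σ)) y =
      (delW z w (fun y => delZ z w l y / l y) y + p y / l y * (q y / l y)) • delZ z w σ y +
      (delZ z w l y / l y * (l y / 2)) • σ y := by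
    refine delW_eq hJ (a := delZ z w (fun y => delZ z w l y / l y) y • delZ z w σ y +
      (delZ z w l y / l y) • ((delZ z w l y / l y) • delZ z w σ y - (p y / l y) • delW z w σ y) -
      (delZ z w (fun y => p y / l y) y • delW z w σ y + (p y / l y) • ((l y / 2) • σ y)))
      fun i => ?_
    rw [pd_congr_on i H.isOpen hZ hy, pd_sub i (da.fun_smul dα) (dp.fun_smul dβ),
      pd_smul i da dα, pd_smul i dp dβ, (h y hy).pd_delZ, (h y hy).pd_delW,
      pd_eq_delZ_add_delW (f := fun y => delZ z w l y / l y) i hJ, H.pd_p_div hy]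
    simp only [smul_eq_mul]
    module
  have e2 : delZ z w (delW z w (delZ z w σ)) y =
      (delZ z w l y / l y * (l y / 2)) • σ y + (l y / 2) • delZ z w σ y := by
    refine delZ_eq hJ (b := (delW z w l y / l y * (l y / 2)) • σ y + (l y / 2) • delW z w σ y)
      fun i => ?_
    have hl2 : pd i (fun y => l y / 2) y = pd i l y / 2 := by
      simp only [div_eq_inv_mul _ (2 : ℂ)]
      exact pd_const_mul i _ (H.differentiableAt H.smooth_l hy)
    rw [pd_congr_on i H.isOpen hW hy, pd_smul i dl dσ, hl2, H.pd_l hy,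
      pd_eq_delZ_add_delW (f := σ) i hJ]
    module
  -- The two expressions for the derivative of σ_zz in w differ by a multiple of σ_z alone, and σ_z
  -- ≠ 0 by the determinant condition.
  rw [H.delW_delZ sα hy, e2] at e1
  have hne := (h y hy).delZ_ne_zero hl
  have : (delW z w (fun y => delZ z w l y / l y) y + p y / l y * (q y / l y) - l y / 2) •
      delZ z w σ y = 0 := by
    rw [← sub_eq_zero] at e1
    rw [← neg_eq_zero, ← e1]
    module
  exact sub_eq_zero.1 ((smul_eq_zero.1 this).resolve_right hne)

theorem sum_pairing_eq (hy : y ∈ U) {C₁ C₂ : (Fin 3 → Fin 2) → ℂ}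
    (h₁ : ∀ i, C₁ i = p y * ∏ a, pd (i a) z y) (h₂ : ∀ i, C₂ i = q y * ∏ a, pd (i a) w y) :
    ∑ i : Fin 3 → Fin 2, ∑ j : Fin 3 → Fin 2, (∏ a, (G y)⁻¹ (i a) (j a)) * C₁ i * C₂ j =
      8 * p y * q y / l y ^ 3 := by
  simp only [h₁, h₂]
  exact (H.form y hy).sum_pairing (H.l_ne y hy) (H.jac_ne y hy) (p y) (q y)

theorem curvature_eq_iff (hy : y ∈ U) :
    curvature G y = -1 + (1 / 4) * (8 * p y * q y / l y ^ 3) ↔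
      delW z w (fun y => delZ z w l y / l y) y + p y / l y * (q y / l y) = l y / 2 := by
  have hl := H.l_ne y hy
  rw [H.curvature_eq hy]
  constructor
  · intro h
    field_simp at h ⊢
    linear_combination (-1 / 4) * h
  · intro h
    field_simp at h ⊢
    linear_combination (-4) * h

end PickData

/-- The coefficients of the structure equations as a linear system for `(∂σ/∂z, ∂σ/∂w, σ)`. -/
def structureCoeff (z w l p q : Plane → ℂ) (i : Fin 2) (b c : Fin 3) (y : Plane) : ℂ :=
  ![![pd i z y * (delZ z w l y / l y), -(pd i z y * (p y / l y)), pd i w y * (l y / 2)],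
    ![-(pd i w y * (q y / l y)), pd i w y * (delW z w l y / l y), pd i z y * (l y / 2)],
    ![pd i z y, pd i w y, 0]] b c

theorem StructureEqs.pd_frame (h : StructureEqs z w l p q σ y) (hJ : jac z w y ≠ 0)
    (i : Fin 2) (b : Fin 3) : ![pd i (delZ z w σ) y, pd i (delW z w σ) y, pd i σ y] b =
      ∑ c, structureCoeff z w l p q i b c y • ![delZ z w σ y, delW z w σ y, σ y] c := by
  rw [h.pd_delZ, h.pd_delW, pd_eq_delZ_add_delW (f := σ) i hJ]
  fin_cases b <;> simp [structureCoeff, Fin.sum_univ_three] <;> module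

namespace PickData

variable (H : PickData U z w l p q G C)
include H

theorem smooth_structureCoeff (i : Fin 2) (b c : Fin 3) :
    ContDiffOn ℝ ∞ (structureCoeff z w l p q i b c) U := by
  have hz := H.smooth_pd i H.smooth_z
  have hw := H.smooth_pd i H.smooth_w
  have hl : ContDiffOn ℝ ∞ (fun y => l y / 2) U := H.smooth_l.div_const (2 : ℂ)
  fin_cases b <;> fin_cases c
  exacts [hz.mul H.smooth_a, (hz.mul H.smooth_p_div).neg, hw.mul hl, (hw.mul H.smooth_q_div).neg,
    hw.mul H.smooth_b, hz.mul hl, hz, hw, contDiffOn_const]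

/-- The Gauss equation enters only in the entries (0, 0) and (1, 1), the latter through closedness
of d log l. The others hold by the Codazzi equations for p/l and q/l and by symmetry of second
derivatives. -/
theorem structureCoeff_flat (hy : y ∈ U)
    (hG : delW z w (fun y => delZ z w l y / l y) y + p y / l y * (q y / l y) = l y / 2)
    (b c : Fin 3) : pd 0 (structureCoeff z w l p q 1 b c) y +
      ∑ d, structureCoeff z w l p q 1 b d y * structureCoeff z w l p q 0 d c y =
      pd 1 (structureCoeff z w l p q 0 b c) y +
      ∑ d, structureCoeff z w l p q 0 b d y * structureCoeff z w l p q 1 d c y := by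
  have hJ := H.jac_ne y hy
  have hl := H.l_ne y hy
  have hn := H.isOpen.mem_nhds hy
  have dz := fun j => H.differentiableAt (H.smooth_pd j H.smooth_z) hy
  have dw := fun j => H.differentiableAt (H.smooth_pd j H.smooth_w) hy
  have dl : DifferentiableAt ℝ (fun y => l y / 2) y := by
    simp only [div_eq_mul_inv]
    exact (H.differentiableAt H.smooth_l hy).mul_const _
  have da := H.differentiableAt H.smooth_a hy
  have db := H.differentiableAt H.smooth_b hy
  have dp := H.differentiableAt H.smooth_p_div hy
  have dq := H.differentiableAt H.smooth_q_div hy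
  have hl2 : ∀ i, pd i (fun y => l y / 2) y = l y / 2 * (delZ z w l y / l y * pd i z y +
      delW z w l y / l y * pd i w y) := fun i => by
    have : pd i (fun y => l y / 2) y = pd i l y / 2 := by
      simp only [div_eq_inv_mul _ (2 : ℂ)]
      exact pd_const_mul i _ (H.differentiableAt H.smooth_l hy)
    rw [this, H.pd_l hy]
    ring
  have ha : ∀ i, pd i (fun y => delZ z w l y / l y) y = _ := fun i => pd_eq_delZ_add_delW i hJ
  have hb : ∀ i, pd i (fun y => delW z w l y / l y) y = _ := fun i => pd_eq_delZ_add_delW i hJ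
  have cz : pd 0 (pd 1 z) y = pd 1 (pd 0 z) y := pd_comm 0 1 (H.smooth_z.contDiffAt hn)
  have cw : pd 0 (pd 1 w) y = pd 1 (pd 0 w) y := pd_comm 0 1 (H.smooth_w.contDiffAt hn)
  have hm := H.delW_a hy
  have hpd : ∀ i j b c, pd i (structureCoeff z w l p q j b c) y =
      ![![pd i (pd j z) y * (delZ z w l y / l y) + pd j z y * pd i (fun y => delZ z w l y / l y) y,
          -(pd i (pd j z) y * (p y / l y) + pd j z y * pd i (fun y => p y / l y) y),
          pd i (pd j w) y * (l y / 2) + pd j w y * pd i (fun y => l y / 2) y],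
        ![-(pd i (pd j w) y * (q y / l y) + pd j w y * pd i (fun y => q y / l y) y),
          pd i (pd j w) y * (delW z w l y / l y) + pd j w y * pd i (fun y => delW z w l y / l y) y,
          pd i (pd j z) y * (l y / 2) + pd j z y * pd i (fun y => l y / 2) y],
        ![pd i (pd j z) y, pd i (pd j w) y, 0]] b c := by
    intro i j b c
    have hneg : ∀ f : Plane → ℂ, pd i (fun y => -f y) y = -pd i f y := fun f => by
      simp [pd]
    fin_cases b <;> fin_cases c
    · exact pd_mul i (dz j) da
    · exact (hneg _).trans (congrArg _ (pd_mul i (dz j) dp))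
    · exact pd_mul i (dw j) dl
    · exact (hneg _).trans (congrArg _ (pd_mul i (dw j) dq))
    · exact pd_mul i (dw j) db
    · exact pd_mul i (dz j) dl
    · rfl
    · rfl
    · exact pd_const i 0
  rw [hpd, hpd, ha, ha, hb, hb, H.pd_p_div hy, H.pd_p_div hy, H.pd_q_div hy, H.pd_q_div hy, hl2, hl2,
    cz, cw, ← hm]
  simp only [structureCoeff, Fin.sum_univ_three, smul_eq_mul]
  set m := delW z w (fun y => delZ z w l y / l y) y
  have hm' : m = l y / 2 - p y / l y * (q y / l y) := by rw [← hG]; ring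
  rw [hm']
  generalize p y / l y = P
  generalize q y / l y = Q
  generalize delZ z w l y / l y = a
  generalize delW z w l y / l y = b'
  fin_cases b <;> fin_cases c <;> simp <;> ring

/-- Local existence of affine spheres. -/
theorem exists_structureEqs (hG : ∀ y ∈ U,
    delW z w (fun y => delZ z w l y / l y) y + p y / l y * (q y / l y) = l y / 2) (hy₀ : y₀ ∈ U) :
    ∃ V ⊆ U, IsOpen V ∧ y₀ ∈ V ∧ ∃ σ : Plane → C3, ContDiffOn ℝ ∞ σ V ∧
      ∀ y ∈ V, StructureEqs z w l p q σ y := by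
  -- The initial frame is chosen with determinant i l(y₀)/2, the value demanded by the volume
  -- normalization.
  obtain ⟨r, hr, hrU, F, hF0, hF⟩ := exists_frame H.isOpen H.smooth_structureCoeff
    (fun y hy => H.structureCoeff_flat hy (hG y hy)) hy₀
    ![![1, 0, 0], ![0, 1, 0], ![0, 0, Complex.I * l y₀ / 2]]
  have hB : IsOpen (Metric.ball y₀ r) := Metric.isOpen_ball
  have hFs : ContDiffOn ℝ ∞ F (Metric.ball y₀ r) :=
    contDiffOn_frame hB (fun i b c => (H.smooth_structureCoeff i b c).mono hrU) hF
  have hFb : ∀ b, ContDiffOn ℝ ∞ (fun y => F y b) (Metric.ball y₀ r) := contDiffOn_pi.1 hFs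
  have hpd : ∀ y ∈ Metric.ball y₀ r, ∀ i b, pd i (fun y => F y b) y =
      ∑ c, structureCoeff z w l p q i b c y • F y c := fun y hy i b => by
    rw [← (hF y hy).2]
    exact pd_apply i (ContinuousLinearMap.proj (R := ℝ) (φ := fun _ : Fin 3 => C3) b) (hF y hy).1
  have h0 : ∀ y ∈ Metric.ball y₀ r, ∀ i, pd i (fun y => F y 0) y =
      pd i z y • ((delZ z w l y / l y) • F y 0 - (p y / l y) • F y 1) +
        pd i w y • ((l y / 2) • F y 2) := fun y hy i => by
    rw [hpd y hy]
    simp [structureCoeff, Fin.sum_univ_three]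
    module
  have h1 : ∀ y ∈ Metric.ball y₀ r, ∀ i, pd i (fun y => F y 1) y =
      pd i z y • ((l y / 2) • F y 2) +
        pd i w y • ((delW z w l y / l y) • F y 1 - (q y / l y) • F y 0) := fun y hy i => by
    rw [hpd y hy]
    simp [structureCoeff, Fin.sum_univ_three]
    module
  have h2 : ∀ y ∈ Metric.ball y₀ r, ∀ i, pd i (fun y => F y 2) y =
      pd i z y • F y 0 + pd i w y • F y 1 := fun y hy i => by
    rw [hpd y hy]
    simp [structureCoeff, Fin.sum_univ_three]
  -- The last row of the system, dF₂ = F₀ dz + F₁ dw, identifies F₀ and F₁ as the derivatives of σ =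
  -- F₂.
  have hZ : EqOn (delZ z w fun y => F y 2) (fun y => F y 0) (Metric.ball y₀ r) := fun y hy =>
    delZ_eq (H.jac_ne y (hrU hy)) (h2 y hy)
  have hW : EqOn (delW z w fun y => F y 2) (fun y => F y 1) (Metric.ball y₀ r) := fun y hy =>
    delW_eq (H.jac_ne y (hrU hy)) (h2 y hy)
  -- The coefficient matrix has trace d log l, so det F / l is constant and keeps its initial value.
  have hdet : ∀ y ∈ Metric.ball y₀ r,
      det3 (F y 0) (F y 1) (F y 2) / l y = Complex.I / 2 := by
    have hd : ∀ y ∈ Metric.ball y₀ r, ∀ b, DifferentiableAt ℝ (fun y => F y b) y := fun y hy b =>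
      differentiableAt_of_contDiffOn hB (hFb b) hy
    have hD : ∀ y ∈ Metric.ball y₀ r,
        DifferentiableAt ℝ (fun y => det3 (F y 0) (F y 1) (F y 2)) y := by
      intro y hy
      have h := fun b => differentiableAt_pi.1 (hd y hy b)
      simp only [det3_eq]
      fun_prop
    have hDl : ∀ y ∈ Metric.ball y₀ r,
        DifferentiableAt ℝ (fun y => det3 (F y 0) (F y 1) (F y 2) / l y) y := fun y hy => by
      simp only [div_eq_mul_inv]
      exact (hD y hy).fun_mul
        ((H.differentiableAt H.smooth_l (hrU hy)).fun_inv (H.l_ne y (hrU hy)))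
    have hconst := fun y hy => hB.is_const_of_fderiv_eq_zero (𝕜 := ℝ)
      (convex_ball y₀ r).isPreconnected (fun y hy => (hDl y hy).differentiableWithinAt)
      (fun y hy => by
        ext v
        rw [fderiv_eq_sum_pd]
        refine Finset.sum_eq_zero fun i _ => ?_
        rw [H.pd_div (hrU hy) i (hD y hy), pd_det3 i (hd y hy 0) (hd y hy 1) (hd y hy 2), h0 y hy,
          h1 y hy, h2 y hy]
        simp only [det3_eq, Pi.add_apply, Pi.sub_apply, Pi.smul_apply, smul_eq_mul]
        have : ∀ x : ℂ, x = 0 → v i • (x / l y) = 0 := fun x hx => by simp [hx]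
        apply this
        ring) (Metric.mem_ball_self hr) (y := y) hy
    intro y hy
    rw [← hconst y hy, hF0, det3_eq]
    have := H.l_ne y₀ hy₀
    simp
    field_simp
  refine ⟨Metric.ball y₀ r, hrU, hB, Metric.mem_ball_self hr, fun y => F y 2, hFb 2,
    fun y hy => ⟨fun i => ?_, fun i => ?_, ?_⟩⟩
  · rw [pd_congr_on i hB hZ hy, h0 y hy, hZ hy, hW hy]
  · rw [pd_congr_on i hB hW hy, h1 y hy, hZ hy, hW hy]
  · rw [hZ hy, hW hy, (div_eq_iff (H.l_ne y (hrU hy))).1 (hdet y hy)]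
    ring

end PickData

end Integrability

end CAS
end

noncomputable section

namespace CAS

/-! ### Locality and invariance under change of coordinates -/

section Invariance

variable {U V : Set Plane} {z w l p q z' w' l' p' q' : Plane → ℂ}
  {G G' : Plane → Matrix (Fin 2) (Fin 2) ℂ} {C C' : Plane → (Fin 3 → Fin 2) → ℂ}
  {σ σ' : Plane → C3} {y y₀ : Plane}

theorem PickData.mono (H : PickData U z w l p q G C) (hV : IsOpen V) (hVU : V ⊆ U) :
    PickData V z w l p q G C where
  isOpen := hV
  smooth_z := H.smooth_z.mono hVU
  smooth_w := H.smooth_w.mono hVU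
  jac_ne y hy := H.jac_ne y (hVU hy)
  smooth_l := H.smooth_l.mono hVU
  l_ne y hy := H.l_ne y (hVU hy)
  form y hy := H.form y (hVU hy)
  side_z y hy := H.side_z y (hVU hy)
  side_w y hy := H.side_w y (hVU hy)
  smooth_p := H.smooth_p.mono hVU
  smooth_q := H.smooth_q.mono hVU
  delW_p y hy := H.delW_p y (hVU hy)
  delZ_q y hy := H.delZ_q y (hVU hy)
  cubic y hy := H.cubic y (hVU hy)

section Congr

variable {E : Type*} [NormedAddCommGroup E] [NormedSpace ℝ E] {f g : Plane → E}

theorem pd_eventuallyEq (i : Fin 2) (h : f =ᶠ[𝓝 y] g) : pd i f =ᶠ[𝓝 y] pd i g :=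
  h.eventuallyEq_nhds.mono fun _ hx => pd_congr i hx

variable [NormedSpace ℂ E]

theorem delZ_congr (hz : z =ᶠ[𝓝 y] z') (hw : w =ᶠ[𝓝 y] w') (h : f =ᶠ[𝓝 y] g) :
    delZ z w f y = delZ z' w' g y := by
  simp only [delZ, jac, pd_congr _ hz, pd_congr _ hw, pd_congr _ h]

theorem delW_congr (hz : z =ᶠ[𝓝 y] z') (hw : w =ᶠ[𝓝 y] w') (h : f =ᶠ[𝓝 y] g) :
    delW z w f y = delW z' w' g y := by
  simp only [delW, jac, pd_congr _ hz, pd_congr _ hw, pd_congr _ h]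

theorem delZ_eventuallyEq (hz : z =ᶠ[𝓝 y] z') (hw : w =ᶠ[𝓝 y] w') (h : f =ᶠ[𝓝 y] g) :
    delZ z w f =ᶠ[𝓝 y] delZ z' w' g := by
  filter_upwards [hz.eventuallyEq_nhds, hw.eventuallyEq_nhds, h.eventuallyEq_nhds] with x h1 h2 h3
  exact delZ_congr h1 h2 h3

theorem delW_eventuallyEq (hz : z =ᶠ[𝓝 y] z') (hw : w =ᶠ[𝓝 y] w') (h : f =ᶠ[𝓝 y] g) :
    delW z w f =ᶠ[𝓝 y] delW z' w' g := by
  filter_upwards [hz.eventuallyEq_nhds, hw.eventuallyEq_nhds, h.eventuallyEq_nhds] with x h1 h2 h3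
  exact delW_congr h1 h2 h3

/-- The coefficients of df in dz and dw pull back along τ unchanged. This is what makes the
structure equations coordinate independent. -/
theorem pd_comp_eq {τ : Plane → Plane} (i : Fin 2) (hJ : jac z w (τ y) ≠ 0)
    (hz : DifferentiableAt ℝ z (τ y)) (hw : DifferentiableAt ℝ w (τ y))
    (hf : DifferentiableAt ℝ f (τ y)) (hτ : DifferentiableAt ℝ τ y) [IsScalarTower ℝ ℂ E] :
    pd i (f ∘ τ) y = pd i (z ∘ τ) y • delZ z w f (τ y) + pd i (w ∘ τ) y • delW z w f (τ y) := by
  have h1 := pd_comp i hf hτ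
  have h2 := pd_comp i hz hτ
  have h3 := pd_comp i hw hτ
  simp only [Fin.sum_univ_two] at h1 h2 h3
  change pd i (fun x => f (τ x)) y = pd i (fun x => z (τ x)) y • _ + pd i (fun x => w (τ x)) y • _
  rw [h1, h2, h3, pd_eq_delZ_add_delW (f := f) 0 hJ, pd_eq_delZ_add_delW (f := f) 1 hJ]
  simp only [smul_add, add_smul, smul_assoc]
  abel

end Congr

theorem StructureEqs.congr (h : StructureEqs z w l p q σ y) (hz : z =ᶠ[𝓝 y] z')
    (hw : w =ᶠ[𝓝 y] w') (hl : l =ᶠ[𝓝 y] l') (hp : p y = p' y) (hq : q y = q' y)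
    (hσ : σ =ᶠ[𝓝 y] σ') : StructureEqs z' w' l' p' q' σ' y where
  pd_delZ i := by
    rw [← pd_congr i (delZ_eventuallyEq hz hw hσ), h.pd_delZ, pd_congr i hz, pd_congr i hw,
      delZ_congr hz hw hl, delZ_congr hz hw hσ, delW_congr hz hw hσ, hl.eq_of_nhds, hp,
      hσ.eq_of_nhds]
  pd_delW i := by
    rw [← pd_congr i (delW_eventuallyEq hz hw hσ), h.pd_delW, pd_congr i hz, pd_congr i hw,
      delW_congr hz hw hl, delZ_congr hz hw hσ, delW_congr hz hw hσ, hl.eq_of_nhds, hq,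
      hσ.eq_of_nhds]
  det := by
    rw [← delZ_congr hz hw hσ, ← delW_congr hz hw hσ, ← hσ.eq_of_nhds, ← hl.eq_of_nhds, h.det]

/-- The structure equations are invariant under changes of coordinates. -/
theorem StructureEqs.comp (H : NullMetric U z w l G) (hσ : ContDiffOn ℝ ∞ σ U)
    (h : ∀ y ∈ U, StructureEqs z w l p q σ y) {τ : Plane → Plane} (hV : IsOpen V)
    (hτ : ContDiffOn ℝ ∞ τ V) (hm : MapsTo τ V U) (hJ : ∀ y ∈ V, jac (z ∘ τ) (w ∘ τ) y ≠ 0)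
    (hy : y ∈ V) : StructureEqs (z ∘ τ) (w ∘ τ) (l ∘ τ) (p ∘ τ) (q ∘ τ) (σ ∘ τ) y := by
  have dτ := fun y hy => differentiableAt_of_contDiffOn hV hτ (y := y) hy
  have key := fun {E : Type} [NormedAddCommGroup E] [NormedSpace ℝ E] [NormedSpace ℂ E]
    [IsScalarTower ℝ ℂ E] {f : Plane → E} (hf : ContDiffOn ℝ ∞ f U) (y : Plane) (hy : y ∈ V)
    (i : Fin 2) => pd_comp_eq i (H.jac_ne _ (hm hy)) (H.differentiableAt H.smooth_z (hm hy))
      (H.differentiableAt H.smooth_w (hm hy)) (H.differentiableAt hf (hm hy)) (dτ y hy)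
  have eZ : EqOn (delZ (z ∘ τ) (w ∘ τ) (σ ∘ τ)) (delZ z w σ ∘ τ) V := fun y hy =>
    delZ_eq (hJ y hy) (key hσ y hy)
  have eW : EqOn (delW (z ∘ τ) (w ∘ τ) (σ ∘ τ)) (delW z w σ ∘ τ) V := fun y hy =>
    delW_eq (hJ y hy) (key hσ y hy)
  have elZ : delZ (z ∘ τ) (w ∘ τ) (l ∘ τ) y = delZ z w l (τ y) :=
    delZ_eq (hJ y hy) (key H.smooth_l y hy)
  have elW : delW (z ∘ τ) (w ∘ τ) (l ∘ τ) y = delW z w l (τ y) :=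
    delW_eq (hJ y hy) (key H.smooth_l y hy)
  have hs := h _ (hm hy)
  have hJτ := H.jac_ne _ (hm hy)
  refine ⟨fun i => ?_, fun i => ?_, ?_⟩
  · rw [pd_congr_on i hV eZ hy, key (H.smooth_delZ hσ) y hy, delZ_eq hJτ hs.pd_delZ,
      delW_eq hJτ hs.pd_delZ, eZ hy, eW hy, elZ]
    rfl
  · rw [pd_congr_on i hV eW hy, key (H.smooth_delW hσ) y hy, delZ_eq hJτ hs.pd_delW,
      delW_eq hJτ hs.pd_delW, eZ hy, eW hy, elW]
    rfl
  · rw [eZ hy, eW hy]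
    exact hs.det

end Invariance

/-! ### Action of SL(3, ℂ) and local uniqueness -/

section LinearAction

variable {U : Set Plane} {z w l p q : Plane → ℂ} {G : Plane → Matrix (Fin 2) (Fin 2) ℂ}
  {C : Plane → (Fin 3 → Fin 2) → ℂ} {σ σ' : Plane → C3} {y y₀ : Plane}

/-- The action of a complex matrix on `ℂ³`, as a real linear map. -/
def mulVecReal (A : Matrix (Fin 3) (Fin 3) ℂ) : C3 →L[ℝ] C3 :=
  (LinearMap.toContinuousLinearMap A.mulVecLin).restrictScalars ℝ

theorem mulVecReal_apply (A : Matrix (Fin 3) (Fin 3) ℂ) (v : C3) : mulVecReal A v = A.mulVec v :=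
  rfl

theorem pd_mulVec (A : Matrix (Fin 3) (Fin 3) ℂ) (i : Fin 2) {f : Plane → C3}
    (hf : DifferentiableAt ℝ f y) : pd i (fun y => A.mulVec (f y)) y = A.mulVec (pd i f y) :=
  pd_apply i (mulVecReal A) hf

theorem contDiffAt_mulVec (A : Matrix (Fin 3) (Fin 3) ℂ) {f : Plane → C3}
    (hf : ContDiffAt ℝ ∞ f y) : ContDiffAt ℝ ∞ (fun y => A.mulVec (f y)) y :=
  (mulVecReal A).contDiff.contDiffAt.comp y hf

theorem delZ_mulVec (A : Matrix (Fin 3) (Fin 3) ℂ) {f : Plane → C3}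
    (hf : DifferentiableAt ℝ f y) :
    delZ z w (fun y => A.mulVec (f y)) y = A.mulVec (delZ z w f y) := by
  simp only [delZ, pd_mulVec A _ hf, Matrix.mulVec_smul, Matrix.mulVec_sub]

theorem delW_mulVec (A : Matrix (Fin 3) (Fin 3) ℂ) {f : Plane → C3}
    (hf : DifferentiableAt ℝ f y) :
    delW z w (fun y => A.mulVec (f y)) y = A.mulVec (delW z w f y) := by
  simp only [delW, pd_mulVec A _ hf, Matrix.mulVec_smul, Matrix.mulVec_sub]

theorem eventually_differentiableAt {f : Plane → C3} (hf : ContDiffAt ℝ ∞ f y) :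
    ∀ᶠ x in 𝓝 y, DifferentiableAt ℝ f x := by
  have h1 : ContDiffAt ℝ 1 f y := hf.of_le (WithTop.coe_le_coe.2 le_top)
  filter_upwards [h1.eventually (by simp)] with x hx
  exact hx.differentiableAt (by norm_num)

/-- The frame of Af is A times the frame of f, so components of A v in the new frame are those of v
in the old one. -/
theorem component_mulVec (A : Matrix.SpecialLinearGroup (Fin 3) ℂ) {f : Plane → C3}
    (hf : DifferentiableAt ℝ f y) (v : C3) :
    component (fun y => A.1.mulVec (f y)) (fun y => A.1.mulVec (f y)) y (A.1.mulVec v) =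
      component f f y v := by
  have hfr : frame (fun y => A.1.mulVec (f y)) (fun y => A.1.mulVec (f y)) y =
      A.1 * frame f f y := by
    ext a b
    fin_cases b <;> simp [frame, pd_mulVec A.1 _ hf, Matrix.mul_apply, Matrix.mulVec, dotProduct]
  have hA : IsUnit A.1.det := by rw [A.2]; exact isUnit_one
  rw [component, component, hfr, Matrix.mul_inv_rev, ← Matrix.mulVec_mulVec, Matrix.mulVec_mulVec v,
    Matrix.nonsing_inv_mul _ hA, Matrix.one_mulVec]

theorem inducedVolume_mulVec (A : Matrix.SpecialLinearGroup (Fin 3) ℂ) {f : Plane → C3}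
    (hf : DifferentiableAt ℝ f y) :
    inducedVolume (fun y => A.1.mulVec (f y)) (fun y => A.1.mulVec (f y)) y =
      inducedVolume f f y := by
  have hfr : frame (fun y => A.1.mulVec (f y)) (fun y => A.1.mulVec (f y)) y =
      A.1 * frame f f y := by
    ext a b
    fin_cases b <;> simp [frame, pd_mulVec A.1 _ hf, Matrix.mul_apply, Matrix.mulVec, dotProduct]
  rw [inducedVolume, inducedVolume, hfr, Matrix.det_mul, A.2, one_mul]

theorem SphereAt.mulVec (h : SphereAt G C σ y) (hσ : ContDiffAt ℝ ∞ σ y)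
    (A : Matrix.SpecialLinearGroup (Fin 3) ℂ) : SphereAt G C (fun y => A.1.mulVec (σ y)) y := by
  have hd := eventually_differentiableAt hσ
  have hd0 := hd.self_of_nhds
  have hpd : ∀ j, pd j (fun y => A.1.mulVec (σ y)) =ᶠ[𝓝 y] fun y => A.1.mulVec (pd j σ y) :=
    fun j => hd.mono fun x hx => pd_mulVec A.1 j hx
  have hpp : ∀ i j, pd i (pd j fun y => A.1.mulVec (σ y)) y = A.1.mulVec (pd i (pd j σ) y) := by
    intro i j
    rw [pd_congr i (hpd j), pd_mulVec A.1 i]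
    have h1 : ContDiffAt ℝ 1 (pd j σ) y :=
      (hσ.fderiv_right (m := 1) (WithTop.coe_le_coe.2 le_top)).clm_apply contDiffAt_const
    exact h1.differentiableAt (by norm_num)
  have hvol : inducedVolume (fun y => A.1.mulVec (σ y)) (fun y => A.1.mulVec (σ y)) =ᶠ[𝓝 y]
      inducedVolume σ σ := hd.mono fun x hx => inducedVolume_mulVec A hx
  have hind : ∀ k i j, inducedConnection (fun y => A.1.mulVec (σ y)) (fun y => A.1.mulVec (σ y))
      k i j y = inducedConnection σ σ k i j y := fun k i j => by
    rw [inducedConnection, hpp, component_mulVec A hd0, inducedConnection]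
  refine ⟨?_, fun i j => ?_, fun i => ?_, ?_, fun k i => ?_, fun i j k => ?_⟩
  · rw [linearIndependent_iff_det3_ne_zero]
    have := hvol.eq_of_nhds
    rw [inducedVolume_eq, inducedVolume_eq] at this
    rw [this]
    exact linearIndependent_iff_det3_ne_zero.1 h.transversal
  · rw [fundamentalForm, hpp, component_mulVec A hd0]
    exact h.metric i j
  · rw [pd_congr i hvol, hvol.eq_of_nhds]
    simp only [hind]
    exact h.parallel i
  · rw [hvol.eq_of_nhds]
    exact h.volume
  · rw [shapeOperator, pd_mulVec A.1 i hd0, component_mulVec A hd0]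
    exact h.shape k i
  · simp only [hind]
    exact h.pick i j k

theorem SphereAt.congr (h : SphereAt G C σ y) (hσ : σ =ᶠ[𝓝 y] σ') : SphereAt G C σ' y := by
  have hfr : frame σ σ =ᶠ[𝓝 y] frame σ' σ' := by
    filter_upwards [pd_eventuallyEq 0 hσ, pd_eventuallyEq 1 hσ, hσ] with x h0 h1 h2
    simp only [frame, h0, h1, h2]
  have hvol : inducedVolume σ σ =ᶠ[𝓝 y] inducedVolume σ' σ' :=
    hfr.mono fun x hx => by simp only [inducedVolume, hx]
  have hpp : ∀ i j, pd i (pd j σ) y = pd i (pd j σ') y := fun i j =>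
    pd_congr i (pd_eventuallyEq j hσ)
  have hind : ∀ k i j, inducedConnection σ' σ' k i j y = inducedConnection σ σ k i j y := by
    intro k i j
    simp only [inducedConnection, component, hfr.eq_of_nhds, hpp]
  refine ⟨?_, fun i j => ?_, fun i => ?_, ?_, fun k i => ?_, fun i j k => ?_⟩
  · rw [← pd_congr 0 hσ, ← pd_congr 1 hσ, ← hσ.eq_of_nhds]
    exact h.transversal
  · rw [← h.metric]
    simp only [fundamentalForm, component, hfr.eq_of_nhds, hpp]
  · rw [← pd_congr i hvol, ← hvol.eq_of_nhds]
    simp only [hind]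
    exact h.parallel i
  · rw [← hvol.eq_of_nhds]
    exact h.volume
  · rw [← h.shape]
    simp only [shapeOperator, component, hfr.eq_of_nhds, pd_congr i hσ]
  · simp only [hind]
    exact h.pick i j k

/-- Affine spheres with the same invariants locally differ by a unique element of `SL(3, ℂ)`. -/
theorem PickData.existsUnique_mulVec (H : PickData U z w l p q G C) (hσ : ContDiffOn ℝ ∞ σ U)
    (h : ∀ y ∈ U, StructureEqs z w l p q σ y) (hσ' : ContDiffOn ℝ ∞ σ' U)
    (h' : ∀ y ∈ U, StructureEqs z w l p q σ' y) (hy₀ : y₀ ∈ U) :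
    ∃! A : Matrix.SpecialLinearGroup (Fin 3) ℂ, ∀ᶠ y in 𝓝 y₀, σ' y = A.1.mulVec (σ y) := by
  set N : (Plane → C3) → Matrix (Fin 3) (Fin 3) ℂ := fun σ =>
    Matrix.of ![delZ z w σ y₀, delW z w σ y₀, σ y₀] with hN
  have hdet : ∀ σ, StructureEqs z w l p q σ y₀ → (N σ).det = Complex.I * l y₀ / 2 := fun σ hs => hs.det
  have hc : Complex.I * l y₀ / 2 ≠ 0 :=
    div_ne_zero (mul_ne_zero Complex.I_ne_zero (H.l_ne y₀ hy₀)) two_ne_zero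
  have hu : IsUnit (N σ).det := by
    rw [hdet σ (h y₀ hy₀)]
    exact isUnit_iff_ne_zero.2 hc
  have hrow : ∀ (A : Matrix (Fin 3) (Fin 3) ℂ) b, A.mulVec (N σ b) = (N σ * A.transpose) b := by
    intro A b
    ext n
    simp only [Matrix.mulVec, dotProduct, Matrix.mul_apply, Matrix.transpose_apply]
    exact Finset.sum_congr rfl fun k _ => mul_comm _ _
  -- The frame vectors are the rows of N, so a matrix acts by right multiplication with its
  -- transpose, and A is read off from N σ · Aᵀ = N σ'. Its determinant is 1 since both frames have
  -- determinant i l(y₀)/2.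
  obtain ⟨A, hA⟩ : ∃ A : Matrix.SpecialLinearGroup (Fin 3) ℂ,
      A.1 = ((N σ)⁻¹ * N σ').transpose := by
    refine ⟨⟨((N σ)⁻¹ * N σ').transpose, ?_⟩, rfl⟩
    rw [Matrix.det_transpose, Matrix.det_mul, Matrix.det_nonsing_inv, Ring.inverse_eq_inv',
      hdet σ (h y₀ hy₀), hdet σ' (h' y₀ hy₀), inv_mul_cancel₀ hc]
  refine ⟨A, ?_, fun B hB => ?_⟩
  · obtain ⟨r, hr, hrU⟩ := Metric.isOpen_iff.1 H.isOpen y₀ hy₀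
    have d : ∀ {σ : Plane → C3}, ContDiffOn ℝ ∞ σ U → ∀ y ∈ Metric.ball y₀ r,
        DifferentiableAt ℝ (fun y => ![delZ z w σ y, delW z w σ y, σ y]) y := by
      intro σ hσ y hy
      refine differentiableAt_pi.2 fun b => ?_
      fin_cases b
      exacts [H.differentiableAt (H.smooth_delZ hσ) (hrU hy),
        H.differentiableAt (H.smooth_delW hσ) (hrU hy), H.differentiableAt hσ (hrU hy)]
    have hsys : ∀ {σ : Plane → C3}, ContDiffOn ℝ ∞ σ U → (∀ y ∈ U, StructureEqs z w l p q σ y) →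
        ∀ y ∈ Metric.ball y₀ r, ∀ i b, pd i (fun y => ![delZ z w σ y, delW z w σ y, σ y]) y b =
          ∑ c, structureCoeff z w l p q i b c y • ![delZ z w σ y, delW z w σ y, σ y] c := by
      intro σ hσ h y hy i b
      rw [← (h y (hrU hy)).pd_frame (H.jac_ne y (hrU hy))]
      have := pd_apply i (ContinuousLinearMap.proj (R := ℝ) (φ := fun _ : Fin 3 => C3) b) (d hσ y hy)
      refine Eq.trans this.symm ?_
      fin_cases b <;> rfl
    have d1 : ∀ y ∈ Metric.ball y₀ r, ∀ b, DifferentiableAt ℝ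
        (fun y => ![delZ z w σ y, delW z w σ y, σ y] b) y := fun y hy =>
      differentiableAt_pi.1 (d hσ y hy)
    -- The frame of σ' and A applied to the frame of σ solve the same linear system and agree at y₀.
    have hEq := eqOn_frame (y₀ := y₀) (r := r)
      (fun i b c => (H.smooth_structureCoeff i b c).mono hrU)
      (F := fun y => ![delZ z w σ' y, delW z w σ' y, σ' y])
      (F' := fun y b => A.1.mulVec (![delZ z w σ y, delW z w σ y, σ y] b))
      (fun y hy => ⟨d hσ' y hy, hsys hσ' h' y hy⟩) (fun y hy => ⟨?_, fun i b => ?_⟩) ?_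
    · filter_upwards [Metric.ball_mem_nhds y₀ hr] with y hy
      exact congrFun (hEq hy) 2
    · exact differentiableAt_pi.2 fun b =>
        (mulVecReal A.1).differentiableAt.comp y (d1 y hy b)
    · have e1 := pd_apply i (ContinuousLinearMap.proj (R := ℝ) (φ := fun _ : Fin 3 => C3) b)
        (f := fun y b => A.1.mulVec (![delZ z w σ y, delW z w σ y, σ y] b)) (y := y)
        (differentiableAt_pi.2 fun b => (mulVecReal A.1).differentiableAt.comp y (d1 y hy b))
      have e2 := pd_apply i (ContinuousLinearMap.proj (R := ℝ) (φ := fun _ : Fin 3 => C3) b)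
        (d hσ y hy)
      refine Eq.trans e1.symm ?_
      refine (pd_mulVec A.1 i (d1 y hy b)).trans ?_
      have e3 : pd i (fun y => ![delZ z w σ y, delW z w σ y, σ y] b) y =
        ∑ c, structureCoeff z w l p q i b c y • ![delZ z w σ y, delW z w σ y, σ y] c :=
        e2.trans (hsys hσ h y hy i b)
      rw [e3, ← mulVecReal_apply, map_sum]
      refine Finset.sum_congr rfl fun c _ => ?_
      rw [mulVecReal_apply, Matrix.mulVec_smul]
    · funext b
      have : A.1.mulVec (N σ b) = N σ' b := by
        rw [hrow, hA, Matrix.transpose_transpose, ← Matrix.mul_assoc, Matrix.mul_nonsing_inv _ hu,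
          Matrix.one_mul]
      exact this.symm
  -- Equality of germs passes to derivatives, so B carries one frame at y₀ to the other and is
  -- determined by the two frames.
  · have hd := H.differentiableAt hσ hy₀
    have hrows : ∀ b, B.1.mulVec (N σ b) = N σ' b := by
      have hB' : σ' =ᶠ[𝓝 y₀] fun y => B.1.mulVec (σ y) := hB
      intro b
      fin_cases b
      · exact (((delZ_congr (z := z) (w := w) .rfl .rfl hB').trans (delZ_mulVec B.1 hd))).symm
      · exact (((delW_congr (z := z) (w := w) .rfl .rfl hB').trans (delW_mulVec B.1 hd))).symm
      · exact hB.self_of_nhds.symm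
    have hmul : N σ * B.1.transpose = N σ' := by
      funext b
      rw [← hrow, hrows]
    refine Subtype.ext ?_
    rw [hA, ← hmul, ← Matrix.mul_assoc, Matrix.nonsing_inv_mul _ hu, Matrix.one_mul,
      Matrix.transpose_transpose]

end LinearAction

end CAS
end

noncomputable section

namespace CAS

/-! ### Composition with holomorphic functions -/

section Holomorphic

variable {F : ℂ → ℂ} {f : Plane → ℂ} {y : Plane} {Ω : Set ℂ} {U : Set Plane}

theorem pd_comp_holomorphic (i : Fin 2) (hF : DifferentiableAt ℂ F (f y))
    (hf : DifferentiableAt ℝ f y) : pd i (F ∘ f) y = deriv F (f y) * pd i f y := by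
  have h := (hF.hasDerivAt.hasFDerivAt.restrictScalars ℝ).comp y hf.hasFDerivAt
  rw [pd, h.fderiv]
  simp [pd, mul_comm]

theorem contDiffOn_comp_holomorphic (hΩ : IsOpen Ω) (hF : DifferentiableOn ℂ F Ω)
    (hf : ContDiffOn ℝ ∞ f U) (hm : MapsTo f U Ω) : ContDiffOn ℝ ∞ (F ∘ f) U :=
  ((hF.contDiffOn (n := ∞) hΩ).restrict_scalars ℝ).comp hf hm

end Holomorphic

/-! ### Lifting charts to the covering -/

section Lift

variable {S M H : Type*} [TopologicalSpace S] [TopologicalSpace M] [TopologicalSpace H]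
  {p : M → S} {e : OpenPartialHomeomorph S H} {κ : OpenPartialHomeomorph M H}

theorem IsLift.mem_target (h : IsLift p e κ) {y : H} (hy : y ∈ κ.target) : y ∈ e.target := by
  have := h _ (κ.map_target hy)
  rw [κ.right_inv hy] at this
  rw [this.2]
  exact e.map_source this.1

theorem IsLift.apply_symm (h : IsLift p e κ) {y : H} (hy : y ∈ κ.target) :
    p (κ.symm y) = e.symm y := by
  have := h _ (κ.map_target hy)
  rw [κ.right_inv hy] at this
  exact ((congrArg e.symm this.2).trans (e.left_inv this.1)).symm

theorem IsLift.symm_apply (h : IsLift p e κ) {x : M} (hx : x ∈ κ.source) :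
    e.symm (κ x) = p x := by
  rw [(h x hx).2, e.left_inv (h x hx).1]

theorem exists_isLift (hp : IsLocalHomeomorph p) {x : M} (hx : p x ∈ e.source) :
    ∃ κ : OpenPartialHomeomorph M H, IsLift p e κ ∧ x ∈ κ.source := by
  obtain ⟨q, hq, rfl⟩ := hp x
  exact ⟨q ≫ₕ e, fun y hy => ⟨(mem_preimage.1 (by simpa using hy.2)), rfl⟩, by simpa using ⟨hq, hx⟩⟩

theorem exists_isLift_of_target (hp : IsLocalHomeomorph p) (hs : Function.Surjective p) {y : H}
    (hy : y ∈ e.target) : ∃ κ : OpenPartialHomeomorph M H, IsLift p e κ ∧ y ∈ κ.target := by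
  obtain ⟨x, hx⟩ := hs (e.symm y)
  obtain ⟨κ, hκ, hxκ⟩ := exists_isLift (e := e) hp (x := x) (hx ▸ e.map_target hy)
  refine ⟨κ, hκ, ?_⟩
  have := κ.map_source hxκ
  rwa [(hκ x hxκ).2, hx, e.right_inv hy] at this

variable (p) in
/-- The atlas of lifted charts on a covering of a surface. -/
abbrev liftedAtlas [ChartedSpace Plane S] (hp : IsLocalHomeomorph p) : ChartedSpace Plane M where
  atlas := {κ | ∃ e ∈ atlas Plane S, IsLift p e κ}
  chartAt x := (exists_isLift hp (mem_chart_source Plane (p x))).choose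
  mem_chart_source x := (exists_isLift hp (mem_chart_source Plane (p x))).choose_spec.2
  chart_mem_atlas x := ⟨_, chart_mem_atlas Plane (p x),
    (exists_isLift hp (mem_chart_source Plane (p x))).choose_spec.1⟩

theorem locallyPathConnectedSpace_of_isLocalHomeomorph [ChartedSpace Plane S]
    (hp : IsLocalHomeomorph p) : LocallyPathConnectedSpace M :=
  let _ := liftedAtlas p hp
  ChartedSpace.locallyPathConnectedSpace Plane M

end Lift

/-! ### From the surface to null coordinates in a chart -/

section Coordinates

variable {S : Type*} [TopologicalSpace S] [ChartedSpace Plane S] {c c₁ c₂ : ComplexStructure S}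
  {z w : OpenPartialHomeomorph S ℂ} {e e' : OpenPartialHomeomorph S Plane} {y : Plane}

/-- The part of the range of the chart `e` where the complex coordinates `z`, `w` are defined. -/
def chartDomain (z w : OpenPartialHomeomorph S ℂ) (e : OpenPartialHomeomorph S Plane) : Set Plane :=
  e.target ∩ e.symm ⁻¹' (z.source ∩ w.source)

omit [ChartedSpace Plane S] in
theorem isOpen_chartDomain : IsOpen (chartDomain z w e) :=
  e.symm.isOpen_inter_preimage (z.open_source.inter w.open_source)

section Smooth

variable [IsManifold (𝓡 2) ∞ S]

theorem contMDiffOn_chart_symm (he : e ∈ atlas Plane S) :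
    ContMDiffOn (𝓡 2) (𝓡 2) ∞ e.symm e.target :=
  contMDiffOn_symm_of_mem_maximalAtlas (IsManifold.subset_maximalAtlas he)

theorem contMDiffOn_chart (he : e ∈ atlas Plane S) : ContMDiffOn (𝓡 2) (𝓡 2) ∞ e e.source :=
  contMDiffOn_of_mem_maximalAtlas (IsManifold.subset_maximalAtlas he)

theorem contDiffOn_transition (he : e ∈ atlas Plane S) (he' : e' ∈ atlas Plane S) :
    ContDiffOn ℝ ∞ (e' ∘ e.symm) (e.target ∩ e.symm ⁻¹' e'.source) :=
  contMDiffOn_iff_contDiffOn.1 ((contMDiffOn_chart he').comp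
    ((contMDiffOn_chart_symm he).mono inter_subset_left) fun _ hy => hy.2)

theorem contDiffOn_comp_chart_symm (he : e ∈ atlas Plane S) {f : S → ℂ} {s : Set S}
    (hf : ContMDiffOn (𝓡 2) 𝓘(ℝ, ℂ) ∞ f s) :
    ContDiffOn ℝ ∞ (f ∘ e.symm) (e.target ∩ e.symm ⁻¹' s) :=
  contMDiffOn_iff_contDiffOn.1 (hf.comp ((contMDiffOn_chart_symm he).mono inter_subset_left)
    fun _ hy => hy.2)

/-- This chain rule turns conditions stated with the intrinsic differentials of z and w into
conditions on partial derivatives in a chart. -/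
theorem dcoord_mfderiv_symm (hz : z ∈ c.charts) (he : e ∈ atlas Plane S) (hy : y ∈ e.target)
    (hyz : e.symm y ∈ z.source) (v : Plane) :
    dcoord z (e.symm y) (mfderiv (𝓡 2) (𝓡 2) e.symm y v) = fderiv ℝ (z ∘ e.symm) y v := by
  have h1 : MDifferentiableAt (𝓡 2) 𝓘(ℝ, ℂ) z (e.symm y) :=
    ((c.smooth z hz).contMDiffAt (z.open_source.mem_nhds hyz)).mdifferentiableAt (by simp)
  have h2 : MDifferentiableAt (𝓡 2) (𝓡 2) e.symm y :=
    ((contMDiffOn_chart_symm he).contMDiffAt (e.open_target.mem_nhds hy)).mdifferentiableAt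
      (by simp)
  have h3 := mfderiv_comp y h1 h2
  rw [mfderiv_eq_fderiv] at h3
  rw [h3]
  rfl

theorem exists_eq_mfderiv_symm (he : e ∈ atlas Plane S) (hy : y ∈ e.target)
    (v : TangentSpace (𝓡 2) (e.symm y)) : ∃ a : Plane, v = mfderiv (𝓡 2) (𝓡 2) e.symm y a := by
  have h1 : MDifferentiableAt (𝓡 2) (𝓡 2) e (e.symm y) :=
    ((contMDiffOn_chart he).contMDiffAt (e.open_source.mem_nhds (e.map_target hy))).mdifferentiableAt
      (by simp)
  have h2 : MDifferentiableAt (𝓡 2) (𝓡 2) e.symm (e (e.symm y)) := by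
    rw [e.right_inv hy]
    exact ((contMDiffOn_chart_symm he).contMDiffAt (e.open_target.mem_nhds hy)).mdifferentiableAt
      (by simp)
  have h3 := mfderiv_comp (e.symm y) h2 h1
  have h4 : e.symm ∘ e =ᶠ[𝓝 (e.symm y)] id := by
    filter_upwards [e.open_source.mem_nhds (e.map_target hy)] with x hx using e.left_inv hx
  have h5 := h4.mfderiv_eq (I := 𝓡 2) (I' := 𝓡 2)
  rw [h3, mfderiv_id] at h5
  -- The base points e (e.symm y) and y agree only propositionally; both derivatives are compared as
  -- maps on the model plane.
  have h6 : ∀ y' b, y' = y → (mfderiv (𝓡 2) (𝓡 2) e.symm y' b : Plane) =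
      (mfderiv (𝓡 2) (𝓡 2) e.symm y b : Plane) := by
    rintro _ b rfl
    rfl
  exact ⟨mfderiv (𝓡 2) (𝓡 2) e (e.symm y) v,
    (DFunLike.congr_fun h5 v).symm.trans (h6 _ _ (e.right_inv hy))⟩

end Smooth

section PickData

variable [IsManifold (𝓡 2) ∞ S] {g : CTensor S 2} {Q Q₁ Q₂ : CTensor S 3} {l : S → ℂ}

theorem ComplexStructure.contDiffOn (hz : z ∈ c.charts) (he : e ∈ atlas Plane S) :
    ContDiffOn ℝ ∞ (z ∘ e.symm) (e.target ∩ e.symm ⁻¹' z.source) :=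
  contDiffOn_comp_chart_symm he (c.smooth z hz)

omit [IsManifold (𝓡 2) ∞ S] in
theorem ComplexStructure.IsCompatible.side_pos (hc : c.IsCompatible) (hz : z ∈ c.charts)
    (he : e ∈ atlas Plane S) (hy : y ∈ e.target) (hyz : e.symm y ∈ z.source) :
    0 < side fun i => pd i (z ∘ e.symm) y := hc z hz e he y hy hyz

omit [IsManifold (𝓡 2) ∞ S] in
theorem ComplexStructure.IsAntiCompatible.side_neg (hc : c.IsAntiCompatible) (hz : z ∈ c.charts)
    (he : e ∈ atlas Plane S) (hy : y ∈ e.target) (hyz : e.symm y ∈ z.source) :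
    side (fun i => pd i (z ∘ e.symm) y) < 0 := hc z hz e he y hy hyz

theorem nullCoords_chartDomain (hc₁ : c₁.IsCompatible) (hc₂ : c₂.IsAntiCompatible)
    (hz : z ∈ c₁.charts) (hw : w ∈ c₂.charts) (he : e ∈ atlas Plane S) :
    NullCoords (chartDomain z w e) (z ∘ e.symm) (w ∘ e.symm) where
  isOpen := isOpen_chartDomain
  smooth_z := (c₁.contDiffOn hz he).mono (inter_subset_inter_right _ fun _ hy => hy.1)
  smooth_w := (c₂.contDiffOn hw he).mono (inter_subset_inter_right _ fun _ hy => hy.2)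
  jac_ne _ hy := jac_ne_zero_of_side (hc₁.side_pos hz he hy.1 hy.2.1)
    (hc₂.side_neg hw he hy.1 hy.2.2)

theorem isNullForm_gram (hz : z ∈ c₁.charts) (hw : w ∈ c₂.charts) (he : e ∈ atlas Plane S)
    {a : ℂ} (hy : y ∈ chartDomain z w e)
    (hg : ∀ v v' : TangentSpace (𝓡 2) (e.symm y), g (e.symm y) ![v, v'] = a * ((1 / 2) *
      (dcoord z (e.symm y) v * dcoord w (e.symm y) v' +
        dcoord w (e.symm y) v * dcoord z (e.symm y) v'))) :
    IsNullForm (gram g e y) a (fun i => pd i (z ∘ e.symm) y) (fun i => pd i (w ∘ e.symm) y) := by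
  intro i j
  have h := hg (mfderiv (𝓡 2) (𝓡 2) e.symm y (EuclideanSpace.single i (1 : ℝ)))
    (mfderiv (𝓡 2) (𝓡 2) e.symm y (EuclideanSpace.single j (1 : ℝ)))
  simp only [dcoord_mfderiv_symm hz he hy.1 hy.2.1, dcoord_mfderiv_symm hw he hy.1 hy.2.2] at h
  refine Eq.trans ?_ h
  rw [gram, Matrix.of_apply, CTensor.coeff]
  congr 1
  funext b
  fin_cases b <;> rfl

/-- Evaluating G on spanning vectors of ker W and ker Z isolates the coefficient. A conformal class
supplies it only pointwise; this formula shows that it depends smoothly on the point when the metric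
does. -/
theorem IsNullForm.eq_coefficient {G : Matrix (Fin 2) (Fin 2) ℂ} {a : ℂ} {Z W : Fin 2 → ℂ}
    (h : IsNullForm G a Z W) (hJ : Z 0 * W 1 - Z 1 * W 0 ≠ 0) :
    a = 2 * (W 1 * (Z 0 * G 0 1 - Z 1 * G 0 0) - W 0 * (Z 0 * G 1 1 - Z 1 * G 1 0)) /
      (Z 0 * W 1 - Z 1 * W 0) ^ 2 := by
  rw [h, h, h, h, eq_div_iff (pow_ne_zero 2 hJ)]
  ring

omit [IsManifold (𝓡 2) ∞ S] in
theorem CTensor.IsSmooth.contDiffOn_gram (hg : g.IsSmooth) (he : e ∈ atlas Plane S) (i j : Fin 2) :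
    ContDiffOn ℝ ∞ (fun y => gram g e y i j) e.target := hg e he ![i, j]

theorem nullMetric_chartDomain (hc₁ : c₁.IsCompatible) (hc₂ : c₂.IsAntiCompatible)
    (hz : z ∈ c₁.charts) (hw : w ∈ c₂.charts) (he : e ∈ atlas Plane S) (hg : g.IsSmooth)
    (hl : ∀ x ∈ z.source ∩ w.source, l x ≠ 0 ∧ ∀ v v' : TangentSpace (𝓡 2) x, g x ![v, v'] =
      l x * ((1 / 2) * (dcoord z x v * dcoord w x v' + dcoord w x v * dcoord z x v'))) :
    NullMetric (chartDomain z w e) (z ∘ e.symm) (w ∘ e.symm) (l ∘ e.symm) (gram g e) := by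
  have N := nullCoords_chartDomain hc₁ hc₂ hz hw he
  have hform : ∀ y ∈ chartDomain z w e, IsNullForm (gram g e y) (l (e.symm y))
      (fun i => pd i (z ∘ e.symm) y) (fun i => pd i (w ∘ e.symm) y) := fun y hy =>
    isNullForm_gram hz hw he hy (hl _ hy.2).2
  refine ⟨N, ?_, fun y hy => (hl _ hy.2).1, hform⟩
  have hG := fun i j => (hg.contDiffOn_gram he i j).mono (inter_subset_left : chartDomain z w e ⊆ _)
  have dz := fun i => N.smooth_pd i N.smooth_z
  have dw := fun i => N.smooth_pd i N.smooth_w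
  refine (contDiffOn_div ((contDiffOn_const (c := (2 : ℂ))).mul
    (((dw 1).mul (((dz 0).mul (hG 0 1)).sub ((dz 1).mul (hG 0 0)))).sub
      ((dw 0).mul (((dz 0).mul (hG 1 1)).sub ((dz 1).mul (hG 1 0))))))
    (N.smooth_jac.pow 2) fun y hy => pow_ne_zero 2 (N.jac_ne y hy)).congr fun y hy => ?_
  exact (hform y hy).eq_coefficient (N.jac_ne y hy)

theorem coeff_cubic (hz : z ∈ c.charts) (he : e ∈ atlas Plane S) {φ : ℂ → ℂ}
    (hQ : ∀ x ∈ z.source, ∀ v : Fin 3 → TangentSpace (𝓡 2) x,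
      Q x v = φ (z x) * ∏ a, dcoord z x (v a)) (hy : y ∈ e.target) (hyz : e.symm y ∈ z.source)
    (i : Fin 3 → Fin 2) :
    Q.coeff e y i = (φ ∘ (z ∘ e.symm)) y * ∏ a, pd (i a) (z ∘ e.symm) y := by
  rw [CTensor.coeff, hQ _ hyz]
  simp only [dcoord_mfderiv_symm hz he hy hyz]
  rfl

variable (z w) in
/-- In the coordinates `z`, `w` one has `g = l dz dw`, `Q₁ = φ dz³` and `Q₂ = ψ dw³`. -/
structure CoordinateData (l φ ψ : S → ℂ) (g : CTensor S 2) (Q₁ Q₂ : CTensor S 3) : Prop where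
  pick : ∀ e ∈ atlas Plane S, PickData (chartDomain z w e) (z ∘ e.symm) (w ∘ e.symm)
    (l ∘ e.symm) (φ ∘ e.symm) (ψ ∘ e.symm) (gram g e) ((Q₁ + Q₂).coeff e)
  coeff_left : ∀ e ∈ atlas Plane S, ∀ y ∈ chartDomain z w e, ∀ i,
    Q₁.coeff e y i = (φ ∘ e.symm) y * ∏ a, pd (i a) (z ∘ e.symm) y
  coeff_right : ∀ e ∈ atlas Plane S, ∀ y ∈ chartDomain z w e, ∀ i,
    Q₂.coeff e y i = (ψ ∘ e.symm) y * ∏ a, pd (i a) (w ∘ e.symm) y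

theorem exists_coordinateData (hc₁ : c₁.IsCompatible) (hc₂ : c₂.IsAntiCompatible)
    (hQ₁ : IsHolomorphicCubic c₁ Q₁) (hQ₂ : IsHolomorphicCubic c₂ Q₂) (hg : g.IsSmooth)
    (hgc : HasConformalClass g c₁ c₂) (x : S) :
    ∃ (z w : OpenPartialHomeomorph S ℂ) (l φ ψ : S → ℂ), x ∈ z.source ∩ w.source ∧
      CoordinateData z w l φ ψ g Q₁ Q₂ := by
  classical
  obtain ⟨z, hz, hxz⟩ := c₁.cover x
  obtain ⟨w, hw, hxw⟩ := c₂.cover x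
  have hl := hgc z hz w hw
  choose! l hl using hl
  obtain ⟨φ, hφ, hφQ⟩ := hQ₁ z hz
  obtain ⟨ψ, hψ, hψQ⟩ := hQ₂ w hw
  refine ⟨z, w, l, φ ∘ z, ψ ∘ w, ⟨hxz, hxw⟩, fun e he => ?_, fun e he y hy i =>
    coeff_cubic hz he hφQ hy.1 hy.2.1 i, fun e he y hy i => coeff_cubic hw he hψQ hy.1 hy.2.2 i⟩
  have H := nullMetric_chartDomain hc₁ hc₂ hz hw he hg hl
  have mz : MapsTo (z ∘ e.symm) (chartDomain z w e) z.target := fun y hy => z.map_source hy.2.1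
  have mw : MapsTo (w ∘ e.symm) (chartDomain z w e) w.target := fun y hy => w.map_source hy.2.2
  refine ⟨H, fun y hy => hc₁.side_pos hz he hy.1 hy.2.1, fun y hy =>
    hc₂.side_neg hw he hy.1 hy.2.2, contDiffOn_comp_holomorphic z.open_target hφ H.smooth_z mz,
    contDiffOn_comp_holomorphic w.open_target hψ H.smooth_w mw, fun y hy => ?_, fun y hy => ?_,
    fun y hy i => ?_⟩
  · refine delW_eq (H.jac_ne y hy) (a := deriv φ (z (e.symm y))) fun i => ?_
    refine (pd_comp_holomorphic i (hφ.differentiableAt (z.open_target.mem_nhds (mz hy)))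
      (H.differentiableAt H.smooth_z hy)).trans ?_
    rw [smul_zero, add_zero, smul_eq_mul, mul_comm]
    rfl
  · refine delZ_eq (H.jac_ne y hy) (b := deriv ψ (w (e.symm y))) fun i => ?_
    refine (pd_comp_holomorphic i (hψ.differentiableAt (w.open_target.mem_nhds (mw hy)))
      (H.differentiableAt H.smooth_w hy)).trans ?_
    rw [smul_zero, zero_add, smul_eq_mul, mul_comm]
    rfl
  · exact congrArg₂ (· + ·) (coeff_cubic hz he hφQ hy.1 hy.2.1 i)
      (coeff_cubic hw he hψQ hy.1 hy.2.2 i)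

end PickData

end Coordinates

end CAS
end

noncomputable section

namespace CAS

/-! ### Affine spheres on the covering as a local condition -/

section Spheres

variable {S M : Type*} [TopologicalSpace S] [ChartedSpace Plane S] [TopologicalSpace M]
  {p : M → S} {g : CTensor S 2} {C Q₁ Q₂ : CTensor S 3} {σ σ' : M → C3} {x : M}
  {z w : OpenPartialHomeomorph S ℂ} {l φ ψ : S → ℂ} {e : OpenPartialHomeomorph S Plane}
  {κ : OpenPartialHomeomorph M Plane}

theorem CoordinateData.gauss_iff (D : CoordinateData z w l φ ψ g Q₁ Q₂) (he : e ∈ atlas Plane S)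
    {y : Plane} (hy : y ∈ chartDomain z w e) :
    curvature (gram g e) y = -1 + (1 / 4) * cubicPairing g Q₁ Q₂ e y ↔
      delW (z ∘ e.symm) (w ∘ e.symm)
        (fun y => delZ (z ∘ e.symm) (w ∘ e.symm) (l ∘ e.symm) y / (l ∘ e.symm) y) y +
        (φ ∘ e.symm) y / (l ∘ e.symm) y * ((ψ ∘ e.symm) y / (l ∘ e.symm) y) =
        (l ∘ e.symm) y / 2 := by
  rw [← (D.pick e he).curvature_eq_iff hy, cubicPairing,
    (D.pick e he).sum_pairing_eq hy (D.coeff_left e he y hy) (D.coeff_right e he y hy)]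

variable (p g C) in
/-- `σ` is an affine sphere, with itself as affine normal, at the point `x` of the covering. -/
def IsSphereNear (σ : M → C3) (x : M) : Prop :=
  ∀ e ∈ atlas Plane S, ∀ κ : OpenPartialHomeomorph M Plane, IsLift p e κ → x ∈ κ.source →
    ContDiffAt ℝ ∞ (σ ∘ κ.symm) (κ x) ∧ SphereAt (gram g e) (C.coeff e) (σ ∘ κ.symm) (κ x)

/-- The normalization σ − ξ = 0 eliminates ξ. What remains splits into a condition on germs, suited
to patching, and equivariance. -/
theorem isEquivariantCAS_iff : IsEquivariantCAS p g C σ ↔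
    IsPositiveComplexMetric g ∧ (∀ x, IsSphereNear p g C σ x) ∧ IsEquivariant p σ σ := by
  constructor
  · rintro ⟨ξ, h, hC, hρ, hξ⟩
    obtain rfl : σ = ξ := funext fun x => sub_eq_zero.1 (hξ x)
    refine ⟨h.positive, fun x e he κ hκ hx => ?_, hρ⟩
    have hy := κ.map_source hx
    exact ⟨(h.smooth e he κ hκ).contDiffAt (κ.open_target.mem_nhds hy),
      h.transversal e he κ hκ _ hy, h.metric e he κ hκ _ hy, h.parallel e he κ hκ _ hy,
      h.volume e he κ hκ _ hy, h.shape e he κ hκ _ hy, hC e he κ hκ _ hy⟩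
  · rintro ⟨hg, h, hρ⟩
    have key : ∀ e ∈ atlas Plane S, ∀ κ : OpenPartialHomeomorph M Plane, IsLift p e κ →
        ∀ y ∈ κ.target, ContDiffAt ℝ ∞ (σ ∘ κ.symm) y ∧
          SphereAt (gram g e) (C.coeff e) (σ ∘ κ.symm) y := fun e he κ hκ y hy => by
      have := h (κ.symm y) e he κ hκ (κ.map_target hy)
      rwa [κ.right_inv hy] at this
    have hs : SmoothOnCover p σ := fun e he κ hκ y hy =>
      (key e he κ hκ y hy).1.contDiffWithinAt
    exact ⟨σ, ⟨⟨⟨hs, hs, fun e he κ hκ y hy => (key e he κ hκ y hy).2.transversal⟩, hg,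
      fun e he κ hκ y hy => (key e he κ hκ y hy).2.metric,
      fun e he κ hκ y hy => (key e he κ hκ y hy).2.parallel,
      fun e he κ hκ y hy => (key e he κ hκ y hy).2.volume⟩,
      fun e he κ hκ y hy => (key e he κ hκ y hy).2.shape⟩,
      fun e he κ hκ y hy => (key e he κ hκ y hy).2.pick, hρ, fun x => sub_self _⟩

theorem IsSphereNear.congr (h : IsSphereNear p g C σ x) (hσ : σ =ᶠ[𝓝 x] σ') :
    IsSphereNear p g C σ' x := fun e he κ hκ hx => by
  have hev : σ ∘ κ.symm =ᶠ[𝓝 (κ x)] σ' ∘ κ.symm := (κ.eventually_nhds' (fun y => σ y = σ' y) hx).2 hσ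
  have := h e he κ hκ hx
  exact ⟨this.1.congr_of_eventuallyEq hev.symm, this.2.congr hev⟩

theorem IsSphereNear.mulVec (h : IsSphereNear p g C σ x)
    (A : Matrix.SpecialLinearGroup (Fin 3) ℂ) :
    IsSphereNear p g C (fun y => A.1.mulVec (σ y)) x := fun e he κ hκ hx => by
  have := h e he κ hκ hx
  exact ⟨contDiffAt_mulVec A.1 this.1, this.2.mulVec this.1 A⟩

/-- Composing a lift of the chart e with the inverse of a deck transformation gives another lift of
e, and the condition is imposed in all lifts. -/
theorem IsSphereNear.comp_deck {d : M ≃ₜ M} (hd : d ∈ deckGroup p)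
    (h : IsSphereNear p g C σ (d x)) : IsSphereNear p g C (σ ∘ d) x := fun e he κ hκ hx => by
  have hp : ∀ x', p (d.symm x') = p x' := fun x' => by
    have := hd (d.symm x')
    rw [d.apply_symm_apply] at this
    exact this.symm
  have h' := h e he (d.symm.transOpenPartialHomeomorph κ)
    (fun x' hx' => by
      have := hκ (d.symm x') hx'
      rw [hp] at this
      exact this)
    (by simpa using hx)
  simpa [Function.comp_def] using h'

section Local

variable (D : CoordinateData z w l φ ψ g Q₁ Q₂)
include D

theorem CoordinateData.exists_structureEqs_of_sphere (he : e ∈ atlas Plane S) (hκ : IsLift p e κ)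
    (hx : x ∈ κ.source) (hpx : p x ∈ z.source ∩ w.source)
    (hσ : ∀ᶠ x' in 𝓝 x, IsSphereNear p g (Q₁ + Q₂) σ x') :
    ∃ V ⊆ chartDomain z w e, IsOpen V ∧ κ x ∈ V ∧ ContDiffOn ℝ ∞ (σ ∘ κ.symm) V ∧
      ∀ y ∈ V, StructureEqs (z ∘ e.symm) (w ∘ e.symm) (l ∘ e.symm) (φ ∘ e.symm) (ψ ∘ e.symm)
        (σ ∘ κ.symm) y := by
  have h1 : ∀ᶠ y in 𝓝 (κ x), IsSphereNear p g (Q₁ + Q₂) σ (κ.symm y) ∧ y ∈ κ.target :=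
    ((κ.eventually_nhds' (fun x => IsSphereNear p g (Q₁ + Q₂) σ x) hx).2 hσ).and (κ.open_target.mem_nhds (κ.map_source hx))
  obtain ⟨V, hV, hVo, hxV⟩ := eventually_nhds_iff.1 h1
  have hs : ∀ y ∈ V, ContDiffAt ℝ ∞ (σ ∘ κ.symm) y ∧
      SphereAt (gram g e) ((Q₁ + Q₂).coeff e) (σ ∘ κ.symm) y := fun y hy => by
    have := (hV y hy).1 e he κ hκ (κ.map_target (hV y hy).2)
    rwa [κ.right_inv (hV y hy).2] at this
  have H := (D.pick e he).mono (hVo.inter isOpen_chartDomain) inter_subset_right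
  have hsm : ContDiffOn ℝ ∞ (σ ∘ κ.symm) (V ∩ chartDomain z w e) := fun y hy =>
    (hs y hy.1).1.contDiffWithinAt
  refine ⟨_, inter_subset_right, hVo.inter isOpen_chartDomain, ⟨hxV, hκ.mem_target
    (κ.map_source hx), ?_⟩, hsm, fun y hy => H.structureEqs_of_sphereAt hsm hy (hs y hy.1).2⟩
  rw [mem_preimage, hκ.symm_apply hx]
  exact hpx

theorem CoordinateData.existsUnique_mulVec (he : e ∈ atlas Plane S) (hκ : IsLift p e κ)
    (hx : x ∈ κ.source) (hpx : p x ∈ z.source ∩ w.source)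
    (hσ : ∀ᶠ x' in 𝓝 x, IsSphereNear p g (Q₁ + Q₂) σ x')
    (hσ' : ∀ᶠ x' in 𝓝 x, IsSphereNear p g (Q₁ + Q₂) σ' x') :
    ∃! A : Matrix.SpecialLinearGroup (Fin 3) ℂ, ∀ᶠ y in 𝓝 x, σ' y = A.1.mulVec (σ y) := by
  obtain ⟨V, hVs, hVo, hxV, hs, h⟩ := D.exists_structureEqs_of_sphere he hκ hx hpx hσ
  obtain ⟨V', -, hVo', hxV', hs', h'⟩ := D.exists_structureEqs_of_sphere he hκ hx hpx hσ'
  have H := (D.pick e he).mono (hVo.inter hVo') (inter_subset_left.trans hVs)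
  have := H.existsUnique_mulVec (hs.mono inter_subset_left) (fun y hy => h y hy.1)
    (hs'.mono inter_subset_right) (fun y hy => h' y hy.2) ⟨hxV, hxV'⟩
  refine (existsUnique_congr fun A => ?_).1 this
  exact κ.eventually_nhds' (fun y => σ' y = A.1.mulVec (σ y)) hx

theorem CoordinateData.gauss_of_sphere (he : e ∈ atlas Plane S) (hκ : IsLift p e κ)
    (hx : x ∈ κ.source) (hpx : p x ∈ z.source ∩ w.source)
    (hσ : ∀ᶠ x' in 𝓝 x, IsSphereNear p g (Q₁ + Q₂) σ x') :
    curvature (gram g e) (κ x) = -1 + (1 / 4) * cubicPairing g Q₁ Q₂ e (κ x) := by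
  obtain ⟨V, hVs, hVo, hxV, hs, h⟩ := D.exists_structureEqs_of_sphere he hκ hx hpx hσ
  exact (D.gauss_iff he (hVs hxV)).2
    (((D.pick e he).mono hVo hVs).integrability_of_structureEqs hs h hxV)

/-- Solving the equations in one lifted chart suffices. The transition τ to another lifted chart
coincides with the transition of the surface charts, hence is smooth, and the structure equations
are invariant under it. -/
theorem CoordinateData.isSphereNear_of_structureEqs [IsManifold (𝓡 2) ∞ S]
    (he : e ∈ atlas Plane S) (hκ : IsLift p e κ) {V : Set Plane} (hVo : IsOpen V)
    (hV : V ⊆ chartDomain z w e) {s : Plane → C3} (hs : ContDiffOn ℝ ∞ s V)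
    (h : ∀ y ∈ V, StructureEqs (z ∘ e.symm) (w ∘ e.symm) (l ∘ e.symm) (φ ∘ e.symm) (ψ ∘ e.symm)
      s y) (hx : x ∈ κ.source) (hxV : κ x ∈ V) : IsSphereNear p g (Q₁ + Q₂) (s ∘ κ) x := by
  intro e' he' κ' hκ' hx'
  set τ : Plane → Plane := κ ∘ κ'.symm with hτdef
  set V' : Set Plane := (κ'.symm ≫ₕ κ).source ∩ (κ'.symm ≫ₕ κ) ⁻¹' V with hV'def
  have hV'o : IsOpen V' := (κ'.symm ≫ₕ κ).isOpen_inter_preimage hVo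
  have hV' : ∀ y ∈ V', y ∈ κ'.target ∧ κ'.symm y ∈ κ.source ∧ τ y ∈ V := fun y hy =>
    ⟨by simpa using hy.1.1, by simpa using hy.1.2, hy.2⟩
  have hxV' : κ' x ∈ V' := by
    refine ⟨⟨by simpa using κ'.map_source hx', ?_⟩, ?_⟩
    · simpa [κ'.left_inv hx'] using hx
    · simpa [κ'.left_inv hx'] using hxV
  have hsymm : ∀ y ∈ V', e.symm (τ y) = e'.symm y := fun y hy => by
    rw [← hκ'.apply_symm (hV' y hy).1]
    exact hκ.symm_apply (hV' y hy).2.1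
  have hτe : EqOn τ (e ∘ e'.symm) V' := fun y hy => by
    have h1 := (hκ _ (hV' y hy).2.1).2
    rw [hκ'.apply_symm (hV' y hy).1] at h1
    exact h1
  have hτ : ContDiffOn ℝ ∞ τ V' := by
    refine ((contDiffOn_transition he' he).mono fun y hy => ⟨hκ'.mem_target (hV' y hy).1, ?_⟩).congr
      hτe
    rw [mem_preimage, ← hκ'.apply_symm (hV' y hy).1]
    exact (hκ _ (hV' y hy).2.1).1
  have hsub : V' ⊆ chartDomain z w e' := fun y hy => by
    refine ⟨hκ'.mem_target (hV' y hy).1, ?_⟩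
    rw [mem_preimage, ← hsymm y hy]
    exact (hV (hV' y hy).2.2).2
  have H := (D.pick e' he').mono hV'o hsub
  have heq : ∀ {E : Type} (f : S → E), ∀ y ∈ V', (f ∘ e.symm) ∘ τ =ᶠ[𝓝 y] f ∘ e'.symm :=
    fun f y hy => by
      filter_upwards [hV'o.mem_nhds hy] with y' hy'
      exact congrArg f (hsymm y' hy')
  have hJ : ∀ y ∈ V', jac ((z ∘ e.symm) ∘ τ) ((w ∘ e.symm) ∘ τ) y ≠ 0 := fun y hy => by
    simp only [jac, pd_congr _ (heq z y hy), pd_congr _ (heq w y hy)]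
    exact H.jac_ne y hy
  have hEqs : ∀ y ∈ V', StructureEqs (z ∘ e'.symm) (w ∘ e'.symm) (l ∘ e'.symm) (φ ∘ e'.symm)
      (ψ ∘ e'.symm) (s ∘ τ) y := fun y hy =>
    (StructureEqs.comp ((D.pick e he).mono hVo hV).toNullMetric hs h hV'o hτ
      (fun y hy => (hV' y hy).2.2) hJ hy).congr (heq z y hy) (heq w y hy) (heq l y hy)
      (heq φ y hy).eq_of_nhds (heq ψ y hy).eq_of_nhds .rfl
  have hsτ : ContDiffOn ℝ ∞ (s ∘ τ) V' := hs.comp hτ fun y hy => (hV' y hy).2.2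
  exact ⟨hsτ.contDiffAt (hV'o.mem_nhds hxV'), H.sphereAt_of_structureEqs hsτ hEqs hxV'⟩

theorem CoordinateData.exists_sphere [IsManifold (𝓡 2) ∞ S] (hG : GaussEquation g Q₁ Q₂)
    (he : e ∈ atlas Plane S) (hκ : IsLift p e κ)
    (hx : x ∈ κ.source) (hpx : p x ∈ z.source ∩ w.source) :
    ∃ σ : M → C3, ∀ᶠ y in 𝓝 x, IsSphereNear p g (Q₁ + Q₂) σ y := by
  have hxU : κ x ∈ chartDomain z w e := ⟨hκ.mem_target (κ.map_source hx), by
    rwa [mem_preimage, hκ.symm_apply hx]⟩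
  obtain ⟨V, hV, hVo, hxV, s, hs, h⟩ := (D.pick e he).exists_structureEqs
    (fun y hy => (D.gauss_iff he hy).1 (hG e he y hy.1)) hxU
  refine ⟨s ∘ κ, ?_⟩
  filter_upwards [(κ.isOpen_inter_preimage hVo).mem_nhds ⟨hx, hxV⟩] with x' hx'
  exact D.isSphereNear_of_structureEqs he hκ hVo hV hs h hx'.1 hx'.2

end Local

end Spheres

end CAS
end

noncomputable section

namespace CAS

/-! ### Global uniqueness, holonomy and existence -/

section Global

variable {S M : Type*} [TopologicalSpace S] [ChartedSpace Plane S] [TopologicalSpace M]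
  {p : M → S} {g : CTensor S 2} {C Q₁ Q₂ : CTensor S 3} {σ σ' : M → C3}

/-- The standard action of `SL(3, ℂ)` on `ℂ³`. -/
abbrev specialLinearAction : MulAction (Matrix.SpecialLinearGroup (Fin 3) ℂ) C3 where
  smul A v := A.1.mulVec v
  one_smul v := Matrix.one_mulVec v
  mul_smul A B v := (Matrix.mulVec_mulVec v A.1 B.1).symm

variable (g Q₁ Q₂) in
/-- The surface is covered by coordinates in which `g = l dz dw`, `Q₁ = φ dz³`, `Q₂ = ψ dw³`. -/
def HasCoordinateData : Prop :=
  ∀ x, ∃ (z w : OpenPartialHomeomorph S ℂ) (l φ ψ : S → ℂ), x ∈ z.source ∩ w.source ∧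
    CoordinateData z w l φ ψ g Q₁ Q₂

variable (D : HasCoordinateData g Q₁ Q₂) (hp : IsLocalHomeomorph p)
include D hp

theorem HasCoordinateData.existsUnique_local {x : M}
    (hσ : ∀ᶠ x' in 𝓝 x, IsSphereNear p g (Q₁ + Q₂) σ x')
    (hσ' : ∀ᶠ x' in 𝓝 x, IsSphereNear p g (Q₁ + Q₂) σ' x') :
    ∃! A : Matrix.SpecialLinearGroup (Fin 3) ℂ, ∀ᶠ y in 𝓝 x, σ' y = A.1.mulVec (σ y) := by
  obtain ⟨z, w, l, φ, ψ, hx, D'⟩ := D (p x)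
  obtain ⟨κ, hκ, hxκ⟩ := exists_isLift hp (mem_chart_source Plane (p x))
  exact D'.existsUnique_mulVec (chart_mem_atlas Plane (p x)) hκ hxκ hx hσ hσ'

/-- Affine spheres with the same invariants differ by a unique element of `SL(3, ℂ)`. -/
theorem HasCoordinateData.existsUnique_global [ConnectedSpace M]
    (hσ : ∀ x, IsSphereNear p g (Q₁ + Q₂) σ x) (hσ' : ∀ x, IsSphereNear p g (Q₁ + Q₂) σ' x) :
    ∃! A : Matrix.SpecialLinearGroup (Fin 3) ℂ, ∀ x, σ' x = A.1.mulVec (σ x) := by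
  have hloc := fun x => D.existsUnique_local hp (x := x) (.of_forall hσ) (.of_forall hσ')
  obtain ⟨x₀⟩ : Nonempty M := inferInstance
  obtain ⟨A, hA, huniq⟩ := hloc x₀
  -- The set where the germ of σ' is A times that of σ is open by definition. It is closed since the
  -- matrix B at a limit point also works at nearby points, where uniqueness forces B = A.
  have hclopen : IsClopen {x | ∀ᶠ y in 𝓝 x, σ' y = A.1.mulVec (σ y)} := by
    refine ⟨⟨isOpen_iff_mem_nhds.2 fun x hx => ?_⟩, isOpen_iff_mem_nhds.2 fun x hx => hx.eventually_nhds⟩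
    obtain ⟨B, hB, -⟩ := hloc x
    filter_upwards [hB.eventually_nhds] with y hy hAy
    have hBA : B = A := (hloc y).unique hy hAy
    exact hx (hBA ▸ hB)
  have huniv := hclopen.eq_univ ⟨x₀, hA⟩
  exact ⟨A, fun x => (huniv ▸ mem_univ x : x ∈ {x | ∀ᶠ y in 𝓝 x, σ' y = A.1.mulVec (σ y)}).self_of_nhds,
    fun B hB => huniq B (.of_forall hB)⟩

/-- For a deck transformation d, σ ∘ d is a sphere with the same invariants, so it equals ρ(d)σ for
a unique ρ(d). Uniqueness also makes ρ multiplicative. -/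
theorem HasCoordinateData.isEquivariant [ConnectedSpace M]
    (hσ : ∀ x, IsSphereNear p g (Q₁ + Q₂) σ x) : IsEquivariant p σ σ := by
  have key := fun d : deckGroup p => D.existsUnique_global hp hσ
    (σ' := σ ∘ d.1) fun x => (hσ (d.1 x)).comp_deck d.2
  choose ρ hρ huniq using key
  refine ⟨MonoidHom.mk' ρ fun d d' => ?_, fun d x => ⟨hρ d x, hρ d x⟩⟩
  refine (huniq _ _ fun x => ?_).symm
  have h1 := hρ d (d'.1 x)
  rw [show σ (d'.1 x) = _ from hρ d' x, Matrix.mulVec_mulVec] at h1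
  exact h1

theorem HasCoordinateData.gauss_of_sphere (hs : Function.Surjective p)
    (hσ : ∀ x, IsSphereNear p g (Q₁ + Q₂) σ x) : GaussEquation g Q₁ Q₂ := by
  intro e he y hy
  obtain ⟨κ, hκ, hyκ⟩ := exists_isLift_of_target hp hs hy
  obtain ⟨z, w, l, φ, ψ, hx, D'⟩ := D (p (κ.symm y))
  have := D'.gauss_of_sphere he hκ (κ.map_target hyκ) hx (.of_forall hσ)
  rwa [κ.right_inv hyκ] at this

theorem HasCoordinateData.exists_sphere [IsManifold (𝓡 2) ∞ S] [SimplyConnectedSpace M]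
    (hG : GaussEquation g Q₁ Q₂) : ∃ σ : M → C3, ∀ x, IsSphereNear p g (Q₁ + Q₂) σ x := by
  have : LocallyPathConnectedSpace M := locallyPathConnectedSpace_of_isLocalHomeomorph hp
  let _ := specialLinearAction
  refine exists_global_of_local (G := Matrix.SpecialLinearGroup (Fin 3) ℂ)
    (IsSphereNear p g (Q₁ + Q₂)) (fun s s' x h hs => hs.congr h) (fun A s x hs => hs.mulVec A)
    (fun x => ?_) fun s s' x hs hs' => D.existsUnique_local hp hs hs'
  obtain ⟨z, w, l, φ, ψ, hx, D'⟩ := D (p x)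
  obtain ⟨κ, hκ, hxκ⟩ := exists_isLift hp (mem_chart_source Plane (p x))
  exact D'.exists_sphere hG (chart_mem_atlas Plane (p x)) hκ hxκ hx

theorem HasCoordinateData.exists_isEquivariantCAS_iff [IsManifold (𝓡 2) ∞ S]
    [SimplyConnectedSpace M] (hs : Function.Surjective p) (hg : IsPositiveComplexMetric g) :
    (∃ σ : M → C3, IsEquivariantCAS p g (Q₁ + Q₂) σ) ↔ GaussEquation g Q₁ Q₂ := by
  constructor
  · rintro ⟨σ, h⟩
    exact D.gauss_of_sphere hp hs (isEquivariantCAS_iff.1 h).2.1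
  · intro hG
    obtain ⟨σ, hσ⟩ := D.exists_sphere hp hG
    exact ⟨σ, isEquivariantCAS_iff.2 ⟨hg, hσ, D.isEquivariant hp hσ⟩⟩

end Global

end CAS
end

noncomputable section

namespace CAS

/-! ### Metrics in the given conformal class -/

section ConformalClass

variable {S : Type*} [TopologicalSpace S] [ChartedSpace Plane S] [IsManifold (𝓡 2) ∞ S]
  {c₁ c₂ : ComplexStructure S} {z w : OpenPartialHomeomorph S ℂ}
  {e : OpenPartialHomeomorph S Plane} {y : Plane} {g h : CTensor S 2} {u : S → ℂ}

/-- The matrix only records values on coordinate vectors. Real multilinearity, applied in a basis of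
the plane, recovers the tensor identity on all tangent vectors. -/
theorem apply_eq_of_isNullForm (hz : z ∈ c₁.charts) (hw : w ∈ c₂.charts) (he : e ∈ atlas Plane S)
    (hy : y ∈ chartDomain z w e) {a : ℂ}
    (hG : IsNullForm (gram g e y) a (fun i => pd i (z ∘ e.symm) y) (fun i => pd i (w ∘ e.symm) y))
    (v v' : TangentSpace (𝓡 2) (e.symm y)) : g (e.symm y) ![v, v'] = a * ((1 / 2) *
      (dcoord z (e.symm y) v * dcoord w (e.symm y) v' +
        dcoord w (e.symm y) v * dcoord z (e.symm y) v')) := by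
  obtain ⟨b, rfl⟩ := exists_eq_mfderiv_symm he hy.1 v
  obtain ⟨b', rfl⟩ := exists_eq_mfderiv_symm he hy.1 v'
  rw [dcoord_mfderiv_symm hz he hy.1 hy.2.1, dcoord_mfderiv_symm hz he hy.1 hy.2.1,
    dcoord_mfderiv_symm hw he hy.1 hy.2.2, dcoord_mfderiv_symm hw he hy.1 hy.2.2]
  set Z : Plane →ₗ[ℝ] ℂ := (fderiv ℝ (z ∘ e.symm) y).toLinearMap
  set W : Plane →ₗ[ℝ] ℂ := (fderiv ℝ (w ∘ e.symm) y).toLinearMap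
  set P : MultilinearMap ℝ (fun _ : Fin 2 => ℂ) ℂ := MultilinearMap.mkPiAlgebra ℝ (Fin 2) ℂ
  set L : Plane →ₗ[ℝ] TangentSpace (𝓡 2) (e.symm y) :=
    (mfderiv (𝓡 2) (𝓡 2) e.symm y).toLinearMap
  have key : (g (e.symm y)).compLinearMap (fun _ => L) =
      a • ((1 / 2 : ℂ) • (P.compLinearMap ![Z, W] + P.compLinearMap ![W, Z])) := by
    refine Module.Basis.ext_multilinear
      (fun _ => (EuclideanSpace.basisFun (Fin 2) ℝ).toBasis) fun i => ?_
    have h1 := hG (i 0) (i 1)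
    have h2 : ![i 0, i 1] = i := by
      funext b
      fin_cases b <;> rfl
    rw [gram, Matrix.of_apply, h2] at h1
    simp only [smul_apply, add_apply,
      MultilinearMap.compLinearMap_apply, P, MultilinearMap.mkPiAlgebra_apply,
      Fin.prod_univ_two, smul_eq_mul, OrthonormalBasis.coe_toBasis, EuclideanSpace.basisFun_apply]
    exact h1
  have h3 := DFunLike.congr_fun key ![b, b']
  simp only [smul_apply, add_apply,
    MultilinearMap.compLinearMap_apply, P, MultilinearMap.mkPiAlgebra_apply,
    Fin.prod_univ_two, smul_eq_mul] at h3
  refine Eq.trans ?_ h3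
  congr 1
  funext b
  fin_cases b <;> rfl

/-- Given smoothness, membership in the class (c₁, c₂) already implies non-degeneracy and
positivity, because c₁ and c₂ have opposite orientations. -/
theorem HasConformalClass.isPositiveComplexMetric (hc₁ : c₁.IsCompatible)
    (hc₂ : c₂.IsAntiCompatible) (hg : g.IsSmooth) (hgc : HasConformalClass g c₁ c₂) :
    IsPositiveComplexMetric g := by
  have key : ∀ e ∈ atlas Plane S, ∀ y ∈ e.target, (gram g e y).det ≠ 0 ∧
      IsPositiveForm (gram g e y) := by
    intro e he y hy
    obtain ⟨z, hz, hxz⟩ := c₁.cover (e.symm y)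
    obtain ⟨w, hw, hxw⟩ := c₂.cover (e.symm y)
    obtain ⟨l, hl, h⟩ := hgc z hz w hw _ ⟨hxz, hxw⟩
    have hN := isNullForm_gram hz hw he ⟨hy, hxz, hxw⟩ h
    have hZ := hc₁.side_pos hz he hy hxz
    have hW := hc₂.side_neg hw he hy hxw
    refine ⟨?_, hN.isPositiveForm hl hZ hW⟩
    rw [hN.det]
    exact neg_ne_zero.2 (mul_ne_zero (div_ne_zero (pow_ne_zero 2 hl) (by norm_num))
      (pow_ne_zero 2 (jac_ne_zero_of_side hZ hW)))
  refine ⟨fun x v v' => ?_, hg, fun e he y hy => (key e he y hy).1,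
    fun e he y hy => (key e he y hy).2⟩
  obtain ⟨z, hz, hxz⟩ := c₁.cover x
  obtain ⟨w, hw, hxw⟩ := c₂.cover x
  obtain ⟨l, -, h⟩ := hgc z hz w hw _ ⟨hxz, hxw⟩
  rw [h, h]
  ring

omit [IsManifold (𝓡 2) ∞ S] in
theorem HasConformalClass.conformalMetric (hh : HasConformalClass h c₁ c₂) :
    HasConformalClass (conformalMetric u h) c₁ c₂ := by
  intro z hz w hw x hx
  obtain ⟨l, hl, H⟩ := hh z hz w hw x hx
  refine ⟨Complex.exp (2 * u x) * l, mul_ne_zero (Complex.exp_ne_zero _) hl, fun v v' => ?_⟩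
  rw [CAS.conformalMetric, smul_apply, H, smul_eq_mul, mul_assoc]

omit [IsManifold (𝓡 2) ∞ S] in
theorem gram_conformalMetric : gram (conformalMetric u h) e =
    fun y => Complex.exp (2 * (u ∘ e.symm) y) • gram h e y := rfl

theorem contDiffOn_comp_symm (hu : ContMDiff (𝓡 2) 𝓘(ℝ, ℂ) ∞ u) (he : e ∈ atlas Plane S) :
    ContDiffOn ℝ ∞ (u ∘ e.symm) e.target := by
  simpa using contDiffOn_comp_chart_symm he (hu.contMDiffOn (s := univ))

theorem CTensor.IsSmooth.conformalMetric (hu : ContMDiff (𝓡 2) 𝓘(ℝ, ℂ) ∞ u) (hh : h.IsSmooth) :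
    (conformalMetric u h).IsSmooth := fun e he i =>
  ((contDiffOn_const.mul (contDiffOn_comp_symm hu he)).cexp).mul (hh e he i)

-- The pairing of cubic tensors uses three copies of the inverse metric, each contributing e^{−2u}.
omit [IsManifold (𝓡 2) ∞ S] in
theorem cubicPairing_conformalMetric (Q₁ Q₂ : CTensor S 3) (hdet : (gram h e y).det ≠ 0) :
    cubicPairing (conformalMetric u h) Q₁ Q₂ e y =
      Complex.exp (-6 * u (e.symm y)) * cubicPairing h Q₁ Q₂ e y := by
  have hinv : (gram (conformalMetric u h) e y)⁻¹ =
      Complex.exp (-2 * u (e.symm y)) • (gram h e y)⁻¹ := by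
    rw [gram_conformalMetric]
    refine Matrix.inv_eq_right_inv ?_
    rw [Matrix.smul_mul, Matrix.mul_smul, smul_smul, ← Complex.exp_add,
      Matrix.mul_nonsing_inv _ (isUnit_iff_ne_zero.2 hdet)]
    simp
  have hexp : Complex.exp (-6 * u (e.symm y)) = Complex.exp (-2 * u (e.symm y)) ^ 3 := by
    rw [← Complex.exp_nat_mul]
    congr 1
    push_cast
    ring
  simp only [cubicPairing, hinv, Finset.mul_sum, Matrix.smul_apply, smul_eq_mul, Finset.prod_mul_distrib,
    Finset.prod_const, Finset.card_univ, Fintype.card_fin, hexp, mul_assoc]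

end ConformalClass

end CAS
end

noncomputable section

namespace CAS

/-! ### Bers metrics -/

section Bers

variable {S M : Type*} [TopologicalSpace S] [ChartedSpace Plane S] [IsManifold (𝓡 2) ∞ S]
  [TopologicalSpace M] {p : M → S} {c c₁ c₂ : ComplexStructure S}
  {z w : OpenPartialHomeomorph S ℂ} {e : OpenPartialHomeomorph S Plane}
  {κ : OpenPartialHomeomorph M Plane} {y : Plane} {f : M → ℂ} {h : CTensor S 2} {u : S → ℂ}
  {Q₁ Q₂ : CTensor S 3}

/-- Locally f is an injective holomorphic function F of z, so df = F'(z) dz with F' nowhere zero.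
Hence f can replace z as a null coordinate. -/
theorem HolomorphicOnCover.exists_pd_eq (hp : IsLocalHomeomorph p)
    (hf : HolomorphicOnCover p c f) (hinj : Function.Injective f) (hz : z ∈ c.charts)
    (he : e ∈ atlas Plane S) (hκ : IsLift p e κ) (hy : y ∈ κ.target)
    (hyz : e.symm y ∈ z.source) : ContDiffAt ℝ ∞ (f ∘ κ.symm) y ∧
      ∃ a : ℂ, a ≠ 0 ∧ ∀ i, pd i (f ∘ κ.symm) y = a * pd i (z ∘ e.symm) y := by
  have hpz : p (κ.symm y) ∈ z.source := by rwa [hκ.apply_symm hy]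
  obtain ⟨ζ, hζ, hxζ⟩ := exists_isLift hp hpz
  have hζy : z (e.symm y) ∈ ζ.target := by
    rw [← hκ.apply_symm hy, ← (hζ _ hxζ).2]
    exact ζ.map_source hxζ
  have hev : (f ∘ ζ.symm) ∘ (z ∘ e.symm) =ᶠ[𝓝 y] f ∘ κ.symm := by
    filter_upwards [(κ.symm.isOpen_inter_preimage ζ.open_source).mem_nhds ⟨hy, hxζ⟩] with y' hy'
    have h1 := (hζ _ hy'.2).2
    rw [hκ.apply_symm hy'.1] at h1
    simp only [Function.comp_apply]
    rw [← h1, ζ.left_inv hy'.2]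
  have hF := hf z hz ζ hζ
  have hFi : InjOn (f ∘ ζ.symm) ζ.target := fun a ha b hb hab =>
    ζ.symm.injOn ha hb (hinj hab)
  have hzs := (c.contDiffOn hz he).contDiffAt
    ((e.symm.isOpen_inter_preimage z.open_source).mem_nhds ⟨hκ.mem_target hy, hyz⟩)
  refine ⟨?_, deriv (f ∘ ζ.symm) (z (e.symm y)),
    deriv_ne_zero_of_injOn ζ.open_target hF hFi hζy, fun i => ?_⟩
  · have hFs : ContDiffAt ℝ ∞ (f ∘ ζ.symm) (z (e.symm y)) :=
      ((hF.contDiffOn (n := ∞) ζ.open_target).contDiffAt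
        (ζ.open_target.mem_nhds hζy)).restrict_scalars ℝ
    exact (hFs.comp y hzs).congr_of_eventuallyEq hev.symm
  · rw [← pd_congr i hev]
    exact pd_comp_holomorphic i (hF.differentiableAt (ζ.open_target.mem_nhds hζy))
      (hzs.differentiableAt (by simp))

theorem IsNullForm.of_smul {G : Matrix (Fin 2) (Fin 2) ℂ} {l a b : ℂ} {Z W Z' W' : Fin 2 → ℂ}
    (hG : IsNullForm G l Z' W') (hZ : ∀ i, Z' i = a * Z i) (hW : ∀ i, W' i = b * W i) :
    IsNullForm G (l * (a * b)) Z W := by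
  intro i j
  rw [hG, hZ, hZ, hW, hW]
  ring

/-- The data which a Bers metric provides on a covering surface. -/
structure BersData (p : M → S) (c₁ c₂ : ComplexStructure S) (h : CTensor S 2) (f₁ f₂ : M → ℂ) :
    Prop where
  holomorphic_left : HolomorphicOnCover p c₁ f₁
  holomorphic_right : HolomorphicOnCover p c₂ f₂
  injective_left : Function.Injective f₁
  injective_right : Function.Injective f₂
  ne : ∀ x x', f₁ x ≠ f₂ x'
  gram_eq : ∀ e ∈ atlas Plane S, ∀ κ : OpenPartialHomeomorph M Plane, IsLift p e κ →
    ∀ y ∈ κ.target, IsNullForm (gram h e y) (-4 / (f₁ (κ.symm y) - f₂ (κ.symm y)) ^ 2)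
      (fun i => pd i (f₁ ∘ κ.symm) y) (fun i => pd i (f₂ ∘ κ.symm) y)

omit [IsManifold (𝓡 2) ∞ S] in
theorem IsBersMetric.exists_bersData (hh : IsBersMetric p c₁ c₂ h) :
    ∃ f₁ f₂ : M → ℂ, BersData p c₁ c₂ h f₁ f₂ := by
  obtain ⟨γ, ρ, f₁, f₂, -, -, -, ⟨h1, h2⟩, ⟨i1, i2⟩, hd, -, -, hG⟩ := hh
  exact ⟨f₁, f₂, h1, h2, i1, i2, fun x x' hx =>
    disjoint_left.1 hd (mem_range_self x) (hx ▸ mem_range_self x'), hG⟩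

namespace BersData

variable {f₁ f₂ : M → ℂ} (B : BersData p c₁ c₂ h f₁ f₂) (hp : IsLocalHomeomorph p)
  (hc₁ : c₁.IsCompatible) (hc₂ : c₂.IsAntiCompatible)
include B hp

theorem exists_isNullForm (hz : z ∈ c₁.charts) (hw : w ∈ c₂.charts) (he : e ∈ atlas Plane S)
    (hκ : IsLift p e κ) (hy : y ∈ κ.target) (hyz : e.symm y ∈ z.source)
    (hyw : e.symm y ∈ w.source) : ∃ a : ℂ, a ≠ 0 ∧
      IsNullForm (gram h e y) a (fun i => pd i (z ∘ e.symm) y) (fun i => pd i (w ∘ e.symm) y) := by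
  obtain ⟨-, a, ha, hZ⟩ :=
    B.holomorphic_left.exists_pd_eq hp B.injective_left hz he hκ hy hyz
  obtain ⟨-, b, hb, hW⟩ :=
    B.holomorphic_right.exists_pd_eq hp B.injective_right hw he hκ hy hyw
  refine ⟨_, mul_ne_zero (div_ne_zero (by norm_num) (pow_ne_zero 2 (sub_ne_zero.2 (B.ne _ _))))
    (mul_ne_zero ha hb), (B.gram_eq e he κ hκ y hy).of_smul hZ hW⟩

theorem hasConformalClass (hs : Function.Surjective p) : HasConformalClass h c₁ c₂ := by
  intro z hz w hw x hx
  obtain ⟨e, he, y, hy, rfl⟩ : ∃ e ∈ atlas Plane S, ∃ y ∈ e.target, e.symm y = x :=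
    ⟨chartAt Plane x, chart_mem_atlas _ x, chartAt Plane x x, mem_chart_target Plane x,
      (chartAt Plane x).left_inv (mem_chart_source _ x)⟩
  obtain ⟨κ, hκ, hyκ⟩ := exists_isLift_of_target hp hs hy
  obtain ⟨a, ha, hN⟩ := B.exists_isNullForm hp hz hw he hκ hyκ hx.1 hx.2
  exact ⟨a, ha, apply_eq_of_isNullForm hz hw he ⟨hy, hx⟩ hN⟩

-- The maps f₁ and f₂ serve as null coordinates on the whole lifted chart. In them h is the model
-- metric of curvature −1.
include hc₁ hc₂ in
theorem nullMetric (he : e ∈ atlas Plane S) (hκ : IsLift p e κ) :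
    NullMetric κ.target (f₁ ∘ κ.symm) (f₂ ∘ κ.symm)
      (fun y => -4 / ((f₁ ∘ κ.symm) y - (f₂ ∘ κ.symm) y) ^ 2) (gram h e) := by
  have key : ∀ y ∈ κ.target, ContDiffAt ℝ ∞ (f₁ ∘ κ.symm) y ∧ ContDiffAt ℝ ∞ (f₂ ∘ κ.symm) y ∧
      jac (f₁ ∘ κ.symm) (f₂ ∘ κ.symm) y ≠ 0 := by
    intro y hy
    obtain ⟨z, hz, hyz⟩ := c₁.cover (e.symm y)
    obtain ⟨w, hw, hyw⟩ := c₂.cover (e.symm y)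
    obtain ⟨s1, a, ha, hZ⟩ :=
      B.holomorphic_left.exists_pd_eq hp B.injective_left hz he hκ hy hyz
    obtain ⟨s2, b, hb, hW⟩ :=
      B.holomorphic_right.exists_pd_eq hp B.injective_right hw he hκ hy hyw
    refine ⟨s1, s2, ?_⟩
    have hJ := jac_ne_zero_of_side (hc₁.side_pos hz he (hκ.mem_target hy) hyz)
      (hc₂.side_neg hw he (hκ.mem_target hy) hyw)
    rw [jac, hZ, hZ, hW, hW]
    have : a * pd 0 (z ∘ e.symm) y * (b * pd 1 (w ∘ e.symm) y) -
        a * pd 1 (z ∘ e.symm) y * (b * pd 0 (w ∘ e.symm) y) = a * b *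
        (pd 0 (z ∘ e.symm) y * pd 1 (w ∘ e.symm) y - pd 1 (z ∘ e.symm) y * pd 0 (w ∘ e.symm) y) := by
      ring
    rw [this]
    exact mul_ne_zero (mul_ne_zero ha hb) hJ
  have hne : ∀ y, (f₁ ∘ κ.symm) y - (f₂ ∘ κ.symm) y ≠ 0 := fun y => sub_ne_zero.2 (B.ne _ _)
  have s1 : ContDiffOn ℝ ∞ (f₁ ∘ κ.symm) κ.target := fun y hy => (key y hy).1.contDiffWithinAt
  have s2 : ContDiffOn ℝ ∞ (f₂ ∘ κ.symm) κ.target := fun y hy => (key y hy).2.1.contDiffWithinAt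
  exact ⟨⟨κ.open_target, s1, s2, fun y hy => (key y hy).2.2⟩,
    contDiffOn_div contDiffOn_const ((s1.sub s2).pow 2) fun y _ => pow_ne_zero 2 (hne y),
    fun y _ => div_ne_zero (by norm_num) (pow_ne_zero 2 (hne y)), B.gram_eq e he κ hκ⟩

include hc₁ hc₂ in
theorem isSmooth (hs : Function.Surjective p) : h.IsSmooth := by
  intro e he i y hy
  obtain ⟨κ, hκ, hyκ⟩ := exists_isLift_of_target hp hs hy
  have N := B.nullMetric hp hc₁ hc₂ he hκ
  have h1 : ContDiffOn ℝ ∞ (fun y => gram h e y (i 0) (i 1)) κ.target := by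
    refine ContDiffOn.congr ?_ fun y hy => N.form y hy (i 0) (i 1)
    have dz := fun i => N.smooth_pd i N.smooth_z
    have dw := fun i => N.smooth_pd i N.smooth_w
    exact N.smooth_l.mul (contDiffOn_const.mul
      (((dz (i 0)).mul (dw (i 1))).add ((dw (i 0)).mul (dz (i 1)))))
  have h2 : ![i 0, i 1] = i := by
    funext b
    fin_cases b <;> rfl
  have h3 := (h1.contDiffAt (κ.open_target.mem_nhds hyκ)).contDiffWithinAt (s := e.target)
  simpa only [gram, Matrix.of_apply, h2] using h3

-- The Gauss equation for e^{2u}h reads e^{−2u}(−1 − Δ_h u) = −1 + ¼ e^{−6u} h(Q₁, Q₂). Multiplying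
-- by the nowhere vanishing e^{2u} gives the equation for u.
include hc₁ hc₂ in
theorem gaussEquation_conformalMetric_iff (hs : Function.Surjective p)
    (hu : ContMDiff (𝓡 2) 𝓘(ℝ, ℂ) ∞ u) :
    GaussEquation (conformalMetric u h) Q₁ Q₂ ↔ GaussPDE h Q₁ Q₂ u := by
  refine forall₂_congr fun e he => forall₂_congr fun y hy => ?_
  obtain ⟨κ, hκ, hyκ⟩ := exists_isLift_of_target hp hs hy
  have N := B.nullMetric hp hc₁ hc₂ he hκ
  have hu' : ContDiffOn ℝ ∞ (u ∘ e.symm) κ.target :=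
    (contDiffOn_comp_symm hu he).mono fun y hy => hκ.mem_target hy
  have hdet : (gram h e y).det ≠ 0 := by
    rw [(N.form y hyκ).det]
    exact neg_ne_zero.2 (mul_ne_zero (div_ne_zero (pow_ne_zero 2 (N.l_ne y hyκ)) (by norm_num))
      (pow_ne_zero 2 (N.jac_ne y hyκ)))
  rw [cubicPairing_conformalMetric Q₁ Q₂ hdet, gram_conformalMetric,
    N.curvature_exp_smul hu' hyκ, N.curvature_eq_neg_one (fun y _ => B.ne _ _) hyκ]
  set E := Complex.exp (u (e.symm y)) with hE
  have hE0 : E ≠ 0 := Complex.exp_ne_zero _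
  have e2 : Complex.exp (2 * u (e.symm y)) = E ^ 2 := by
    rw [hE, ← Complex.exp_nat_mul]; norm_num
  have e4 : Complex.exp (-4 * u (e.symm y)) = (E ^ 4)⁻¹ := by
    rw [hE, ← Complex.exp_nat_mul, ← Complex.exp_neg]; norm_num
  have e6 : Complex.exp (-6 * u (e.symm y)) = (E ^ 6)⁻¹ := by
    rw [hE, ← Complex.exp_nat_mul, ← Complex.exp_neg]; norm_num
  have e2' : Complex.exp (-(2 * (u ∘ e.symm) y)) = (E ^ 2)⁻¹ := by
    rw [Complex.exp_neg, ← e2]; rfl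
  rw [e2, e4, e6, e2']
  generalize laplacian (gram h e) (u ∘ e.symm) y = L
  generalize cubicPairing h Q₁ Q₂ e y = K
  field_simp
  constructor <;> intro H <;> linear_combination (-1 : ℂ) * H

end BersData

end Bers

end CAS
end

/-! ### The main theorem -/

theorem mainTheorem7 {S M : Type*}
    -- `S` is a closed oriented (smooth) surface
    [TopologicalSpace S] [T2Space S] [CompactSpace S] [ConnectedSpace S]
    [ChartedSpace Plane S] [IsManifold (𝓡 2) ∞ S] (hS : IsOrientedAtlas S)
    -- `p : M → S` is its universal covering
    [TopologicalSpace M] [SimplyConnectedSpace M]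
    (p : M → S) (hp : IsCoveringMap p) (hp_surj : Function.Surjective p)
    -- complex structures on `S` and on the oppositely oriented surface
    (c₁ c₂ : ComplexStructure S) (hc₁ : c₁.IsCompatible) (hc₂ : c₂.IsAntiCompatible)
    -- holomorphic cubic differentials
    (Q₁ Q₂ : CTensor S 3) (hQ₁ : IsHolomorphicCubic c₁ Q₁) (hQ₂ : IsHolomorphicCubic c₂ Q₂) :
    (∀ g : CTensor S 2, IsPositiveComplexMetric g → HasConformalClass g c₁ c₂ →
      ((∃ σ : M → C3, IsEquivariantCAS p g (Q₁ + Q₂) σ) ↔ GaussEquation g Q₁ Q₂) ∧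
      (∀ σ σ' : M → C3, IsEquivariantCAS p g (Q₁ + Q₂) σ → IsEquivariantCAS p g (Q₁ + Q₂) σ' →
        ∃ A : Matrix.SpecialLinearGroup (Fin 3) ℂ, ∀ x, σ' x = A.1.mulVec (σ x))) ∧
    (∀ (h : CTensor S 2) (u : S → ℂ), IsBersMetric p c₁ c₂ h →
      ContMDiff (𝓡 2) 𝓘(ℝ, ℂ) ∞ u →
      ((∃ σ : M → C3, IsEquivariantCAS p (conformalMetric u h) (Q₁ + Q₂) σ) ↔
        GaussPDE h Q₁ Q₂ u)) := by
  have hp' := hp.isLocalHomeomorph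
  have hD : ∀ g : CTensor S 2, IsPositiveComplexMetric g → HasConformalClass g c₁ c₂ →
      HasCoordinateData g Q₁ Q₂ := fun g hg hgc x =>
    exists_coordinateData hc₁ hc₂ hQ₁ hQ₂ hg.smooth hgc x
  refine ⟨fun g hg hgc => ⟨(hD g hg hgc).exists_isEquivariantCAS_iff hp' hp_surj hg,
    fun σ σ' hσ hσ' => ?_⟩, fun h u hh hu => ?_⟩
  · obtain ⟨A, hA, -⟩ := (hD g hg hgc).existsUnique_global hp' (isEquivariantCAS_iff.1 hσ).2.1
      (isEquivariantCAS_iff.1 hσ').2.1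
    exact ⟨A, hA⟩
  · obtain ⟨f₁, f₂, B⟩ := hh.exists_bersData
    -- The metric e^{2u}h stays in the class (c₁, c₂) and is smooth, hence is a positive complex
    -- metric, and the Gauss equation criterion applies to it.
    have hgc := (B.hasConformalClass hp' hp_surj).conformalMetric (u := u)
    have hg := hgc.isPositiveComplexMetric hc₁ hc₂
      ((B.isSmooth hp' hc₁ hc₂ hp_surj).conformalMetric hu)
    rw [(hD _ hg hgc).exists_isEquivariantCAS_iff hp' hp_surj hg,
      B.gaussEquation_conformalMetric_iff hp' hc₁ hc₂ hp_surj hu]
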